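/- Let $X=\mathbb C^N$ and let $\mathcal C$ be a central arrangement in $X$, that is, a finite set of hyperplanes through $0$. The strata of $\mathcal C$ are labelled by the set $I$ of their closures $X_\alpha$, which are the intersections of hyperplanes of $\mathcal C$ (the empty intersection is $X$). Let $l(\alpha)$ be the codimension of $X_\alpha$, and write $\alpha\succ\beta$ if $X_\beta\subset X_\alpha$ and $l(\beta)=l(\alpha)+1$. Vertices $\alpha,\beta$ are adjacent if $\alpha\succ\beta$ or $\beta\succ\alpha$. A *quiver* $\mathcal V=\{V_\alpha,A_{\alpha,\beta}\}$ of $\mathcal C$ consists of finite-dimensional complex vector spaces $V_\alpha$, $\alpha\in I$, and linear maps $A_{\alpha,\beta}:V_\beta\to V_\alpha$ such that (a) $A_{\alpha,\beta}=0$ if $\alpha,\beta$ are not adjacent; (b) $\sum_\beta A_{\alpha,\beta}A_{\beta,\gamma}=0$ if $|l(\alpha)-l(\gamma)|=2$; (c) $\sum_\beta A_{\alpha,\beta}A_{\beta,\gamma}=0$ if $\alpha\ne\gamma$, $l(\alpha)=l(\gamma)$, and there is $\delta$ with $\alpha\succ\delta$ and $\gamma\succ\delta$. Its quiver complex $C_+(\mathcal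 V)$ has the terms $C_k(\mathcal V)=\bigoplus_{l(\alpha)=k}V_\alpha$ in degree $k$ and the differential $v\mapsto\sum_{\beta:\alpha\succ\beta}A_{\beta,\alpha}v$ for $v\in V_\alpha$. We set $C[N]^k=C^{k+N}$. Let $T_\alpha$ be the space of constant vector fields parallel to $X_\alpha$, $F_\alpha$ the space of linear functions vanishing on $X_\alpha$, and $\overline\Omega_\alpha$ the one-dimensional space of translation invariant top degree forms on $X_\alpha$. For each pair $\alpha\succ\beta$ choose $f_{\beta,\alpha}\in F_\beta\setminus F_\alpha$ and $\xi_{\alpha,\beta}\in T_\alpha\setminus T_\beta$ (an edge framing). The isomorphism $\pi_{\beta,\alpha}:\overline\Omega_\alpha\to\overline\Omega_\beta$ is defined by $df_{\beta,\alpha}\wedge\pi_{\beta,\alpha}(\omega)=\omega$ if $\alpha\succ\beta$, and by $i_{\xi_{\beta,\alpha}}\pi_{\beta,\alpha}(\omega)=\omega$ on $X_\alpha$ if $\beta\succ\alpha$. For adjacent $\alpha,\beta$ let $$A^r_{\beta,\alpha}=i\otimes\pi_{\beta,\alpha}\otimes A_{\beta,\alpha}:\ \textstyle\bigwedge^r(T_\alpha\oplus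 F_\alpha)\otimes\overline\Omega_\alpha\otimes V_\alpha\to\bigwedge^{r-1}(T_\beta\oplus F_\beta)\otimes\overline\Omega_\beta\otimes V_\beta ,$$ where $i$ is the substitution $t_1\wedge\dots\wedge t_r\mapsto\sum_j(-1)^{j+1}\lambda(t_j)\,t_1\wedge\dots\widehat{t_j}\dots\wedge t_r$ of the linear function $\lambda$ on $T_\alpha\oplus F_\alpha$ given by $\lambda(\xi+f)=\langle\xi,f_{\beta,\alpha}\rangle$ if $\alpha\succ\beta$ and by $\lambda(\xi+f)=\langle\xi_{\beta,\alpha},f\rangle$ if $\beta\succ\alpha$; its values lie in $\bigwedge^{r-1}\ker\lambda$, and $\ker\lambda\subset T_\beta\oplus F_\beta$. Let $\Omega(X)$ be the space of global holomorphic $N$-forms on $X$, on which functions and vector fields act from the right by $\omega\cdot f=f\omega$ and $\omega\cdot\xi=-\mathrm{Lie}_\xi\omega$. The complex $\overline{\mathcal Q\mathcal V}=\Gamma(X,\mathcal Q\mathcal V)$ of global sections of the de Rham complex of $\mathcal V$ has, in degree $-r$ for $r=0,1,\dots,N$, the term $$\bigoplus_{\alpha\in I}\Omega(X)\otimes\textstyle\bigwedge^{r}(T_\alpha\oplus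 F_\alpha)\otimes\overline\Omega_\alpha\otimes V_\alpha ,$$ zero in all other degrees, and the differential $d=d_1-d_0$, where $$d_1(\omega\otimes t_1\wedge\dots\wedge t_r\otimes\overline\omega_\alpha\otimes v_\alpha)=\sum_{i=1}^r(-1)^{i+1}\,\omega\cdot t_i\otimes t_1\wedge\dots\widehat{t_i}\dots\wedge t_r\otimes\overline\omega_\alpha\otimes v_\alpha ,$$ $$d_0(\omega\otimes t_1\wedge\dots\wedge t_r\otimes\overline\omega_\alpha\otimes v_\alpha)=\sum_{\beta\text{ adjacent to }\alpha}\omega\otimes A^r_{\beta,\alpha}(t_1\wedge\dots\wedge t_r\otimes\overline\omega_\alpha\otimes v_\alpha).$$ **Theorem.** For every central arrangement $\mathcal C$ in $\mathbb C^N$ there is $\varepsilon>0$, depending only on $\mathcal C$, such that the following holds for every quiver $\mathcal V$ of $\mathcal C$ on finite-dimensional normed complex vector spaces $V_\alpha$ and for every edge framing: if $\|A_{\alpha,\beta}\|\le\varepsilon$ for all $\alpha,\beta$, then there is a quasi-isomorphism of complexes $$\overline{\mathcal Q\mathcal V}\ \longrightarrow\ C_+(\mathcal V)[N].$$ -/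

import Mathlib

universe u

open scoped TensorProduct
open Module (finrank)

noncomputable section

namespace QuiverDR


/-- The affine space `ℂ^N`, with a chosen origin. -/
abbrev Pt (N : ℕ) : Type := Fin N → ℂ

/-- Central arrangement in `ℂ^N`: finitely many hyperplanes through the origin. -/
structure Arrangement (N : ℕ) where
  planes : Set (Submodule ℂ (Pt N))
  finite : planes.Finite
  hyperplane : ∀ H ∈ planes, finrank ℂ H + 1 = N

variable {N : ℕ}

/-- The vertices of the graph of the arrangement, i.e. the strata. A stratum is recorded by its
closure, an intersection of hyperplanes of the arrangement (the empty intersection, `⊤`, is the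
closure of the open stratum). -/
@[ext]
structure Arrangement.Vertex (𝒞 : Arrangement N) where
  /-- the closure of the stratum `α`, which is also the space `T_α` of constant vector fields
  parallel to the stratum -/
  T : Submodule ℂ (Pt N)
  exists_eq_sInf : ∃ S ⊆ 𝒞.planes, T = sInf S

namespace Arrangement

variable {𝒞 : Arrangement N}

instance : Finite 𝒞.Vertex := by
  have h : Finite {S : Set (Submodule ℂ (Pt N)) // S ⊆ 𝒞.planes} :=
    (𝒞.finite.finite_subsets).to_subtype
  refine Finite.of_surjective
    (fun S : {S : Set (Submodule ℂ (Pt N)) // S ⊆ 𝒞.planes} =>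
      (⟨sInf S.1, S.1, S.2, rfl⟩ : 𝒞.Vertex)) ?_
  rintro ⟨α, S, hS, rfl⟩
  exact ⟨⟨S, hS⟩, rfl⟩

instance : Fintype 𝒞.Vertex := Fintype.ofFinite _

/-- The space `F_α` of affine functions on `ℂ^N` vanishing on the stratum `α`. As the closure of
`α` contains the origin, these functions are linear. -/
abbrev Vertex.F (α : 𝒞.Vertex) : Submodule ℂ (Module.Dual ℂ (Pt N)) := α.T.dualAnnihilator

/-- The codimension `l(α)` of the stratum `α`. -/
def Vertex.codim (α : 𝒞.Vertex) : ℕ := finrank ℂ (Pt N ⧸ α.T)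

/-- `α ≻ β`: the closure of `α` contains that of `β`, with codimension one. -/
def Vertex.Succ (α β : 𝒞.Vertex) : Prop := β.T ≤ α.T ∧ finrank ℂ α.T = finrank ℂ β.T + 1

infix:50 " ≻ " => Vertex.Succ

/-- The space `T_α ⊕ F_α`, as a subspace of the space of all pairs (constant vector field, linear
function). -/
abbrev Vertex.TF (α : 𝒞.Vertex) : Submodule ℂ (Pt N × Module.Dual ℂ (Pt N)) := α.T.prod α.F

/-- The space of translation invariant exterior forms of degree `n` on the closure of `α`. -/
abbrev Vertex.Form (α : 𝒞.Vertex) (n : ℕ) : Type := α.T [⋀^Fin n]→ₗ[ℂ] ℂ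

/-- The one-dimensional space `Ω̄_α` of translation invariant top exterior forms on `α`. -/
abbrev Vertex.TopForm (α : 𝒞.Vertex) : Type := α.Form (finrank ℂ α.T)

/-- A quiver of the graph of the arrangement on the vector spaces `V α`. -/
structure Quiver (𝒞 : Arrangement N) (V : 𝒞.Vertex → Type u) [∀ α, AddCommGroup (V α)]
    [∀ α, Module ℂ (V α)] where
  /-- the linear map `A_{α,β} : V_β → V_α` -/
  A : ∀ α β : 𝒞.Vertex, V β →ₗ[ℂ] V α
  A_eq_zero : ∀ α β, ¬ (α ≻ β ∨ β ≻ α) → A α β = 0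
  sum_eq_zero_of_codim : ∀ α γ : 𝒞.Vertex,
    (α.codim = γ.codim + 2 ∨ γ.codim = α.codim + 2) → ∑ β, A α β ∘ₗ A β γ = 0
  sum_eq_zero_of_common : ∀ α γ : 𝒞.Vertex, α.codim = γ.codim → α ≠ γ →
    (∃ δ, α ≻ δ ∧ γ ≻ δ) → ∑ β, A α β ∘ₗ A β γ = 0

/-- An edge framing: for each edge `α ≻ β` a function `f_{β,α}` in `F_β` but not in `F_α`, and a
vector field `ξ_{α,β}` in `T_α` but not in `T_β`. Values at pairs that are not of this
form are irrelevant. -/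
structure EdgeFraming (𝒞 : Arrangement N) where
  /-- `f α β` is `f_{β,α}` for `α ≻ β` -/
  f : 𝒞.Vertex → 𝒞.Vertex → Module.Dual ℂ (Pt N)
  /-- `ξ α β` is `ξ_{α,β}` for `α ≻ β` -/
  ξ : 𝒞.Vertex → 𝒞.Vertex → Pt N
  f_mem : ∀ {α β}, α ≻ β → f α β ∈ β.F
  f_notMem : ∀ {α β}, α ≻ β → f α β ∉ α.F
  ξ_mem : ∀ {α β}, α ≻ β → ξ α β ∈ α.T
  ξ_notMem : ∀ {α β}, α ≻ β → ξ α β ∉ β.T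

instance (𝒞 : Arrangement N) : Nonempty (EdgeFraming 𝒞) := by
  classical
  have h1 : ∀ α β : 𝒞.Vertex, α ≻ β → ∃ f ∈ β.F, f ∉ α.F := by
    intro α β h
    by_contra hc
    push Not at hc
    have h2 : α.T ≤ β.T := Subspace.dualAnnihilator_le_dualAnnihilator_iff.mp hc
    have := Submodule.finrank_mono h2
    have := h.2
    omega
  have h2 : ∀ α β : 𝒞.Vertex, α ≻ β → ∃ ξ ∈ α.T, ξ ∉ β.T := by
    intro α β h
    by_contra hc
    push Not at hc
    have := Submodule.finrank_mono (show α.T ≤ β.T from hc)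
    have := h.2
    omega
  choose f hf hf' using h1
  choose ξ hξ hξ' using h2
  exact ⟨{
    f := fun α β => if h : α ≻ β then f α β h else 0
    ξ := fun α β => if h : α ≻ β then ξ α β h else 0
    f_mem := fun {α β} h => by simpa only [dif_pos h] using hf α β h
    f_notMem := fun {α β} h => by simpa only [dif_pos h] using hf' α β h
    ξ_mem := fun {α β} h => by simpa only [dif_pos h] using hξ α β h
    ξ_notMem := fun {α β} h => by simpa only [dif_pos h] using hξ' α β h }⟩

theorem Vertex.Succ.asymm {α β : 𝒞.Vertex} (h : α ≻ β) : ¬ β ≻ α := fun h' => by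
  have := h.2
  have := h'.2
  omega

namespace EdgeFraming

variable (φ : EdgeFraming 𝒞) {α β γ : 𝒞.Vertex}

/-- The number `⟨ξ_{α,β}, f_{β,α}⟩`. -/
def c (α β : 𝒞.Vertex) : ℂ := φ.f α β (φ.ξ α β)

theorem f_apply_eq_zero (h : α ≻ β) {x : Pt N} (hx : x ∈ β.T) : φ.f α β x = 0 :=
  (Submodule.mem_dualAnnihilator _).mp (φ.f_mem h) x hx

theorem mem_of_f_eq_zero (h : α ≻ β) {x : Pt N} (hx : x ∈ α.T) (h0 : φ.f α β x = 0) :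
    x ∈ β.T := by
  have hle : β.T ≤ α.T ⊓ LinearMap.ker (φ.f α β) := le_inf h.1 fun y hy => φ.f_apply_eq_zero h hy
  have hlt : α.T ⊓ LinearMap.ker (φ.f α β) < α.T := by
    refine lt_of_le_of_ne inf_le_left fun he => φ.f_notMem h ?_
    rw [Submodule.mem_dualAnnihilator]
    intro w hw
    rw [← he] at hw
    exact hw.2
  have h1 := Submodule.finrank_lt_finrank_of_lt hlt
  have h2 := h.2
  have h3 := Submodule.finrank_mono hle
  have h4 : β.T = α.T ⊓ LinearMap.ker (φ.f α β) :=
    Submodule.eq_of_le_of_finrank_eq hle (by omega)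
  rw [h4]
  exact ⟨hx, h0⟩

theorem c_ne_zero (h : α ≻ β) : φ.c α β ≠ 0 := fun h0 =>
  φ.ξ_notMem h (φ.mem_of_f_eq_zero h (φ.ξ_mem h) h0)

theorem sub_mem (h : α ≻ β) {x : Pt N} (hx : x ∈ α.T) :
    x - ((φ.c α β)⁻¹ * φ.f α β x) • φ.ξ α β ∈ β.T := by
  refine φ.mem_of_f_eq_zero h (α.T.sub_mem hx (α.T.smul_mem _ (φ.ξ_mem h))) ?_
  have := φ.c_ne_zero h
  simp only [c] at this ⊢
  simp only [map_sub, map_smul, smul_eq_mul]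
  field_simp
  ring

theorem sub_mem' (h : α ≻ β) {g : Module.Dual ℂ (Pt N)} (hg : g ∈ β.F) :
    g - ((φ.c α β)⁻¹ * g (φ.ξ α β)) • φ.f α β ∈ α.F := by
  rw [Submodule.mem_dualAnnihilator] at hg ⊢
  intro x hx
  have h1 := hg _ (φ.sub_mem h hx)
  have := φ.c_ne_zero h
  simp only [map_sub, map_smul, smul_eq_mul] at h1
  simp only [LinearMap.sub_apply, LinearMap.smul_apply, smul_eq_mul]
  linear_combination h1

/-- For `α ≻ β`, the projection of `T_α` onto `T_β` along `ξ_{α,β}`. -/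
def proj (h : α ≻ β) : α.T →ₗ[ℂ] β.T :=
  LinearMap.codRestrict β.T
    (α.T.subtype -
      ((φ.c α β)⁻¹ • (φ.f α β ∘ₗ α.T.subtype)).smulRight (φ.ξ α β))
    (fun x => by simpa using φ.sub_mem h x.2)

/-- The map `π_{β,α} : Ω̄_α → Ω̄_β` for `α ≻ β`, on forms of any degree: substitution of the
vector field `ξ_{α,β} / ⟨ξ_{α,β}, f_{β,α}⟩`, followed by restriction to `β`. -/
def piDown (h : α ≻ β) {a b : ℕ} (hab : a = b + 1) : α.Form a →ₗ[ℂ] β.Form b where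
  toFun ω := (φ.c α β)⁻¹ • ((ω.domDomCongr (finCongr hab)).curryLeft
    ⟨φ.ξ α β, φ.ξ_mem h⟩).compLinearMap (Submodule.inclusion h.1)
  map_add' ω ω' := by ext; simp
  map_smul' r ω := by ext; simp; ring

/-- The exterior product with `df_{β,α}` for `α ≻ β`, sending a form `ω` on `β` to the form
`df_{β,α} ∧ ω̃` on `α`, where `ω̃` is an extension of `ω` to `α`. -/
def wedge (h : α ≻ β) {a b : ℕ} (hab : a = b + 1) : β.Form b →ₗ[ℂ] α.Form a where
  toFun ω := (AlternatingMap.alternatizeUncurryFin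
    ((φ.f α β ∘ₗ α.T.subtype).smulRight (ω.compLinearMap (φ.proj h)))).domDomCongr
      (finCongr hab.symm)
  map_add' ω ω' := by
    ext; simp [AlternatingMap.alternatizeUncurryFin_apply, Finset.sum_add_distrib]
  map_smul' r ω := by
    ext
    simp only [AlternatingMap.domDomCongr_apply, AlternatingMap.alternatizeUncurryFin_apply,
      LinearMap.smulRight_apply, AlternatingMap.smul_apply, AlternatingMap.compLinearMap_apply,
      RingHom.id_apply, Finset.smul_sum]
    refine Finset.sum_congr rfl fun i _ => ?_
    simp only [smul_eq_mul, zsmul_eq_mul]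
    ring

/-- The map `π_{α,β} : Ω̄_β → Ω̄_α` for `α ≻ β`, on forms of any degree. -/
def piUp (h : α ≻ β) {a b : ℕ} (hab : a = b + 1) : β.Form b →ₗ[ℂ] α.Form a :=
  (φ.c α β)⁻¹ • φ.wedge h hab

end EdgeFraming
end Arrangement

section Koszul

variable {M S : Type*} [AddCommGroup M] [Module ℂ M] [AddCommGroup S] [Module ℂ S]

/-- Substitution of the linear function `φ` into polyvectors:
`t₀ ∧ ⋯ ∧ tₙ ↦ ∑ i, (-1) ^ i φ(tᵢ) t₀ ∧ ⋯ t̂ᵢ ⋯ ∧ tₙ`. -/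
def interior (φ : Module.Dual ℂ M) (n : ℕ) : ⋀[ℂ]^(n + 1) M →ₗ[ℂ] ⋀[ℂ]^n M :=
  exteriorPower.alternatingMapLinearEquiv
    (AlternatingMap.alternatizeUncurryFin (φ.smulRight (exteriorPower.ιMulti ℂ n)))

/-- The auxiliary map `(t, y) ↦ (s ↦ s · t ⊗ y)`. -/
def koszulAux (a : M →ₗ[ℂ] S →ₗ[ℂ] S) (n : ℕ) :
    M →ₗ[ℂ] M [⋀^Fin n]→ₗ[ℂ] (S →ₗ[ℂ] S ⊗[ℂ] ⋀[ℂ]^n M) where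
  toFun t := (((TensorProduct.mk ℂ S (⋀[ℂ]^n M)).compl₁₂ (a t) LinearMap.id).flip).compAlternatingMap
    (exteriorPower.ιMulti ℂ n)
  map_add' t t' := by ext; simp
  map_smul' r t := by ext; simp [TensorProduct.smul_tmul']

/-- For a bilinear action `(s, t) ↦ s · t = a t s` of `M` on `S`, the Koszul map
`s ⊗ t₀ ∧ ⋯ ∧ tₙ ↦ ∑ i, (-1) ^ i s · tᵢ ⊗ t₀ ∧ ⋯ t̂ᵢ ⋯ ∧ tₙ`. -/
def koszul (a : M →ₗ[ℂ] S →ₗ[ℂ] S) (n : ℕ) :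
    S ⊗[ℂ] ⋀[ℂ]^(n + 1) M →ₗ[ℂ] S ⊗[ℂ] ⋀[ℂ]^n M :=
  TensorProduct.lift (exteriorPower.alternatingMapLinearEquiv
    (AlternatingMap.alternatizeUncurryFin (koszulAux a n))).flip

theorem interior_ιMulti (φ : Module.Dual ℂ M) (n : ℕ) (t : Fin (n + 1) → M) :
    interior φ n (exteriorPower.ιMulti ℂ (n + 1) t) =
      ∑ i : Fin (n + 1), (-1 : ℂ) ^ (i : ℕ) • φ (t i) • exteriorPower.ιMulti ℂ n (i.removeNth t) := by
  simp only [interior, exteriorPower.alternatingMapLinearEquiv_apply_ιMulti,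
    AlternatingMap.alternatizeUncurryFin_apply]
  refine Finset.sum_congr rfl fun i _ => ?_
  rw [← Int.cast_smul_eq_zsmul ℂ]
  simp

theorem koszul_tmul (a : M →ₗ[ℂ] S →ₗ[ℂ] S) (n : ℕ) (s : S) (t : Fin (n + 1) → M) :
    koszul a n (s ⊗ₜ exteriorPower.ιMulti ℂ (n + 1) t) =
      ∑ i : Fin (n + 1), (-1 : ℂ) ^ (i : ℕ) •
        (a (t i) s ⊗ₜ[ℂ] exteriorPower.ιMulti ℂ n (i.removeNth t)) := by
  simp only [koszul, TensorProduct.lift.tmul, LinearMap.flip_apply,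
    exteriorPower.alternatingMapLinearEquiv_apply_ιMulti,
    AlternatingMap.alternatizeUncurryFin_apply, LinearMap.sum_apply]
  refine Finset.sum_congr rfl fun i _ => ?_
  rw [← Int.cast_smul_eq_zsmul ℂ]
  simp [koszulAux]

end Koszul

section HolForm

variable (N)

/-- The subspace of holomorphic functions in the space of all functions from `ℂ^N` to the space of
alternating `N`-forms. -/
def holForm : Submodule ℂ (Pt N → (Pt N [⋀^Fin N]→L[ℂ] ℂ)) where
  carrier := {ω | AnalyticOnNhd ℂ ω Set.univ}
  add_mem' h h' := h.add h'
  zero_mem' := analyticOnNhd_const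
  smul_mem' r _ h := (analyticOnNhd_const (v := r)).smul h

/-- The space of global holomorphic `N`-forms on `ℂ^N`. -/
def HolForm : Type := ↥(holForm N)

instance : AddCommGroup (HolForm N) := inferInstanceAs (AddCommGroup ↥(holForm N))

instance : Module ℂ (HolForm N) := inferInstanceAs (Module ℂ ↥(holForm N))

variable {N}

/-- A holomorphic `N`-form, from the function and the proof that it is holomorphic. -/
def HolForm.mk (ω : Pt N → (Pt N [⋀^Fin N]→L[ℂ] ℂ)) (h : AnalyticOnNhd ℂ ω Set.univ) :
    HolForm N := (⟨ω, h⟩ : ↥(holForm N))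

theorem HolForm.ext {ω ω' : HolForm N} (h : ∀ x, ω.1 x = ω'.1 x) : ω = ω' :=
  Subtype.ext (funext h)

/-- The right action of functions on top forms, `ω · g = g ω`, for a linear function `g`. -/
def mulFun : Module.Dual ℂ (Pt N) →ₗ[ℂ] HolForm N →ₗ[ℂ] HolForm N :=
  LinearMap.mk₂ ℂ
    (fun g ω => HolForm.mk (fun x => g x • ω.1 x)
      ((g.toContinuousLinearMap.analyticOnNhd _).smul ω.2))
    (fun g g' ω => HolForm.ext fun x => by exact add_smul (g x) (g' x) (ω.1 x))
    (fun r g ω => HolForm.ext fun x => by exact mul_smul r (g x) (ω.1 x))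
    (fun g ω ω' => HolForm.ext fun x => by exact smul_add (g x) (ω.1 x) (ω'.1 x))
    (fun r g ω => HolForm.ext fun x => by exact smul_comm (g x) r (ω.1 x))

theorem differentiable (ω : HolForm N) : Differentiable ℂ ω.1 := fun x =>
  (ω.2 x (Set.mem_univ _)).differentiableAt

/-- The right action of constant vector fields on top forms, `ω · ξ = - Lie_ξ ω`. The flow of the
constant vector field `ξ` consists of translations, so `Lie_ξ ω` is the derivative of the
form-valued function `ω` in the direction `ξ`. -/
def negLie : Pt N →ₗ[ℂ] HolForm N →ₗ[ℂ] HolForm N :=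
  LinearMap.mk₂ ℂ
    (fun ξ ω => HolForm.mk (fun x => - fderiv ℂ ω.1 x ξ) (by
      have h : AnalyticOnNhd ℂ (fderiv ℂ ω.1) Set.univ := AnalyticOnNhd.fderiv ω.2
      exact (((ContinuousLinearMap.apply ℂ (Pt N [⋀^Fin N]→L[ℂ] ℂ) ξ).comp_analyticOnNhd h)).neg))
    (fun ξ ξ' ω => HolForm.ext fun x => by
      change - fderiv ℂ ω.1 x (ξ + ξ') = - fderiv ℂ ω.1 x ξ + - fderiv ℂ ω.1 x ξ'
      simp [add_comm])
    (fun r ξ ω => HolForm.ext fun x => by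
      change - fderiv ℂ ω.1 x (r • ξ) = r • - fderiv ℂ ω.1 x ξ
      simp)
    (fun ξ ω ω' => HolForm.ext fun x => by
      change - fderiv ℂ (ω.1 + ω'.1) x ξ = - fderiv ℂ ω.1 x ξ + - fderiv ℂ ω'.1 x ξ
      simp [fderiv_add (differentiable ω x) (differentiable ω' x), add_comm])
    (fun r ξ ω => HolForm.ext fun x => by
      change - fderiv ℂ (r • ω.1) x ξ = r • - fderiv ℂ ω.1 x ξ
      simp [fderiv_const_smul (differentiable ω x)])

/-- The right action of `ξ + g`, for a constant vector field `ξ` and a linear function `g`. -/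
def rightAct : Pt N × Module.Dual ℂ (Pt N) →ₗ[ℂ] HolForm N →ₗ[ℂ] HolForm N :=
  negLie.coprod mulFun

theorem rightAct_comm (t t' : Pt N × Module.Dual ℂ (Pt N)) (h : t.2 t'.1 = 0) (h' : t'.2 t.1 = 0)
    (ω : HolForm N) : rightAct t (rightAct t' ω) = rightAct t' (rightAct t ω) := by
  obtain ⟨ξ, g⟩ := t
  obtain ⟨η, k⟩ := t'
  simp only at h h'
  have hd : Differentiable ℂ (fderiv ℂ ω.1) := fun x =>
    ((AnalyticOnNhd.fderiv ω.2) x (Set.mem_univ _)).differentiableAt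
  have hmul : ∀ (g : Module.Dual ℂ (Pt N)) (ξ : Pt N), g ξ = 0 →
      negLie ξ (mulFun g ω) = mulFun g (negLie ξ ω) := by
    intro g ξ hg
    refine HolForm.ext fun x => ?_
    have h1 := fderiv_smul (g.toContinuousLinearMap.differentiableAt (x := x))
      (differentiable ω x)
    change - fderiv ℂ (fun y => g.toContinuousLinearMap y • ω.1 y) x ξ = g x • -fderiv ℂ ω.1 x ξ
    erw [h1]
    rw [ContinuousLinearMap.fderiv]
    simp [hg]
  have hsymm : negLie ξ (negLie η ω) = negLie η (negLie ξ ω) := by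
    have key : ∀ ξ η : Pt N, ∀ x, (negLie ξ (negLie η ω)).1 x =
        fderiv ℂ (fderiv ℂ ω.1) x ξ η := by
      intro ξ η x
      change - fderiv ℂ (fun y => - fderiv ℂ ω.1 y η) x ξ = _
      rw [fderiv_fun_neg]
      have := (hd x).hasFDerivAt.clm_apply (hasFDerivAt_const η x)
      rw [this.fderiv]
      simp
    refine HolForm.ext fun x => ?_
    rw [key, key]
    have hs : IsSymmSndFDerivAt ℂ ω.1 x :=
      ContDiffAt.isSymmSndFDerivAt_of_omega (ω.2 x (Set.mem_univ _)).contDiffAt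
    exact hs.eq ξ η
  have hcomm : mulFun g (mulFun k ω) = mulFun k (mulFun g ω) := by
    refine HolForm.ext fun x => ?_
    exact smul_comm (g x) (k x) (ω.1 x)
  simp only [rightAct, LinearMap.coprod_apply, LinearMap.add_apply, map_add]
  rw [hsymm, hcomm, hmul k ξ h', hmul g η h]
  abel

end HolForm

namespace Arrangement

variable {𝒞 : Arrangement N}

namespace EdgeFraming

variable (φ : EdgeFraming 𝒞)

open Classical in
/-- For an edge between `α` and `β`, the linear function on `T_α ⊕ F_α` that is given by
`ξ + g ↦ ⟨ξ, f_{β,α}⟩` if `α ≻ β`, and by `ξ + g ↦ ⟨ξ_{β,α}, g⟩` if `β ≻ α`. -/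
def pairing (α β : 𝒞.Vertex) : Module.Dual ℂ α.TF :=
  if α ≻ β then φ.f α β ∘ₗ LinearMap.fst ℂ _ _ ∘ₗ α.TF.subtype
  else if β ≻ α then
    Module.Dual.eval ℂ (Pt N) (φ.ξ β α) ∘ₗ LinearMap.snd ℂ _ _ ∘ₗ α.TF.subtype
  else 0

open Classical in
/-- A vector of `T_α ⊕ F_α` on which the linear function `pairing α β` takes the value `1`. -/
def vec (α β : 𝒞.Vertex) : Pt N × Module.Dual ℂ (Pt N) :=
  if α ≻ β then ((φ.c α β)⁻¹ • φ.ξ α β, 0)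
  else if β ≻ α then (0, (φ.c β α)⁻¹ • φ.f β α)
  else 0

variable {α β γ : 𝒞.Vertex}

theorem pairing_down (h : α ≻ β) (t : α.TF) : φ.pairing α β t = φ.f α β t.1.1 := by
  simp [pairing, h]

theorem pairing_up (h : β ≻ α) (t : α.TF) : φ.pairing α β t = t.1.2 (φ.ξ β α) := by
  simp [pairing, h, h.asymm]

/-- Subtracting a multiple of `vec α β`, one projects `T_α ⊕ F_α` onto the kernel of
`pairing α β`, which is `T_β ⊕ F_α` if `α ≻ β` and `T_α ⊕ F_β` if `β ≻ α`, hence is contained in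
`T_β ⊕ F_β`. -/
theorem sub_vec_mem (h : α ≻ β ∨ β ≻ α) (t : α.TF) :
    t.1 - φ.pairing α β t • φ.vec α β ∈ β.TF := by
  obtain ⟨⟨x, g⟩, hx, hg⟩ := t
  simp only [] at hx hg
  rcases h with h | h
  · rw [φ.pairing_down h]
    simp only [vec, h, if_true]
    refine ⟨?_, ?_⟩
    · have := φ.sub_mem h hx
      simpa [smul_smul, mul_comm] using this
    · simpa using Submodule.dualAnnihilator_anti h.1 hg
  · rw [φ.pairing_up h]
    simp only [vec, h, h.asymm, if_true, if_false]
    refine ⟨?_, ?_⟩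
    · simpa using h.1 hx
    · have := φ.sub_mem' h hg
      simpa [smul_smul, mul_comm] using this

/-- The projection of `T_α ⊕ F_α` onto the kernel of `pairing α β`, as a map to `T_β ⊕ F_β`. -/
def shift (h : α ≻ β ∨ β ≻ α) : α.TF →ₗ[ℂ] β.TF :=
  LinearMap.codRestrict β.TF (α.TF.subtype - (φ.pairing α β).smulRight (φ.vec α β))
    (φ.sub_vec_mem h)

/-- Substitution of `f_{β,α}` or `ξ_{β,α}` into polyvectors, `⋀ⁿ⁺¹(T_α ⊕ F_α) → ⋀ⁿ(T_β ⊕ F_β)`.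
The result of the substitution is a polyvector on the kernel of `pairing α β`, and `shift` only
serves to consider it as a polyvector on `T_β ⊕ F_β`, see `substitution_ιMulti`. -/
def substitution (h : α ≻ β ∨ β ≻ α) (n : ℕ) : ⋀[ℂ]^(n + 1) α.TF →ₗ[ℂ] ⋀[ℂ]^n β.TF :=
  exteriorPower.map n (φ.shift h) ∘ₗ interior (φ.pairing α β) n

open Classical in
/-- The map `π_{β,α} : Ω̄_α → Ω̄_β`. -/
def π (h : α ≻ β ∨ β ≻ α) : α.TopForm →ₗ[ℂ] β.TopForm :=
  if h' : α ≻ β then φ.piDown h' h'.2 else φ.piUp (h.resolve_left h') (h.resolve_left h').2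

theorem shift_apply_of_pairing_eq_zero (h : α ≻ β ∨ β ≻ α) (t : α.TF)
    (ht : φ.pairing α β t = 0) : (φ.shift h t).1 = t.1 := by
  change t.1 - φ.pairing α β t • φ.vec α β = t.1
  rw [ht, zero_smul, sub_zero]

/-- The defining property of `substitution`. -/
theorem substitution_ιMulti (h : α ≻ β ∨ β ≻ α) (n : ℕ) (t : α.TF) (s : Fin n → α.TF)
    (s' : Fin n → β.TF) (hs : ∀ i, φ.pairing α β (s i) = 0) (hs' : ∀ i, (s' i).1 = (s i).1) :
    φ.substitution h n (exteriorPower.ιMulti ℂ (n + 1) (Fin.cons t s)) =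
      φ.pairing α β t • exteriorPower.ιMulti ℂ n s' := by
  have h1 : (fun i => φ.shift h (s i)) = s' := by
    funext i
    exact Subtype.ext ((φ.shift_apply_of_pairing_eq_zero h _ (hs i)).trans (hs' i).symm)
  rw [substitution, LinearMap.comp_apply, interior_ιMulti, Fin.sum_univ_succ]
  simp [hs, exteriorPower.map_apply_ιMulti, Function.comp_def, h1]

end EdgeFraming

section Complex

variable {V : 𝒞.Vertex → Type u} [∀ α, AddCommGroup (V α)] [∀ α, Module ℂ (V α)]

variable (V) in
/-- The summand of the vertex `α` in the space of global sections of the term of degree `-n` of the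
de Rham complex: holomorphic `N`-forms tensored with `⋀ⁿ(T_α ⊕ F_α) ⊗ (Ω̄_α ⊗ V_α)`. -/
def Vertex.Term (α : 𝒞.Vertex) (n : ℕ) : Type u :=
  (HolForm N ⊗[ℂ] ⋀[ℂ]^n α.TF) ⊗[ℂ] (α.TopForm ⊗[ℂ] V α)

instance (α : 𝒞.Vertex) (n : ℕ) : AddCommGroup (α.Term V n) :=
  inferInstanceAs (AddCommGroup ((HolForm N ⊗[ℂ] ⋀[ℂ]^n α.TF) ⊗[ℂ] (α.TopForm ⊗[ℂ] V α)))

instance (α : 𝒞.Vertex) (n : ℕ) : Module ℂ (α.Term V n) :=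
  inferInstanceAs (Module ℂ ((HolForm N ⊗[ℂ] ⋀[ℂ]^n α.TF) ⊗[ℂ] (α.TopForm ⊗[ℂ] V α)))

/-- For an edge between `α` and `β`, the map `A^{n+1}_{β,α}` from
`⋀ⁿ⁺¹(T_α ⊕ F_α) ⊗ (Ω̄_α ⊗ V_α)` to `⋀ⁿ(T_β ⊕ F_β) ⊗ (Ω̄_β ⊗ V_β)`, tensored on the left with the
identity of the space of holomorphic `N`-forms. -/
def edgeTerm (φ : EdgeFraming 𝒞) (𝒱 : Quiver 𝒞 V) {α β : 𝒞.Vertex} (h : α ≻ β ∨ β ≻ α) (n : ℕ) :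
    α.Term V (n + 1) →ₗ[ℂ] β.Term V n :=
  TensorProduct.map (LinearMap.lTensor (HolForm N) (φ.substitution h n))
    (TensorProduct.map (φ.π h) (𝒱.A β α))

open Classical in
/-- The map `edgeTerm` for adjacent `α` and `β`, and zero otherwise. -/
def edgeMap (φ : EdgeFraming 𝒞) (𝒱 : Quiver 𝒞 V) (α β : 𝒞.Vertex) (n : ℕ) :
    α.Term V (n + 1) →ₗ[ℂ] β.Term V n :=
  if h : α ≻ β ∨ β ≻ α then edgeTerm φ 𝒱 h n else 0

/-- The action of `T_α ⊕ F_α` on holomorphic `N`-forms from the right. -/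
def Vertex.act (α : 𝒞.Vertex) : α.TF →ₗ[ℂ] HolForm N →ₗ[ℂ] HolForm N :=
  rightAct ∘ₗ α.TF.subtype

variable (V) in
/-- The Koszul map for the action of `T_α ⊕ F_α` on holomorphic `N`-forms, tensored on the right
with the identity of `Ω̄_α ⊗ V_α`. -/
def Vertex.koszulTerm (α : 𝒞.Vertex) (n : ℕ) : α.Term V (n + 1) →ₗ[ℂ] α.Term V n :=
  LinearMap.rTensor (α.TopForm ⊗[ℂ] V α) (koszul (M := α.TF) (S := HolForm N) α.act n)

variable (V) in
/-- The space of global sections of the term of degree `-n` of the de Rham complex. -/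
abbrev DRTerm (n : ℕ) : Type u := ∀ α : 𝒞.Vertex, α.Term V n

variable (V) in
/-- The part `d₁` of the differential. -/
def d₁ (n : ℕ) : DRTerm V (n + 1) →ₗ[ℂ] DRTerm V n :=
  LinearMap.pi fun α => α.koszulTerm V n ∘ₗ LinearMap.proj α

/-- The part `d₀` of the differential. -/
def d₀ (φ : EdgeFraming 𝒞) (𝒱 : Quiver 𝒞 V) (n : ℕ) : DRTerm V (n + 1) →ₗ[ℂ] DRTerm V n :=
  LinearMap.pi fun β => ∑ α, edgeMap φ 𝒱 α β n ∘ₗ LinearMap.proj α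

end Complex

end Arrangement

section KoszulLemmas

variable {M M' S : Type*} [AddCommGroup M] [Module ℂ M] [AddCommGroup M'] [Module ℂ M']
  [AddCommGroup S] [Module ℂ S]

theorem tmul_ext {n : ℕ} {X : Type*} [AddCommGroup X] [Module ℂ X]
    {F G : S ⊗[ℂ] ⋀[ℂ]^n M →ₗ[ℂ] X}
    (h : ∀ s t, F (s ⊗ₜ exteriorPower.ιMulti ℂ n t) = G (s ⊗ₜ exteriorPower.ιMulti ℂ n t)) :
    F = G := by
  refine TensorProduct.ext ?_
  refine LinearMap.ext fun s => exteriorPower.linearMap_ext ?_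
  ext t
  exact h s t

theorem sum_alt {n : ℕ} {T : Type*} [AddCommGroup T] [Module ℂ T]
    (f : M →ₗ[ℂ] M →ₗ[ℂ] T) (hf : ∀ x y, f x y = f y x) (t : Fin (n + 2) → M) :
    ∑ i : Fin (n + 2), ∑ j : Fin (n + 1), (-1 : ℂ) ^ (i : ℕ) • (-1 : ℂ) ^ (j : ℕ) •
      (f (t i) (i.removeNth t j) ⊗ₜ[ℂ]
        exteriorPower.ιMulti ℂ n (j.removeNth (i.removeNth t))) = 0 := by
  let g : M →ₗ[ℂ] M →ₗ[ℂ] M [⋀^Fin n]→ₗ[ℂ] (T ⊗[ℂ] ⋀[ℂ]^n M) :=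
    LinearMap.mk₂ ℂ (fun x y =>
      (TensorProduct.mk ℂ T (⋀[ℂ]^n M) (f x y)).compAlternatingMap (exteriorPower.ιMulti ℂ n))
      (fun _ _ _ => by ext; simp) (fun _ _ _ => by ext; simp) (fun _ _ _ => by ext; simp)
      (fun _ _ _ => by ext; simp)
  have hg : ∀ x y, g x y = g y x := fun x y => by
    ext; simp [g, hf x y]
  have := DFunLike.congr_fun
    (AlternatingMap.alternatizeUncurryFin_alternatizeUncurryFinLM_comp_of_symmetric hg) t
  simp only [AlternatingMap.alternatizeUncurryFin_apply, LinearMap.comp_apply,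
    AlternatingMap.alternatizeUncurryFinLM_apply, Finset.smul_sum, AlternatingMap.zero_apply] at this
  rw [← this]
  refine Finset.sum_congr rfl fun i _ => Finset.sum_congr rfl fun j _ => ?_
  rw [← Int.cast_smul_eq_zsmul ℂ, ← Int.cast_smul_eq_zsmul ℂ]
  simp [g]

theorem koszul_koszul (a : M →ₗ[ℂ] S →ₗ[ℂ] S) (ha : ∀ x y s, a x (a y s) = a y (a x s)) (n : ℕ) :
    koszul a n ∘ₗ koszul a (n + 1) = 0 := by
  refine tmul_ext fun s t => ?_
  rw [LinearMap.comp_apply, koszul_tmul, map_sum, LinearMap.zero_apply,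
    ← sum_alt (LinearMap.mk₂ ℂ (fun x y => a y (a x s)) (by simp) (by simp) (by simp) (by simp))
      (fun x y => by simp [ha x y]) t]
  refine Finset.sum_congr rfl fun i _ => ?_
  rw [map_smul, koszul_tmul, Finset.smul_sum]
  rfl

theorem interior_koszul (a : M →ₗ[ℂ] S →ₗ[ℂ] S) (φ : Module.Dual ℂ M) (n : ℕ) :
    LinearMap.lTensor S (interior φ n) ∘ₗ koszul a (n + 1) +
      koszul a n ∘ₗ LinearMap.lTensor S (interior φ (n + 1)) = 0 := by
  refine tmul_ext fun s t => ?_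
  rw [LinearMap.add_apply, LinearMap.comp_apply, koszul_tmul, map_sum, LinearMap.zero_apply,
    LinearMap.comp_apply, LinearMap.lTensor_tmul, interior_ιMulti, TensorProduct.tmul_sum, map_sum,
    ← sum_alt (LinearMap.mk₂ ℂ (fun x y => φ y • a x s + φ x • a y s)
      (fun _ _ _ => by simp only [map_add, LinearMap.add_apply]; module)
      (fun _ _ _ => by simp only [map_smul, LinearMap.smul_apply, smul_eq_mul]; module)
      (fun _ _ _ => by simp only [map_add, LinearMap.add_apply]; module)
      (fun _ _ _ => by simp only [map_smul, LinearMap.smul_apply, smul_eq_mul]; module))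
      (fun x y => by simp [add_comm]) t, ← Finset.sum_add_distrib]
  refine Finset.sum_congr rfl fun i _ => ?_
  rw [map_smul, LinearMap.lTensor_tmul, interior_ιMulti, TensorProduct.tmul_smul, map_smul,
    TensorProduct.tmul_smul, map_smul, koszul_tmul, TensorProduct.tmul_sum, ← smul_add,
    ← Finset.smul_sum]
  congr 1
  rw [Finset.smul_sum, ← Finset.sum_add_distrib]
  refine Finset.sum_congr rfl fun j _ => ?_
  simp only [TensorProduct.tmul_smul, TensorProduct.add_tmul, TensorProduct.smul_tmul',
    LinearMap.mk₂_apply, smul_add]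
  rw [smul_comm (φ (t i))]

theorem koszul_smulRight (a : M →ₗ[ℂ] S →ₗ[ℂ] S) (φ : Module.Dual ℂ M) (A : S →ₗ[ℂ] S) (n : ℕ) :
    koszul (a + φ.smulRight A) n = koszul a n + TensorProduct.map A (interior φ n) := by
  refine tmul_ext fun s t => ?_
  rw [LinearMap.add_apply, koszul_tmul, koszul_tmul, TensorProduct.map_tmul, interior_ιMulti,
    TensorProduct.tmul_sum, ← Finset.sum_add_distrib]
  refine Finset.sum_congr rfl fun i _ => ?_
  simp only [TensorProduct.tmul_smul, LinearMap.add_apply, TensorProduct.add_tmul,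
    LinearMap.smulRight_apply, LinearMap.smul_apply, TensorProduct.smul_tmul', smul_add]

theorem koszul_map (a : M' →ₗ[ℂ] S →ₗ[ℂ] S) (P : M →ₗ[ℂ] M') (n : ℕ) :
    koszul a n ∘ₗ LinearMap.lTensor S (exteriorPower.map (n + 1) P) =
      LinearMap.lTensor S (exteriorPower.map n P) ∘ₗ koszul (a ∘ₗ P) n := by
  refine tmul_ext fun s t => ?_
  rw [LinearMap.comp_apply, LinearMap.comp_apply, LinearMap.lTensor_tmul, koszul_tmul, map_sum,
    exteriorPower.map_apply_ιMulti, koszul_tmul]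
  refine Finset.sum_congr rfl fun i _ => ?_
  rw [map_smul, LinearMap.lTensor_tmul, exteriorPower.map_apply_ιMulti]
  rfl

theorem interior_map (ψ : Module.Dual ℂ M') (P : M →ₗ[ℂ] M') (n : ℕ) :
    interior ψ n ∘ₗ exteriorPower.map (n + 1) P =
      exteriorPower.map n P ∘ₗ interior (ψ ∘ₗ P) n := by
  refine exteriorPower.linearMap_ext ?_
  ext1 t
  simp only [LinearMap.compAlternatingMap_apply, LinearMap.comp_apply,
    exteriorPower.map_apply_ιMulti, interior_ιMulti, map_sum]
  refine Finset.sum_congr rfl fun i _ => ?_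
  rw [map_smul, map_smul, exteriorPower.map_apply_ιMulti]
  rfl

theorem sum_interior_interior {ι : Type*} [Fintype ι] {Y : Type*} [AddCommGroup Y] [Module ℂ Y]
    (φ ψ : ι → Module.Dual ℂ M) (y : ι → Y)
    (h : ∀ s t, ∑ b, (φ b s * ψ b t - φ b t * ψ b s) • y b = 0) (n : ℕ)
    (x : ⋀[ℂ]^(n + 2) M) :
    ∑ b, y b ⊗ₜ[ℂ] interior (ψ b) n (interior (φ b) (n + 1) x) = 0 := by
  suffices H : ∑ b, (TensorProduct.mk ℂ Y (⋀[ℂ]^n M) (y b)) ∘ₗ interior (ψ b) n ∘ₗ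
      interior (φ b) (n + 1) = 0 by
    simpa using LinearMap.congr_fun H x
  refine exteriorPower.linearMap_ext ?_
  ext1 t
  simp only [LinearMap.compAlternatingMap_apply, LinearMap.sum_apply, LinearMap.comp_apply,
    LinearMap.zero_apply]
  rw [← sum_alt (∑ b, LinearMap.mk₂ ℂ (fun s t => (φ b s * ψ b t) • y b)
      (fun _ _ _ => by simp only [map_add]; module)
      (fun _ _ _ => by simp only [map_smul, smul_eq_mul]; module)
      (fun _ _ _ => by simp only [map_add]; module)
      (fun _ _ _ => by simp only [map_smul, smul_eq_mul]; module))
      (fun s t => by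
        have := h s t
        simp only [sub_smul, Finset.sum_sub_distrib, sub_eq_zero] at this
        simpa using this) t]
  simp only [interior_ιMulti, map_sum, map_smul, LinearMap.sum_apply, LinearMap.mk₂_apply,
    TensorProduct.sum_tmul, Finset.smul_sum, TensorProduct.mk_apply, TensorProduct.smul_tmul']
  rw [Finset.sum_comm]
  refine Finset.sum_congr rfl fun i _ => ?_
  rw [Finset.sum_comm]
  refine Finset.sum_congr rfl fun j _ => Finset.sum_congr rfl fun b _ => ?_
  rw [smul_comm (φ b (t i)), smul_smul (φ b (t i))]

theorem interior_interior (φ : Module.Dual ℂ M) (n : ℕ) :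
    interior φ n ∘ₗ interior φ (n + 1) = 0 := by
  refine LinearMap.ext fun x => ?_
  have := sum_interior_interior (ι := Unit) (Y := ℂ) (fun _ => φ) (fun _ => φ) (fun _ => 1)
    (fun s t => by simp [mul_comm]) n x
  have := congrArg (TensorProduct.lid ℂ _) this
  simpa using this

theorem coe_interior (φ : Module.Dual ℂ M) (n : ℕ) (x : ⋀[ℂ]^(n + 1) M) :
    (interior φ n x : ExteriorAlgebra ℂ M) = CliffordAlgebra.contractLeft (Q := 0) φ x.1 := by
  suffices H : (⋀[ℂ]^n M).subtype ∘ₗ interior φ n =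
      CliffordAlgebra.contractLeft (Q := (0 : QuadraticForm ℂ M)) φ ∘ₗ (⋀[ℂ]^(n + 1) M).subtype from
    LinearMap.congr_fun H x
  refine exteriorPower.linearMap_ext ?_
  ext1 t
  simp only [LinearMap.compAlternatingMap_apply, LinearMap.comp_apply]
  rw [interior_ιMulti]
  clear x
  induction n with
  | zero =>
    simp [ExteriorAlgebra.ιMulti_succ_apply, ExteriorAlgebra.ι]
    exact (Algebra.algebraMap_eq_smul_one _).symm
  | succ n ih =>
    have hι : ∀ y : ExteriorAlgebra ℂ M, CliffordAlgebra.contractLeft (Q := (0 : QuadraticForm ℂ M)) φ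
        (ExteriorAlgebra.ι ℂ (t 0) * y) = φ (t 0) • y - ExteriorAlgebra.ι ℂ (t 0) *
          CliffordAlgebra.contractLeft (Q := (0 : QuadraticForm ℂ M)) φ y :=
      CliffordAlgebra.contractLeft_ι_mul φ (t 0)
    simp only [Submodule.subtype_apply, exteriorPower.ιMulti_apply_coe] at ih ⊢
    rw [ExteriorAlgebra.ιMulti_succ_apply t, hι, ← ih]
    simp only [Fin.sum_univ_succ (n := n + 1), AddSubmonoidClass.coe_finsetSum, Submodule.coe_add]
    rw [sub_eq_add_neg, Finset.mul_sum, ← Finset.sum_neg_distrib]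
    congr 1
    · rw [Fin.val_zero, pow_zero, one_smul]
      rfl
    · refine Finset.sum_congr rfl fun i _ => ?_
      rw [Submodule.coe_smul, Submodule.coe_smul, Submodule.coe_smul, Submodule.coe_smul,
        exteriorPower.ιMulti_apply_coe, exteriorPower.ιMulti_apply_coe,
        ExteriorAlgebra.ιMulti_succ_apply (i.succ.removeNth t), mul_smul_comm, mul_smul_comm,
        Fin.val_succ, pow_succ, mul_neg_one, neg_smul]
      have e : Matrix.vecTail (i.succ.removeNth t) = i.removeNth (Matrix.vecTail t) := by
        funext j
        simp [Matrix.vecTail, Fin.removeNth]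
      rw [e]
      rfl

theorem exteriorAlgebra_map_sub (u : M →ₗ[ℂ] M') (φ : Module.Dual ℂ M) (w : M')
    (x : ExteriorAlgebra ℂ M) :
    ExteriorAlgebra.map (u - φ.smulRight w) x = ExteriorAlgebra.map u x -
      ExteriorAlgebra.ι ℂ w * ExteriorAlgebra.map u (CliffordAlgebra.contractLeft (Q := 0) φ x) := by
  induction x using CliffordAlgebra.left_induction with
  | algebraMap r =>
    rw [CliffordAlgebra.contractLeft_algebraMap, map_zero, mul_zero, sub_zero]
    exact (AlgHom.commutes _ r).trans (AlgHom.commutes _ r).symm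
  | add x y hx hy => rw [map_add, hx, hy, map_add, map_add, map_add, mul_add]; abel
  | ι_mul x m hx =>
    have h1 : ∀ (v : M →ₗ[ℂ] M') (x : ExteriorAlgebra ℂ M), ExteriorAlgebra.map v
        (CliffordAlgebra.ι (0 : QuadraticForm ℂ M) m * x) =
        ExteriorAlgebra.ι ℂ (v m) * ExteriorAlgebra.map v x := fun v x =>
      (map_mul (ExteriorAlgebra.map v) (ExteriorAlgebra.ι ℂ m) x).trans
        (congrArg (· * _) (ExteriorAlgebra.map_apply_ι v m))
    rw [CliffordAlgebra.contractLeft_ι_mul, h1, h1, hx, map_sub, map_smul, h1]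
    have h2 : ExteriorAlgebra.ι ℂ ((u - φ.smulRight w) m) =
        ExteriorAlgebra.ι ℂ (u m) - φ m • ExteriorAlgebra.ι ℂ w := by simp
    have h3 : ExteriorAlgebra.ι ℂ w * ExteriorAlgebra.ι ℂ w = 0 := ExteriorAlgebra.ι_sq_zero w
    have h4 : ExteriorAlgebra.ι ℂ (u m) * ExteriorAlgebra.ι ℂ w =
        - (ExteriorAlgebra.ι ℂ w * ExteriorAlgebra.ι ℂ (u m)) :=
      eq_neg_of_add_eq_zero_left (ExteriorAlgebra.ι_add_mul_swap (u m) w)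
    rw [h2]
    generalize ExteriorAlgebra.map u x = X
    generalize ExteriorAlgebra.map u (CliffordAlgebra.contractLeft φ x) = Y
    rw [sub_mul, mul_sub, smul_mul_assoc, mul_sub, mul_sub, ← mul_assoc, h4, ← mul_assoc _ _ Y, h3,
      mul_smul_comm, ← mul_assoc]
    simp only [neg_mul, zero_mul, sub_zero]
    abel

theorem map_sub_interior (u : M →ₗ[ℂ] M') (φ : Module.Dual ℂ M) (w : M') (n : ℕ) :
    exteriorPower.map n (u - φ.smulRight w) ∘ₗ interior φ n =
      exteriorPower.map n u ∘ₗ interior φ n := by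
  have coe_map : ∀ (v : M →ₗ[ℂ] M') (x : ⋀[ℂ]^n M),
      (exteriorPower.map n v x : ExteriorAlgebra ℂ M') = ExteriorAlgebra.map v x.1 := by
    intro v x
    suffices H : (⋀[ℂ]^n M').subtype ∘ₗ exteriorPower.map n v =
        (ExteriorAlgebra.map v).toLinearMap ∘ₗ (⋀[ℂ]^n M).subtype from LinearMap.congr_fun H x
    refine exteriorPower.linearMap_ext ?_
    ext1 t
    simp
  refine LinearMap.ext fun x => Subtype.ext ?_
  rw [LinearMap.comp_apply, LinearMap.comp_apply, coe_map, coe_map, exteriorAlgebra_map_sub,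
    coe_interior, CliffordAlgebra.contractLeft_contractLeft, map_zero, mul_zero, sub_zero]

end KoszulLemmas

namespace Arrangement

variable {𝒞 : Arrangement N}

namespace EdgeFraming

variable (φ : EdgeFraming 𝒞) {α β γ : 𝒞.Vertex}

theorem proj_coe (h : α ≻ β) (x : α.T) :
    (φ.proj h x : Pt N) = x - ((φ.c α β)⁻¹ * φ.f α β x) • φ.ξ α β := by
  simp [proj]

theorem proj_of_mem (h : α ≻ β) (x : α.T) (hx : x.1 ∈ β.T) : φ.proj h x = ⟨x.1, hx⟩ := by
  apply Subtype.ext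
  rw [proj_coe, φ.f_apply_eq_zero h hx]
  simp

theorem piDown_apply (h : α ≻ β) {b : ℕ} (ω : α.Form (b + 1)) (u : Fin b → β.T) :
    φ.piDown h rfl ω u = (φ.c α β)⁻¹ *
      ω (Fin.cons ⟨φ.ξ α β, φ.ξ_mem h⟩ (fun i => Submodule.inclusion h.1 (u i))) := rfl

theorem wedge_apply (h : α ≻ β) {b : ℕ} (ω : β.Form b) (v : Fin (b + 1) → α.T) :
    φ.wedge h rfl ω v = ∑ i : Fin (b + 1), (-1 : ℂ) ^ (i : ℕ) * (φ.f α β (v i) *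
      ω (fun j => φ.proj h (i.removeNth v j))) := by
  change AlternatingMap.alternatizeUncurryFin _ _ = _
  rw [AlternatingMap.alternatizeUncurryFin_apply]
  refine Finset.sum_congr rfl fun i _ => ?_
  rw [zsmul_eq_mul]
  simp

/-- Evaluation of `df ∧ ω` at a vector followed by vectors in `T_β`. -/
theorem wedge_cons (h : α ≻ β) {b : ℕ} (ω : β.Form b) (x : α.T) (u : Fin b → α.T)
    (hu : ∀ i, (u i).1 ∈ β.T) :
    φ.wedge h rfl ω (Fin.cons x u) = φ.f α β x * ω (fun i => ⟨(u i).1, hu i⟩) := by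
  rw [wedge_apply, Fin.sum_univ_succ, Finset.sum_eq_zero]
  · simp [φ.proj_of_mem h _ (hu _)]
  · intro i _
    simp [φ.f_apply_eq_zero h (hu i)]

/-- Evaluation of `df ∧ ω` at two vectors followed by vectors in `T_β`. -/
theorem wedge_cons_cons (h : α ≻ β) {b : ℕ} (ω : β.Form (b + 1)) (x y : α.T) (u : Fin b → α.T)
    (hu : ∀ i, (u i).1 ∈ β.T) :
    φ.wedge h rfl ω (Fin.cons x (Fin.cons y u)) =
      φ.f α β x * ω (Fin.cons (φ.proj h y) (fun i => ⟨(u i).1, hu i⟩)) -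
      φ.f α β y * ω (Fin.cons (φ.proj h x) (fun i => ⟨(u i).1, hu i⟩)) := by
  rw [wedge_apply, Fin.sum_univ_succ, Fin.sum_univ_succ, Finset.sum_eq_zero]
  · have h1 : (fun j => φ.proj h ((0 : Fin (b + 2)).removeNth (α := fun _ => α.T) (Fin.cons x (Fin.cons y u)) j)) =
        (Fin.cons (φ.proj h y) (fun i => ⟨(u i).1, hu i⟩) : Fin (b + 1) → β.T) := by
      funext j
      refine Fin.cases ?_ (fun j => ?_) j
      · rfl
      · exact φ.proj_of_mem h _ (hu _)
    have h2 : (fun j => φ.proj h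
        ((Fin.succ (0 : Fin (b + 1))).removeNth (α := fun _ => α.T) (Fin.cons x (Fin.cons y u)) j)) =
        (Fin.cons (φ.proj h x) (fun i => ⟨(u i).1, hu i⟩) : Fin (b + 1) → β.T) := by
      funext j
      refine Fin.cases ?_ (fun j => ?_) j
      · rfl
      · exact φ.proj_of_mem h _ (hu _)
    rw [h1, h2]
    simp
    ring
  · intro i _
    simp [φ.f_apply_eq_zero h (hu i)]

/-- A top form is determined by its substitution of `ξ_{α,β}`, restricted to `β`. -/
theorem form_ext (h : α ≻ β) {b : ℕ} (hb : finrank ℂ α.T = b + 1) {ω ω' : α.Form (b + 1)}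
    (hω : ∀ u : Fin b → β.T,
      ω (Fin.cons ⟨φ.ξ α β, φ.ξ_mem h⟩ (fun i => Submodule.inclusion h.1 (u i))) =
      ω' (Fin.cons ⟨φ.ξ α β, φ.ξ_mem h⟩ (fun i => Submodule.inclusion h.1 (u i)))) :
    ω = ω' := by
  have hb' : finrank ℂ β.T = b := by have := h.2; omega
  let e : Module.Basis (Fin b) ℂ β.T := Module.finBasisOfFinrankEq ℂ β.T hb'
  let e' := Module.Basis.mkFinConsOfLE (φ.ξ α β) (φ.ξ_mem h) e h.1
    (fun c x hx hc => by
      by_contra h0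
      refine φ.ξ_notMem h ?_
      have : φ.ξ α β = - (c⁻¹ • x) := by
        rw [eq_neg_iff_add_eq_zero, ← smul_right_injective _ h0 |>.eq_iff]
        simpa [smul_smul, h0] using hc
      rw [this]
      exact β.T.neg_mem (β.T.smul_mem _ hx))
    (fun z hz => ⟨- ((φ.c α β)⁻¹ * φ.f α β z), by
      simpa [sub_eq_add_neg] using φ.sub_mem h hz⟩)
  rw [← sub_eq_zero, ← AlternatingMap.map_basis_eq_zero_iff e', AlternatingMap.sub_apply,
    sub_eq_zero]
  have he : (e' : Fin (b + 1) → α.T) =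
      Fin.cons ⟨φ.ξ α β, φ.ξ_mem h⟩ (fun i => Submodule.inclusion h.1 (e i)) := by
    simp [e', Module.Basis.coe_mkFinConsOfLE]
    rfl
  rw [he]
  exact hω e

/-- The defining property of `π_{β,α}` for `α ≻ β`. -/
theorem wedge_piDown (h : α ≻ β) {b : ℕ} (hb : finrank ℂ α.T = b + 1) (ω : α.Form (b + 1)) :
    φ.wedge h rfl (φ.piDown h rfl ω) = ω := by
  refine φ.form_ext h hb fun u => ?_
  rw [φ.wedge_cons h _ _ _ (fun i => (u i).2), piDown_apply, ← mul_assoc]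
  change φ.c α β * _ * _ = _
  rw [mul_inv_cancel₀ (φ.c_ne_zero h), one_mul]
  rfl

/-- The defining property of `π_{α,β}` for `α ≻ β`. -/
theorem piUp_cons (h : α ≻ β) {b : ℕ} (ω : β.Form b) (u : Fin b → β.T) :
    φ.piUp h rfl ω (Fin.cons ⟨φ.ξ α β, φ.ξ_mem h⟩ (fun i => Submodule.inclusion h.1 (u i))) =
      ω u := by
  change (φ.c α β)⁻¹ * φ.wedge h rfl ω _ = _
  rw [φ.wedge_cons h _ _ _ (fun i => (u i).2), ← mul_assoc]
  change _ * φ.c α β * _ = _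
  rw [inv_mul_cancel₀ (φ.c_ne_zero h), one_mul]
  rfl

end EdgeFraming
end Arrangement

namespace Arrangement

variable {𝒞 : Arrangement N}

theorem Vertex.codim_add (α : 𝒞.Vertex) : α.codim + finrank ℂ α.T = N := by
  rw [Vertex.codim, Submodule.finrank_quotient_add_finrank, Module.finrank_fin_fun]

namespace EdgeFraming

variable (φ : EdgeFraming 𝒞) {α β γ : 𝒞.Vertex}

theorem shift_down_fst (h : α ≻ β) (h' : α ≻ β ∨ β ≻ α) (t : α.TF) :
    (φ.shift h' t).1.1 = φ.proj h ⟨t.1.1, t.2.1⟩ := by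
  change (t.1 - φ.pairing α β t • φ.vec α β).1 = _
  rw [φ.pairing_down h, φ.proj_coe]
  simp [vec, h, smul_smul, mul_comm]

theorem shift_down_snd (h : α ≻ β) (h' : α ≻ β ∨ β ≻ α) (t : α.TF) :
    (φ.shift h' t).1.2 = t.1.2 := by
  change (t.1 - φ.pairing α β t • φ.vec α β).2 = _
  simp [vec, h]

theorem shift_up_fst (h : β ≻ α) (h' : α ≻ β ∨ β ≻ α) (t : α.TF) :
    (φ.shift h' t).1.1 = t.1.1 := by
  change (t.1 - φ.pairing α β t • φ.vec α β).1 = _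
  simp [vec, h, h.asymm]

theorem shift_up_snd (h : β ≻ α) (h' : α ≻ β ∨ β ≻ α) (t : α.TF) :
    (φ.shift h' t).1.2 = t.1.2 - ((φ.c β α)⁻¹ * t.1.2 (φ.ξ β α)) • φ.f β α := by
  change (t.1 - φ.pairing α β t • φ.vec α β).2 = _
  rw [φ.pairing_up h]
  simp [vec, h, h.asymm, smul_smul, mul_comm]

theorem π_down (h : α ≻ β) (h' : α ≻ β ∨ β ≻ α) : φ.π h' = φ.piDown h h.2 := by
  simp [π, h]

theorem π_up (h : β ≻ α) (h' : α ≻ β ∨ β ≻ α) : φ.π h' = φ.piUp h h.2 := by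
  simp [π, h.asymm]

/-- The antisymmetrized coefficient of a double substitution. -/
def coef (h1 : α ≻ β ∨ β ≻ α) (t t' : α.TF) : ℂ :=
  φ.pairing α β t * φ.pairing β γ (φ.shift h1 t') - φ.pairing α β t' * φ.pairing β γ (φ.shift h1 t)

/-- `wedge_piDown`, evaluated at a vector followed by vectors in `T_β`. -/
theorem f_mul_piDown (h : α ≻ β) {b : ℕ} (hb : finrank ℂ α.T = b + 1) (ω : α.Form (b + 1))
    (x : α.T) (u : Fin b → β.T) :
    φ.f α β x * φ.piDown h rfl ω u = ω (Fin.cons x (fun i => Submodule.inclusion h.1 (u i))) := by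
  conv_rhs => rw [← φ.wedge_piDown h hb ω]
  rw [φ.wedge_cons h _ _ _ (fun i => (u i).2)]
  rfl

theorem down_down {a c : ℕ} (hac : a = c + 1 + 1) (ha : finrank ℂ α.T = a) (w : α.Form a)
    (x y : α.T) : ∃ τ : γ.Form c, ∀ (β : 𝒞.Vertex) (h1 : α ≻ β) (h2 : β ≻ γ) (b : ℕ)
      (hab : a = b + 1) (hbc : b = c + 1),
      (φ.f α β x * φ.f β γ (φ.proj h1 y) - φ.f α β y * φ.f β γ (φ.proj h1 x)) •
        φ.piDown h2 hbc (φ.piDown h1 hab w) = τ := by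
  subst hac
  by_cases hle : γ.T ≤ α.T
  · refine ⟨((w.curryLeft x).curryLeft y).compLinearMap (Submodule.inclusion hle), ?_⟩
    rintro β h1 h2 b hab rfl
    have hb : finrank ℂ β.T = c + 1 := by have := h1.2; omega
    ext u
    change _ = w (Fin.cons x (Fin.cons y fun i => Submodule.inclusion hle (u i)))
    conv_rhs => rw [← φ.wedge_piDown h1 ha w]
    rw [φ.wedge_cons_cons h1 _ _ _ _ (fun i => h2.1 (u i).2)]
    have e1 := φ.f_mul_piDown h2 hb (φ.piDown h1 rfl w) (φ.proj h1 y) u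
    have e2 := φ.f_mul_piDown h2 hb (φ.piDown h1 rfl w) (φ.proj h1 x) u
    change _ = _ * (φ.piDown h1 rfl w) (Fin.cons _ fun i => Submodule.inclusion h2.1 (u i)) -
      _ * (φ.piDown h1 rfl w) (Fin.cons _ fun i => Submodule.inclusion h2.1 (u i))
    rw [← e1, ← e2, AlternatingMap.smul_apply, smul_eq_mul]
    ring
  · exact ⟨0, fun β h1 h2 => absurd (h2.1.trans h1.1) hle⟩

theorem up_up_apply (h1 : β ≻ α) (h2 : γ ≻ β) {a : ℕ} (w : α.Form a) (s s' : γ.T)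
    (u : Fin a → γ.T) (hu : ∀ i, (u i).1 ∈ α.T) (g g' : Module.Dual ℂ (Pt N)) (hg : g ∈ α.F)
    (hg' : g' ∈ α.F) :
    (g (φ.ξ β α) * g' (φ.ξ γ β) - g' (φ.ξ β α) * g (φ.ξ γ β)) *
      φ.piUp h2 rfl (φ.piUp h1 rfl w) (Fin.cons s (Fin.cons s' u)) =
      (g s' * g' s - g s * g' s') * w (fun i => ⟨(u i).1, hu i⟩) := by
  have hu' : ∀ i, (u i).1 ∈ β.T := fun i => h1.1 (hu i)
  change _ * ((φ.c γ β)⁻¹ * φ.wedge h2 rfl _ _) = _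
  rw [φ.wedge_cons_cons h2 _ _ _ _ hu']
  change _ * ((φ.c γ β)⁻¹ * (_ * ((φ.c β α)⁻¹ * φ.wedge h1 rfl w _) -
    _ * ((φ.c β α)⁻¹ * φ.wedge h1 rfl w _))) = _
  rw [φ.wedge_cons h1 _ _ _ hu, φ.wedge_cons h1 _ _ _ hu]
  have hc1 := φ.c_ne_zero h1
  have hc2 := φ.c_ne_zero h2
  have key : ∀ (k : Module.Dual ℂ (Pt N)), k ∈ α.F → ∀ z : γ.T, k z =
      (φ.c γ β)⁻¹ * φ.f γ β z * k (φ.ξ γ β) +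
        (φ.c β α)⁻¹ * φ.f β α (φ.proj h2 z) * k (φ.ξ β α) := by
    intro k hk z
    have h0 := (Submodule.mem_dualAnnihilator _).mp hk _ (φ.proj h1 (φ.proj h2 z)).2
    rw [proj_coe, map_sub, map_smul, sub_eq_zero] at h0
    have h3 : k (φ.proj h2 z : Pt N) = k z - (φ.c γ β)⁻¹ * φ.f γ β z * k (φ.ξ γ β) := by
      rw [proj_coe, map_sub, map_smul, smul_eq_mul]
    rw [h3] at h0
    simp only [smul_eq_mul] at h0
    linear_combination h0
  rw [key g hg s, key g hg s', key g' hg' s, key g' hg' s']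
  field_simp
  ring

theorem up_up {a c : ℕ} (hac : c = a + 1 + 1) (hc : finrank ℂ γ.T = c) (w : α.Form a)
    (g g' : Module.Dual ℂ (Pt N)) (hg : g ∈ α.F) (hg' : g' ∈ α.F) :
    ∃ τ : γ.Form c, ∀ (β : 𝒞.Vertex) (h1 : β ≻ α) (h2 : γ ≻ β) (b : ℕ)
      (hba : b = a + 1) (hcb : c = b + 1),
      (g (φ.ξ β α) * g' (φ.ξ γ β) - g' (φ.ξ β α) * g (φ.ξ γ β)) •
        φ.piUp h2 hcb (φ.piUp h1 hba w) = τ := by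
  subst hac
  by_cases hex : ∃ β₀ : 𝒞.Vertex, β₀ ≻ α ∧ γ ≻ β₀
  · obtain ⟨β₀, k1, k2⟩ := hex
    refine ⟨(g (φ.ξ β₀ α) * g' (φ.ξ γ β₀) - g' (φ.ξ β₀ α) * g (φ.ξ γ β₀)) •
        φ.piUp k2 rfl (φ.piUp k1 rfl w), ?_⟩
    rintro β h1 h2 b rfl hcb
    refine φ.form_ext k2 hc fun u => ?_
    have hβ₀ : finrank ℂ β₀.T = a + 1 := by have := k2.2; omega
    let L : γ.Form (a + 1 + 1) →ₗ[ℂ] β₀.Form (a + 1) :=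
      { toFun := fun ω => (ω.curryLeft ⟨φ.ξ γ β₀, φ.ξ_mem k2⟩).compLinearMap
          (Submodule.inclusion k2.1)
        map_add' := fun _ _ => by ext; simp
        map_smul' := fun _ _ => by ext; simp }
    suffices H : L ((g (φ.ξ β α) * g' (φ.ξ γ β) - g' (φ.ξ β α) * g (φ.ξ γ β)) •
        φ.piUp h2 hcb (φ.piUp h1 rfl w)) =
        L ((g (φ.ξ β₀ α) * g' (φ.ξ γ β₀) - g' (φ.ξ β₀ α) * g (φ.ξ γ β₀)) •
        φ.piUp k2 rfl (φ.piUp k1 rfl w)) from DFunLike.congr_fun H u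
    refine φ.form_ext k1 hβ₀ fun v => ?_
    have hL : ∀ ω : γ.Form (a + 1 + 1), L ω (Fin.cons ⟨φ.ξ β₀ α, φ.ξ_mem k1⟩
        fun i => Submodule.inclusion k1.1 (v i)) =
        ω (Fin.cons ⟨φ.ξ γ β₀, φ.ξ_mem k2⟩ (Fin.cons ⟨φ.ξ β₀ α, k2.1 (φ.ξ_mem k1)⟩
          fun i => ⟨(v i).1, k2.1 (k1.1 (v i).2)⟩)) := by
      intro ω
      refine congrArg ω ?_
      funext i
      refine Fin.cases rfl (fun i => ?_) i
      refine Fin.cases rfl (fun i => rfl) i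
    rw [hL, hL, AlternatingMap.smul_apply, AlternatingMap.smul_apply, smul_eq_mul, smul_eq_mul,
      φ.up_up_apply h1 h2 w _ _ _ (fun i => (v i).2) g g' hg hg',
      φ.up_up_apply k1 k2 w _ _ _ (fun i => (v i).2) g g' hg hg']
  · exact ⟨0, fun β h1 h2 => absurd ⟨β, h1, h2⟩ hex⟩

/-- Passing from `α` to `γ` through a common upper neighbour and through a common lower
neighbour. -/
theorem up_down {δ : 𝒞.Vertex} (h1 : β ≻ α) (h2 : β ≻ γ) (k1 : α ≻ δ) (k2 : γ ≻ δ) {a d : ℕ}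
    (had : a = d + 1) (ha : finrank ℂ α.T = a) (hc : finrank ℂ γ.T = a) (w : α.Form a) (x : α.T)
    (g : Module.Dual ℂ (Pt N)) (hg : g ∈ α.F) :
    (g (φ.ξ β α) * φ.f β γ x) • φ.piDown h2 rfl (φ.piUp h1 rfl w) =
      - ((φ.f α δ x * g (φ.ξ γ δ)) • φ.piUp k2 had (φ.piDown k1 had w)) := by
  subst had
  refine φ.form_ext k2 hc fun u => ?_
  rw [AlternatingMap.neg_apply, AlternatingMap.smul_apply, AlternatingMap.smul_apply, φ.piUp_cons,
    smul_eq_mul, smul_eq_mul]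
  have e1 := φ.f_mul_piDown k1 ha w x u
  have hβ : finrank ℂ β.T = d + 1 + 1 := by have := h1.2; omega
  have e2 := φ.f_mul_piDown h2 hβ (φ.piUp h1 rfl w) ⟨x.1, h1.1 x.2⟩
    (Fin.cons ⟨φ.ξ γ δ, φ.ξ_mem k2⟩ fun i => Submodule.inclusion k2.1 (u i))
  have e3 : (Fin.cons ⟨x.1, h1.1 x.2⟩ fun i => Submodule.inclusion h2.1
      ((Fin.cons ⟨φ.ξ γ δ, φ.ξ_mem k2⟩ fun i => Submodule.inclusion k2.1 (u i) :
        Fin (d + 1) → γ.T) i) : Fin (d + 2) → β.T) =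
      Fin.cons ⟨x.1, h1.1 x.2⟩ (Fin.cons ⟨φ.ξ γ δ, h2.1 (φ.ξ_mem k2)⟩
        fun i => ⟨(u i).1, h2.1 (k2.1 (u i).2)⟩) := by
    funext i
    refine Fin.cases rfl (fun i => ?_) i
    refine Fin.cases rfl (fun i => rfl) i
  rw [e3] at e2
  have e4 : φ.piUp h1 rfl w (Fin.cons ⟨x.1, h1.1 x.2⟩ (Fin.cons ⟨φ.ξ γ δ, h2.1 (φ.ξ_mem k2)⟩
        fun i => ⟨(u i).1, h2.1 (k2.1 (u i).2)⟩)) = - ((φ.c β α)⁻¹ * φ.f β α (φ.ξ γ δ) *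
        w (Fin.cons x (fun i => Submodule.inclusion k1.1 (u i)))) := by
    change (φ.c β α)⁻¹ * φ.wedge h1 rfl w _ = _
    rw [φ.wedge_cons_cons h1 _ _ _ _ (fun i => k1.1 (u i).2), φ.f_apply_eq_zero h1 x.2,
      φ.proj_of_mem h1 ⟨x.1, h1.1 x.2⟩ x.2]
    change (φ.c β α)⁻¹ * (0 * _ - φ.f β α (φ.ξ γ δ) *
      w (Fin.cons x (fun i => Submodule.inclusion k1.1 (u i)))) = _
    ring
  have e5 : g (φ.ξ γ δ) = (φ.c β α)⁻¹ * φ.f β α (φ.ξ γ δ) * g (φ.ξ β α) := by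
    have h0 := (Submodule.mem_dualAnnihilator _).mp hg _ (φ.sub_mem h1 (h2.1 (φ.ξ_mem k2)))
    rw [map_sub, map_smul, sub_eq_zero] at h0
    simpa using h0
  rw [mul_assoc, e2, e4, e5]
  linear_combination (φ.c β α)⁻¹ * φ.f β α (φ.ξ γ δ) * g (φ.ξ β α) * e1

end EdgeFraming

variable {V : 𝒞.Vertex → Type u} [∀ α, AddCommGroup (V α)] [∀ α, Module ℂ (V α)]

theorem Vertex.ext_of_le {α β : 𝒞.Vertex} (h : α.T ≤ β.T)
    (h' : finrank ℂ α.T = finrank ℂ β.T) : α = β :=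
  Vertex.ext (Submodule.eq_of_le_of_finrank_eq h h')

/-- In a central arrangement, two strata with a common upper neighbour have a common lower
neighbour. -/
theorem exists_lower {α β γ : 𝒞.Vertex} (h1 : β ≻ α) (h2 : β ≻ γ) (hne : α ≠ γ) :
    ∃ δ : 𝒞.Vertex, α ≻ δ ∧ γ ≻ δ := by
  obtain ⟨S, hS, hα⟩ := α.exists_eq_sInf
  obtain ⟨S', hS', hγ⟩ := γ.exists_eq_sInf
  refine ⟨⟨α.T ⊓ γ.T, S ∪ S', Set.union_subset hS hS', by rw [sInf_union, ← hα, ← hγ]⟩, ?_⟩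
  have e1 := Submodule.finrank_sup_add_finrank_inf_eq α.T γ.T
  have e2 := Submodule.finrank_mono (sup_le h1.1 h2.1)
  have e3 : finrank ℂ α.T < finrank ℂ (α.T ⊔ γ.T : Submodule ℂ (Pt N)) := by
    refine Submodule.finrank_lt_finrank_of_lt (lt_of_le_of_ne le_sup_left fun he => hne ?_)
    refine (Vertex.ext_of_le ?_ ?_).symm
    · rw [he]; exact le_sup_right
    · have := h1.2; have := h2.2; omega
  have := h1.2
  have := h2.2
  refine ⟨⟨inf_le_left, ?_⟩, ⟨inf_le_right, ?_⟩⟩ <;> (simp only; omega)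

theorem coef_smul (φ : EdgeFraming 𝒞) (α γ : 𝒞.Vertex) (w : α.TopForm) (t t' : α.TF) :
    (∀ (β : 𝒞.Vertex) (h1 : α ≻ β ∨ β ≻ α) (h2 : β ≻ γ ∨ γ ≻ β),
      φ.coef (γ := γ) h1 t t' • φ.π h2 (φ.π h1 w) = 0) ∨
    ((∀ 𝒱 : Quiver 𝒞 V, ∑ β, 𝒱.A γ β ∘ₗ 𝒱.A β α = 0) ∧
      ∃ τ : γ.TopForm, ∀ (β : 𝒞.Vertex) (h1 : α ≻ β ∨ β ≻ α) (h2 : β ≻ γ ∨ γ ≻ β),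
        φ.coef (γ := γ) h1 t t' • φ.π h2 (φ.π h1 w) = τ) := by
  have hα := α.codim_add
  have hγ := γ.codim_add
  by_cases hdd : finrank ℂ α.T = finrank ℂ γ.T + 1 + 1
  · refine .inr ⟨fun 𝒱 => 𝒱.sum_eq_zero_of_codim _ _ (by omega), ?_⟩
    obtain ⟨τ, hτ⟩ := φ.down_down (γ := γ) hdd rfl w ⟨t.1.1, t.2.1⟩ ⟨t'.1.1, t'.2.1⟩
    refine ⟨τ, fun β h1 h2 => ?_⟩
    have h1' : α ≻ β := h1.resolve_right fun h => by
      have := h.2; rcases h2 with h2 | h2 <;> (have := h2.2; omega)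
    have h2' : β ≻ γ := h2.resolve_right fun h => by
      have := h.2; have := h1'.2; omega
    rw [← hτ β h1' h2' _ h1'.2 h2'.2, φ.π_down h1', φ.π_down h2', EdgeFraming.coef,
      φ.pairing_down h1', φ.pairing_down h1', φ.pairing_down h2', φ.pairing_down h2',
      φ.shift_down_fst h1', φ.shift_down_fst h1']
  by_cases huu : finrank ℂ γ.T = finrank ℂ α.T + 1 + 1
  · refine .inr ⟨fun 𝒱 => 𝒱.sum_eq_zero_of_codim _ _ (by omega), ?_⟩
    obtain ⟨τ, hτ⟩ := φ.up_up (γ := γ) huu rfl w t.1.2 t'.1.2 t.2.2 t'.2.2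
    refine ⟨τ, fun β h1 h2 => ?_⟩
    have h1' : β ≻ α := h1.resolve_left fun h => by
      have := h.2; rcases h2 with h2 | h2 <;> (have := h2.2; omega)
    have h2' : γ ≻ β := h2.resolve_left fun h => by
      have := h.2; have := h1'.2; omega
    rw [← hτ β h1' h2' _ h1'.2 h2'.2, φ.π_up h1', φ.π_up h2', EdgeFraming.coef,
      φ.pairing_up h1', φ.pairing_up h1', φ.pairing_up h2', φ.pairing_up h2',
      φ.shift_up_snd h1', φ.shift_up_snd h1']
    congr 1
    simp only [LinearMap.sub_apply, LinearMap.smul_apply, smul_eq_mul]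
    ring
  by_cases heq : finrank ℂ α.T = finrank ℂ γ.T
  swap
  · refine .inl fun β h1 h2 => ?_
    exfalso
    rcases h1 with h1 | h1 <;> rcases h2 with h2 | h2 <;>
      (have := h1.2; have := h2.2; omega)
  by_cases hne : α = γ
  · subst hne
    refine .inl fun β h1 h2 => ?_
    rcases h1 with h1' | h1'
    · rw [EdgeFraming.coef, φ.pairing_up h1', φ.pairing_up h1', φ.shift_down_snd h1',
        φ.shift_down_snd h1', (Submodule.mem_dualAnnihilator _).mp t.2.2 _ (φ.ξ_mem h1'),
        (Submodule.mem_dualAnnihilator _).mp t'.2.2 _ (φ.ξ_mem h1')]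
      simp
    · rw [EdgeFraming.coef, φ.pairing_down h1', φ.pairing_down h1', φ.shift_up_fst h1',
        φ.shift_up_fst h1', φ.f_apply_eq_zero h1' t.2.1, φ.f_apply_eq_zero h1' t'.2.1]
      simp
  by_cases hδ : ∃ δ : 𝒞.Vertex, α ≻ δ ∧ γ ≻ δ
  swap
  · refine .inl fun β h1 h2 => ?_
    exfalso
    rcases h1 with h1 | h1 <;> rcases h2 with h2 | h2
    · have := h1.2; have := h2.2; omega
    · exact hδ ⟨β, h1, h2⟩
    · exact hδ (exists_lower h1 h2 hne)
    · have := h1.2; have := h2.2; omega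
  refine .inr ⟨fun 𝒱 => 𝒱.sum_eq_zero_of_common _ _ (by omega) (Ne.symm hne)
    (hδ.imp fun _ h => h.symm), ?_⟩
  obtain ⟨δ, k1, k2⟩ := hδ
  have had : finrank ℂ α.T = finrank ℂ δ.T + 1 := k1.2
  refine ⟨(φ.f α δ t.1.1 * t'.1.2 (φ.ξ γ δ) - φ.f α δ t'.1.1 * t.1.2 (φ.ξ γ δ)) •
    φ.piUp k2 k2.2 (φ.piDown k1 k1.2 w), fun β h1 h2 => ?_⟩
  rcases h1 with h1' | h1' <;> rcases h2 with h2' | h2'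
  · exfalso; have := h1'.2; have := h2'.2; omega
  · have : β = δ := by
      have hle : β.T ≤ α.T ⊓ γ.T := le_inf h1'.1 h2'.1
      have hle' : δ.T ≤ α.T ⊓ γ.T := le_inf k1.1 k2.1
      have hlt : α.T ⊓ γ.T < α.T := by
        refine lt_of_le_of_ne inf_le_left fun he => hne (Vertex.ext_of_le ?_ heq)
        rw [← he]; exact inf_le_right
      have e1 := Submodule.finrank_lt_finrank_of_lt hlt
      have e2 := h1'.2
      have e3 := k1.2
      have e4 := Submodule.finrank_mono hle
      refine Vertex.ext ?_
      rw [Submodule.eq_of_le_of_finrank_eq hle (by omega),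
        Submodule.eq_of_le_of_finrank_eq hle' (by omega)]
    subst this
    rw [φ.π_down h1', φ.π_up h2', EdgeFraming.coef, φ.pairing_down h1', φ.pairing_down h1',
      φ.pairing_up h2', φ.pairing_up h2', φ.shift_down_snd h1', φ.shift_down_snd h1']
  · have hT : ∀ {a c d : ℕ} (w : α.Form a) (hba : finrank ℂ β.T = a + 1)
        (hbc : finrank ℂ β.T = c + 1) (had : a = d + 1) (hcd : c = d + 1)
        (ha : finrank ℂ α.T = a) (hc : finrank ℂ γ.T = c),
        (t.1.2 (φ.ξ β α) * φ.f β γ t'.1.1 - t'.1.2 (φ.ξ β α) * φ.f β γ t.1.1) •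
          φ.piDown h2' hbc (φ.piUp h1' hba w) =
        (φ.f α δ t.1.1 * t'.1.2 (φ.ξ γ δ) - φ.f α δ t'.1.1 * t.1.2 (φ.ξ γ δ)) •
          φ.piUp k2 hcd (φ.piDown k1 had w) := by
      intro a c d w hba hbc had hcd ha hc
      generalize hB : finrank ℂ β.T = B at hba hbc
      subst had hcd hba
      have e1 := φ.up_down h1' h2' k1 k2 rfl ha hc w ⟨t'.1.1, t'.2.1⟩ t.1.2 t.2.2
      have e2 := φ.up_down h1' h2' k1 k2 rfl ha hc w ⟨t.1.1, t.2.1⟩ t'.1.2 t'.2.2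
      rw [sub_smul, e1, e2, sub_smul]
      abel
    rw [φ.π_up h1', φ.π_down h2', EdgeFraming.coef, φ.pairing_up h1', φ.pairing_up h1',
      φ.pairing_down h2', φ.pairing_down h2', φ.shift_up_fst h1', φ.shift_up_fst h1']
    exact hT w h1'.2 h2'.2 k1.2 k2.2 rfl rfl
  · exfalso; have := h1'.2; have := h2'.2; omega

end Arrangement

namespace Arrangement

variable {𝒞 : Arrangement N}

section DR

variable {V : 𝒞.Vertex → Type u} [∀ α, AddCommGroup (V α)] [∀ α, Module ℂ (V α)]

theorem interior_comm {M : Type*} [AddCommGroup M] [Module ℂ M] (p q : Module.Dual ℂ M) (n : ℕ) :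
    interior p n ∘ₗ interior q (n + 1) = - (interior q n ∘ₗ interior p (n + 1)) := by
  refine LinearMap.ext fun x => Subtype.ext ?_
  rw [LinearMap.neg_apply, Submodule.coe_neg, LinearMap.comp_apply, LinearMap.comp_apply,
    coe_interior, coe_interior, coe_interior, coe_interior, CliffordAlgebra.contractLeft_comm]

theorem map_sub_sub_interior {M M' : Type*} [AddCommGroup M] [Module ℂ M] [AddCommGroup M']
    [Module ℂ M'] (G : M →ₗ[ℂ] M') (p q : Module.Dual ℂ M) (v w : M') (n : ℕ) :
    exteriorPower.map n (G - p.smulRight v - q.smulRight w) ∘ₗ interior q n ∘ₗ interior p (n + 1) =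
      exteriorPower.map n G ∘ₗ interior q n ∘ₗ interior p (n + 1) := by
  rw [← LinearMap.comp_assoc, map_sub_interior, LinearMap.comp_assoc, interior_comm,
    LinearMap.comp_neg, LinearMap.comp_neg, ← LinearMap.comp_assoc, map_sub_interior,
    LinearMap.comp_assoc]

section Generic

variable {ι S M M' Y : Type*} [AddCommGroup S] [Module ℂ S] [AddCommGroup M] [Module ℂ M]
  [AddCommGroup M'] [Module ℂ M'] [AddCommGroup Y] [Module ℂ Y]

theorem sum_tmul_interior_interior [Fintype ι] (G : M →ₗ[ℂ] M') (p ψ : ι → Module.Dual ℂ M)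
    (y : ι → Y) (h : ∀ t t', ∑ i, (p i t * ψ i t' - p i t' * ψ i t) • y i = 0) (n : ℕ) (s : S)
    (x : ⋀[ℂ]^(n + 1 + 1) M) :
    ∑ i, (s ⊗ₜ[ℂ] exteriorPower.map n G (interior (ψ i) n (interior (p i) (n + 1) x))) ⊗ₜ[ℂ] y i =
      0 := by
  let Φ : Y ⊗[ℂ] ⋀[ℂ]^n M →ₗ[ℂ] (S ⊗[ℂ] ⋀[ℂ]^n M') ⊗[ℂ] Y :=
    (TensorProduct.comm ℂ _ _).toLinearMap ∘ₗ LinearMap.lTensor _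
      ((TensorProduct.mk ℂ S _ s) ∘ₗ exteriorPower.map n G)
  have h1 := congrArg Φ (sum_interior_interior p ψ y h n x)
  rw [map_sum, map_zero] at h1
  exact h1

theorem lTensor_map_interior_koszul {a : M →ₗ[ℂ] S →ₗ[ℂ] S} {a' : M' →ₗ[ℂ] S →ₗ[ℂ] S}
    {P : M →ₗ[ℂ] M'} {p : Module.Dual ℂ M} {b : S →ₗ[ℂ] S}
    (h : a = a' ∘ₗ P + p.smulRight b) (n : ℕ) :
    LinearMap.lTensor S (exteriorPower.map n P ∘ₗ interior p n) ∘ₗ koszul a (n + 1) +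
      koszul a' n ∘ₗ LinearMap.lTensor S (exteriorPower.map (n + 1) P ∘ₗ interior p (n + 1)) =
      0 := by
  have e1 : LinearMap.lTensor S (interior p n) ∘ₗ
      TensorProduct.map b (interior p (n + 1)) = 0 := by
    rw [LinearMap.lTensor, ← TensorProduct.map_comp, interior_interior, TensorProduct.map_zero_right]
  rw [h, koszul_smulRight,
    LinearMap.lTensor_comp, LinearMap.lTensor_comp, LinearMap.comp_assoc, LinearMap.comp_add, e1,
    add_zero, ← LinearMap.comp_assoc _ _ (koszul _ n), koszul_map, LinearMap.comp_assoc,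
    ← LinearMap.comp_add, interior_koszul, LinearMap.comp_zero]

theorem map_comp_rTensor_add {Z Z₁ Z' Z₁' W W' : Type*} [AddCommMonoid Z] [Module ℂ Z]
    [AddCommMonoid Z₁] [Module ℂ Z₁] [AddCommMonoid Z'] [Module ℂ Z'] [AddCommMonoid Z₁']
    [Module ℂ Z₁'] [AddCommMonoid W] [Module ℂ W] [AddCommMonoid W'] [Module ℂ W']
    {k : Z →ₗ[ℂ] Z₁} {f : Z₁ →ₗ[ℂ] Z₁'} {f' : Z →ₗ[ℂ] Z'} {k' : Z' →ₗ[ℂ] Z₁'}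
    (h : f ∘ₗ k + k' ∘ₗ f' = 0) (g : W →ₗ[ℂ] W') :
    TensorProduct.map f g ∘ₗ LinearMap.rTensor W k +
      LinearMap.rTensor W' k' ∘ₗ TensorProduct.map f' g = 0 := by
  rw [LinearMap.rTensor, LinearMap.rTensor, ← TensorProduct.map_comp, ← TensorProduct.map_comp,
    LinearMap.id_comp, LinearMap.comp_id, ← TensorProduct.map_add_left, h,
    TensorProduct.map_zero_left]

end Generic

theorem substitution_substitution (φ : EdgeFraming 𝒞) {α β γ : 𝒞.Vertex} (h1 : α ≻ β ∨ β ≻ α)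
    (h2 : β ≻ γ ∨ γ ≻ β) (n : ℕ)
    (g : Pt N × Module.Dual ℂ (Pt N) →ₗ[ℂ] γ.TF) (hg : g ∘ₗ γ.TF.subtype = LinearMap.id) :
    φ.substitution h2 n ∘ₗ φ.substitution h1 (n + 1) =
      exteriorPower.map n (g ∘ₗ α.TF.subtype) ∘ₗ
        interior (φ.pairing β γ ∘ₗ φ.shift h1) n ∘ₗ interior (φ.pairing α β) (n + 1) := by
  have e : φ.shift h2 ∘ₗ φ.shift h1 = g ∘ₗ α.TF.subtype -
      (φ.pairing α β).smulRight (g (φ.vec α β)) -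
      (φ.pairing β γ ∘ₗ φ.shift h1).smulRight (g (φ.vec β γ)) := by
    refine LinearMap.ext fun t => ?_
    have h3 := LinearMap.congr_fun hg (φ.shift h2 (φ.shift h1 t))
    rw [LinearMap.comp_apply, LinearMap.id_apply] at h3
    rw [LinearMap.comp_apply, ← h3]
    change g (t.1 - φ.pairing α β t • φ.vec α β -
      φ.pairing β γ (φ.shift h1 t) • φ.vec β γ) = _
    rw [map_sub, map_sub, map_smul, map_smul]
    rfl
  have e2 := map_sub_sub_interior (g ∘ₗ α.TF.subtype) (φ.pairing α β) (φ.pairing β γ ∘ₗ φ.shift h1)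
    (g (φ.vec α β)) (g (φ.vec β γ)) n
  rw [← e, exteriorPower.map_comp] at e2
  rw [← e2]
  refine LinearMap.ext fun x => ?_
  exact congrArg (exteriorPower.map n (φ.shift h2)) (LinearMap.congr_fun
    (interior_map (φ.pairing β γ) (φ.shift h1) n) (interior (φ.pairing α β) (n + 1) x))

variable (V) in
/-- A pure tensor in the summand of the vertex `α`. -/
def Vertex.pure {α : 𝒞.Vertex} {n : ℕ} (s : HolForm N) (x : ⋀[ℂ]^n α.TF) (y : α.TopForm ⊗[ℂ] V α) :
    α.Term V n :=
  (s ⊗ₜ[ℂ] x) ⊗ₜ[ℂ] y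

theorem Vertex.term_ext {α : 𝒞.Vertex} {n : ℕ} {W : Type*} [AddCommMonoid W] [Module ℂ W]
    {f g : α.Term V n →ₗ[ℂ] W}
    (h : ∀ s x w v, f (Vertex.pure V s x (w ⊗ₜ[ℂ] v)) = g (Vertex.pure V s x (w ⊗ₜ[ℂ] v))) :
    f = g :=
  TensorProduct.ext_fourfold' h

theorem edgeMap_pure (φ : EdgeFraming 𝒞) (𝒱 : Quiver 𝒞 V) {α β : 𝒞.Vertex}
    (h : α ≻ β ∨ β ≻ α) (n : ℕ) (s : HolForm N) (x : ⋀[ℂ]^(n + 1) α.TF) (w : α.TopForm) (v : V α) :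
    edgeMap φ 𝒱 α β n (Vertex.pure V s x (w ⊗ₜ[ℂ] v)) =
      Vertex.pure V s (φ.substitution h n x) (φ.π h w ⊗ₜ[ℂ] 𝒱.A β α v) := by
  rw [edgeMap, dif_pos h]
  rfl

theorem edgeMap_eq_zero (φ : EdgeFraming 𝒞) (𝒱 : Quiver 𝒞 V) {α β : 𝒞.Vertex}
    (h : ¬ (α ≻ β ∨ β ≻ α)) (n : ℕ) : edgeMap φ 𝒱 α β n = 0 := by
  rw [edgeMap, dif_neg h]

theorem pure_zero {α : 𝒞.Vertex} {n : ℕ} (s : HolForm N) (x : ⋀[ℂ]^n α.TF) :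
    Vertex.pure V s x 0 = 0 :=
  TensorProduct.tmul_zero _ _

theorem edgeMap_edgeMap_pure (φ : EdgeFraming 𝒞) (𝒱 : Quiver 𝒞 V) {α β γ : 𝒞.Vertex}
    (h1 : α ≻ β ∨ β ≻ α) (h2 : β ≻ γ ∨ γ ≻ β) (n : ℕ)
    (g : Pt N × Module.Dual ℂ (Pt N) →ₗ[ℂ] γ.TF) (hg : g ∘ₗ γ.TF.subtype = LinearMap.id)
    {ψ : Module.Dual ℂ α.TF} (hψ : ψ = φ.pairing β γ ∘ₗ φ.shift h1)
    (s : HolForm N) (x : ⋀[ℂ]^(n + 1 + 1) α.TF) (w : α.TopForm) (v : V α) :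
    edgeMap φ 𝒱 β γ n (edgeMap φ 𝒱 α β (n + 1) (Vertex.pure V s x (w ⊗ₜ[ℂ] v))) =
      Vertex.pure V s (exteriorPower.map n (g ∘ₗ α.TF.subtype)
        (interior ψ n (interior (φ.pairing α β) (n + 1) x)))
        (φ.π h2 (φ.π h1 w) ⊗ₜ[ℂ] 𝒱.A γ β (𝒱.A β α v)) := by
  subst hψ
  rw [edgeMap_pure φ 𝒱 h1 (n + 1), edgeMap_pure φ 𝒱 h2 n]
  exact congrArg (fun z => Vertex.pure V s z _)
    (LinearMap.congr_fun (substitution_substitution φ h1 h2 n g hg) x)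

theorem sum_edgeMap_edgeMap_tmul (φ : EdgeFraming 𝒞) (𝒱 : Quiver 𝒞 V) (α γ : 𝒞.Vertex) (n : ℕ)
    (s : HolForm N) (x : ⋀[ℂ]^(n + 1 + 1) α.TF) (w : α.TopForm) (v : V α) :
    ∑ β, edgeMap φ 𝒱 β γ n (edgeMap φ 𝒱 α β (n + 1) (Vertex.pure V s x (w ⊗ₜ[ℂ] v))) = 0 := by
  classical
  obtain ⟨g, hg⟩ := LinearMap.exists_leftInverse_of_injective γ.TF.subtype
    (LinearMap.ker_eq_bot.mpr γ.TF.injective_subtype)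
  let y : 𝒞.Vertex → γ.TopForm ⊗[ℂ] V γ := fun β =>
    if h1 : α ≻ β ∨ β ≻ α then if h2 : β ≻ γ ∨ γ ≻ β then
      φ.π h2 (φ.π h1 w) ⊗ₜ 𝒱.A γ β (𝒱.A β α v) else 0 else 0
  let ψ : 𝒞.Vertex → Module.Dual ℂ α.TF := fun β =>
    if h1 : α ≻ β ∨ β ≻ α then φ.pairing β γ ∘ₗ φ.shift h1 else 0
  have hy : ∀ β (h1 : α ≻ β ∨ β ≻ α) (h2 : β ≻ γ ∨ γ ≻ β),
      y β = φ.π h2 (φ.π h1 w) ⊗ₜ 𝒱.A γ β (𝒱.A β α v) := by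
    intro β h1 h2
    simp only [y, dif_pos h1, dif_pos h2]
  have hψ : ∀ β (h1 : α ≻ β ∨ β ≻ α), ψ β = φ.pairing β γ ∘ₗ φ.shift h1 := by
    intro β h1
    simp only [ψ, dif_pos h1]
  have hy1 : ∀ β, ¬ (α ≻ β ∨ β ≻ α) → y β = 0 := by
    intro β h1
    simp only [y, dif_neg h1]
  have hy2 : ∀ β, ¬ (β ≻ γ ∨ γ ≻ β) → y β = 0 := by
    intro β h2
    by_cases h1 : α ≻ β ∨ β ≻ α
    · simp only [y, dif_pos h1, dif_neg h2]
    · exact hy1 β h1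
  clear_value y ψ
  have hterm : ∀ β, edgeMap φ 𝒱 β γ n (edgeMap φ 𝒱 α β (n + 1)
      (Vertex.pure V s x (w ⊗ₜ[ℂ] v))) =
      Vertex.pure V s (exteriorPower.map n (g ∘ₗ α.TF.subtype)
        (interior (ψ β) n (interior (φ.pairing α β) (n + 1) x))) (y β) := by
    intro β
    by_cases h1 : α ≻ β ∨ β ≻ α
    · by_cases h2 : β ≻ γ ∨ γ ≻ β
      · exact (hy β h1 h2) ▸ edgeMap_edgeMap_pure φ 𝒱 h1 h2 n g hg (hψ β h1) s x w v
      · rw [edgeMap_eq_zero φ 𝒱 h2 n, LinearMap.zero_apply, hy2 β h2, pure_zero]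
    · rw [edgeMap_eq_zero φ 𝒱 h1 (n + 1), LinearMap.zero_apply, map_zero, hy1 β h1, pure_zero]
  rw [Finset.sum_congr rfl fun β _ => hterm β]
  refine sum_tmul_interior_interior (g ∘ₗ α.TF.subtype) (fun β => φ.pairing α β) ψ y ?_ n s x
  intro t t'
  have hco : ∀ β (h1 : α ≻ β ∨ β ≻ α) (h2 : β ≻ γ ∨ γ ≻ β),
      (φ.pairing α β t * ψ β t' - φ.pairing α β t' * ψ β t) • y β =
      (φ.coef (γ := γ) h1 t t' • φ.π h2 (φ.π h1 w)) ⊗ₜ[ℂ] 𝒱.A γ β (𝒱.A β α v) := by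
    intro β h1 h2
    rw [hy β h1 h2, hψ β h1, TensorProduct.smul_tmul']
    rfl
  rcases coef_smul (V := V) φ α γ w t t' with h | ⟨hA, τ, hτ⟩
  · refine Finset.sum_eq_zero fun β _ => ?_
    by_cases h1 : α ≻ β ∨ β ≻ α
    · by_cases h2 : β ≻ γ ∨ γ ≻ β
      · rw [hco β h1 h2, h β h1 h2, TensorProduct.zero_tmul]
      · rw [hy2 β h2, smul_zero]
    · rw [hy1 β h1, smul_zero]
  · have : ∀ β, (φ.pairing α β t * ψ β t' - φ.pairing α β t' * ψ β t) • y β =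
        τ ⊗ₜ[ℂ] 𝒱.A γ β (𝒱.A β α v) := by
      intro β
      by_cases h1 : α ≻ β ∨ β ≻ α
      · by_cases h2 : β ≻ γ ∨ γ ≻ β
        · rw [hco β h1 h2, hτ β h1 h2]
        · rw [𝒱.A_eq_zero γ β (fun h => h2 h.symm), hy2 β h2, smul_zero, LinearMap.zero_apply,
            TensorProduct.tmul_zero]
      · rw [𝒱.A_eq_zero β α (fun h => h1 h.symm), hy1 β h1, smul_zero, LinearMap.zero_apply,
          map_zero, TensorProduct.tmul_zero]
    rw [Finset.sum_congr rfl fun β _ => this β, ← TensorProduct.tmul_sum]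
    have h0 := LinearMap.congr_fun (hA 𝒱) v
    simp only [LinearMap.sum_apply, LinearMap.comp_apply, LinearMap.zero_apply] at h0
    rw [h0, TensorProduct.tmul_zero]

theorem sum_edgeMap_edgeMap (φ : EdgeFraming 𝒞) (𝒱 : Quiver 𝒞 V) (α γ : 𝒞.Vertex) (n : ℕ) :
    ∑ β, edgeMap φ 𝒱 β γ n ∘ₗ edgeMap φ 𝒱 α β (n + 1) = 0 := by
  refine Vertex.term_ext fun s x w v => ?_
  rw [LinearMap.sum_apply, LinearMap.zero_apply]
  exact sum_edgeMap_edgeMap_tmul φ 𝒱 α γ n s x w v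

theorem act_comm (α : 𝒞.Vertex) (t t' : α.TF) (ω : HolForm N) :
    α.act t (α.act t' ω) = α.act t' (α.act t ω) :=
  rightAct_comm _ _ ((Submodule.mem_dualAnnihilator _).mp t.2.2 _ t'.2.1)
    ((Submodule.mem_dualAnnihilator _).mp t'.2.2 _ t.2.1) ω

theorem act_eq (φ : EdgeFraming 𝒞) {α β : 𝒞.Vertex} (h : α ≻ β ∨ β ≻ α) :
    α.act = β.act ∘ₗ φ.shift h + (φ.pairing α β).smulRight (rightAct (φ.vec α β)) := by
  refine LinearMap.ext fun t => ?_
  change rightAct t.1 = rightAct (t.1 - φ.pairing α β t • φ.vec α β) +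
    φ.pairing α β t • rightAct (φ.vec α β)
  rw [map_sub, map_smul, sub_add_cancel]

theorem lTensor_substitution_koszul (φ : EdgeFraming 𝒞) {α β : 𝒞.Vertex} (h : α ≻ β ∨ β ≻ α)
    (n : ℕ) :
    LinearMap.lTensor (HolForm N) (φ.substitution h n) ∘ₗ
        koszul (M := α.TF) (S := HolForm N) α.act (n + 1) +
      koszul (M := β.TF) (S := HolForm N) β.act n ∘ₗ
        LinearMap.lTensor (HolForm N) (φ.substitution h (n + 1)) = 0 :=
  lTensor_map_interior_koszul (act_eq φ h) n

theorem edgeMap_koszulTerm (φ : EdgeFraming 𝒞) (𝒱 : Quiver 𝒞 V) (α β : 𝒞.Vertex) (n : ℕ) :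
    edgeMap φ 𝒱 α β n ∘ₗ α.koszulTerm V (n + 1) + β.koszulTerm V n ∘ₗ edgeMap φ 𝒱 α β (n + 1) =
      0 := by
  by_cases h : α ≻ β ∨ β ≻ α
  · rw [edgeMap, edgeMap, dif_pos h, dif_pos h]
    exact map_comp_rTensor_add (lTensor_substitution_koszul φ h n)
      (TensorProduct.map (φ.π h) (𝒱.A β α))
  · rw [edgeMap_eq_zero φ 𝒱 h n, edgeMap_eq_zero φ 𝒱 h (n + 1), LinearMap.zero_comp, LinearMap.comp_zero,
      add_zero]

theorem koszulTerm_koszulTerm (α : 𝒞.Vertex) (n : ℕ) :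
    α.koszulTerm V n ∘ₗ α.koszulTerm V (n + 1) = 0 := by
  have e := congrArg (LinearMap.rTensor (α.TopForm ⊗[ℂ] V α))
    (koszul_koszul (M := α.TF) (S := HolForm N) α.act (act_comm α) n)
  rw [LinearMap.rTensor_comp, LinearMap.rTensor_zero] at e
  exact e

/-- The differential `d = d₁ - d₀`. -/
def dDR (φ : EdgeFraming 𝒞) (𝒱 : Quiver 𝒞 V) (n : ℕ) : DRTerm V (n + 1) →ₗ[ℂ] DRTerm V n :=
  d₁ V n - d₀ φ 𝒱 n

theorem dDR_comp_dDR (φ : EdgeFraming 𝒞) (𝒱 : Quiver 𝒞 V) (n : ℕ) :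
    dDR φ 𝒱 n ∘ₗ dDR φ 𝒱 (n + 1) = 0 := by
  have h11 : d₁ V n ∘ₗ d₁ V (n + 1) = 0 := by
    refine LinearMap.ext fun q => funext fun α => ?_
    exact LinearMap.congr_fun (koszulTerm_koszulTerm α n) (q α)
  have h00 : d₀ φ 𝒱 n ∘ₗ d₀ φ 𝒱 (n + 1) = 0 := by
    refine LinearMap.ext fun q => funext fun γ => ?_
    simp only [d₀, LinearMap.comp_apply, LinearMap.pi_apply, LinearMap.sum_apply,
      LinearMap.proj_apply, map_sum, LinearMap.zero_apply, Pi.zero_apply]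
    rw [Finset.sum_comm]
    refine Finset.sum_eq_zero fun α _ => ?_
    simpa using LinearMap.congr_fun (sum_edgeMap_edgeMap φ 𝒱 α γ n) (q α)
  have h01 : d₀ φ 𝒱 n ∘ₗ d₁ V (n + 1) + d₁ V n ∘ₗ d₀ φ 𝒱 (n + 1) = 0 := by
    refine LinearMap.ext fun q => funext fun β => ?_
    simp only [d₀, d₁, LinearMap.add_apply, LinearMap.comp_apply, LinearMap.pi_apply,
      LinearMap.sum_apply, Pi.add_apply,
      LinearMap.proj_apply, map_sum, LinearMap.zero_apply, Pi.zero_apply]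
    rw [← Finset.sum_add_distrib]
    refine Finset.sum_eq_zero fun α _ => ?_
    exact LinearMap.congr_fun (edgeMap_koszulTerm φ 𝒱 α β n) (q α)
  rw [dDR, dDR, LinearMap.sub_comp, LinearMap.comp_sub, LinearMap.comp_sub, h11, h00, zero_sub,
    sub_zero, ← neg_add', neg_eq_zero, ← h01]
  exact add_comm _ _

variable (V) in
/-- The term of degree `r` of the complex of global sections. For `r ≤ 0` the index set consists
of the single number `-r`, for `r > 0` it is empty and the term is zero. -/
abbrev DRObj (r : ℤ) : Type u := ∀ n : {n : ℕ // (n : ℤ) = -r}, DRTerm V n.1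

/-- The differential of the complex of global sections, in degree `r`. -/
def dDRInt (φ : EdgeFraming 𝒞) (𝒱 : Quiver 𝒞 V) (r : ℤ) : DRObj V r →ₗ[ℂ] DRObj V (r + 1) :=
  LinearMap.pi fun n => dDR φ 𝒱 n.1 ∘ₗ
    LinearMap.proj (⟨n.1 + 1, by have := n.2; push_cast; omega⟩ : {n : ℕ // (n : ℤ) = -r})

/-- The complex of global sections of the de Rham complex of the quiver `𝒱`, in degrees
`-N, …, 0`. -/
def deRhamComplex (φ : EdgeFraming 𝒞) (𝒱 : Quiver 𝒞 V) : CochainComplex (ModuleCat.{u} ℂ) ℤ :=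
  CochainComplex.of (fun r => ModuleCat.of ℂ (DRObj V r)) (fun r => ModuleCat.ofHom (dDRInt φ 𝒱 r))
    fun r => by
      rw [← ModuleCat.ofHom_comp]
      have : dDRInt φ 𝒱 (r + 1) ∘ₗ dDRInt φ 𝒱 r = 0 := by
        refine LinearMap.ext fun q => funext fun n => ?_
        exact LinearMap.congr_fun (dDR_comp_dDR φ 𝒱 n.1) _
      rw [this]
      rfl

variable (V) in
/-- The direct sum `C_k` of the spaces `V α` with `l(α) = k`. -/
abbrev QuiverObj (k : ℤ) : Type u := ∀ α : {α : 𝒞.Vertex // (α.codim : ℤ) = k}, V α.1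

/-- The differential `v ↦ ∑ A_{β,α} v`, for `v` in `V α`, of the quiver complex. As the maps
`A_{β,α}` between nonadjacent vertices vanish, the sum is over those `β` with `α ≻ β`. -/
def dQuiver (𝒱 : Quiver 𝒞 V) (k : ℤ) : QuiverObj V k →ₗ[ℂ] QuiverObj V (k + 1) :=
  LinearMap.pi fun β => ∑ α : {α : 𝒞.Vertex // (α.codim : ℤ) = k},
    𝒱.A β.1 α.1 ∘ₗ LinearMap.proj α

theorem dQuiver_comp_dQuiver (𝒱 : Quiver 𝒞 V) (k : ℤ) :
    dQuiver 𝒱 (k + 1) ∘ₗ dQuiver 𝒱 k = 0 := by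
  classical
  refine LinearMap.ext fun q => funext fun γ => ?_
  simp only [dQuiver, LinearMap.comp_apply, LinearMap.pi_apply, LinearMap.sum_apply,
    LinearMap.proj_apply, map_sum, LinearMap.zero_apply, Pi.zero_apply]
  rw [Finset.sum_comm]
  refine Finset.sum_eq_zero fun α _ => ?_
  have h1 := 𝒱.sum_eq_zero_of_codim γ.1 α.1 (by have := γ.2; have := α.2; omega)
  have h2 := LinearMap.congr_fun h1 (q α)
  simp only [LinearMap.sum_apply, LinearMap.comp_apply, LinearMap.zero_apply] at h2
  rw [← h2]
  refine Eq.trans ?_ (Finset.sum_filter_of_ne (p := fun β : 𝒞.Vertex => (β.codim : ℤ) = k + 1) ?_)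
  · exact (Finset.sum_subtype _ (by simp) fun β => 𝒱.A γ.1 β (𝒱.A β α.1 (q α))).symm
  · intro β _ hne
    have hα : β ≻ α.1 ∨ α.1 ≻ β := by
      by_contra hc
      exact hne (by rw [𝒱.A_eq_zero _ _ hc, LinearMap.zero_apply, map_zero])
    have hγ : γ.1 ≻ β ∨ β ≻ γ.1 := by
      by_contra hc
      exact hne (by rw [𝒱.A_eq_zero _ _ hc, LinearMap.zero_apply])
    have e1 := α.1.codim_add
    have e2 := β.codim_add
    have e3 := γ.1.codim_add
    have e4 := α.2
    have e5 := γ.2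
    rcases hα with hα | hα <;> rcases hγ with hγ | hγ <;>
      (have e6 := hα.2; have e7 := hγ.2; omega)

/-- The quiver complex `C₊(𝒱)`. -/
def quiverComplex (𝒱 : Quiver 𝒞 V) : CochainComplex (ModuleCat.{u} ℂ) ℤ :=
  CochainComplex.of (fun k => ModuleCat.of ℂ (QuiverObj V k))
    (fun k => ModuleCat.ofHom (dQuiver 𝒱 k)) fun k => by
      rw [← ModuleCat.ofHom_comp, dQuiver_comp_dQuiver]
      rfl

end DR

end Arrangement

end QuiverDR

end

open CategoryTheory

/-!
# Global sections of the de Rham complex of a small quiver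

The comparison morphism sends an element of the summand of the vertex `α` in degree `-dim X_α` to the
value at the origin of its component in `⋀^{dim X_α} T_α ⊗ Ω̄_α ⊗ V_α = V_α`, up to a sign. It is
surjective, and it is compatible with the differentials since the Koszul part of the differential and
the edge maps `A_{β,α}` with `β ≻ α` do not contribute to this component (`bottom_dDR`). Hence it
suffices that its kernel is acyclic.

In a basis of `ℂ^N` adapted to `X_α`, the term of `α` consists of entire functions with values in an
exterior algebra, on which linear functions act by multiplication and vector fields by derivatives.
Give a coordinate function the degree `1`, an element of `F_α` in the exterior algebra the degree `1`,
an element of `T_α` the degree `-1`, and shift by `dim X_α`. The resulting total degree is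
nonnegative, and in the basis of all monomials and exterior products it vanishes exactly at the
element seen by the comparison morphism. The Koszul complex of `α` has the homotopy `∑ b_j ⊗ e_j ∧ ·`,
where `b_j` is the operator conjugate to the action of the basis element `e_j`: a coordinate if `e_j`
is a vector field, and a derivative if `e_j` is a function. Its anticommutator with the Koszul
differential is multiplication by the total degree (`koszulTerm_homotopy_succ`, `coeff_euler`).

The anticommutator with the complete differential is the total degree minus a perturbation
`∑ (x_l ⊗ Q_l + ∂_l ⊗ R_l)`, with matrices `Q_l`, `R_l` that depend linearly on the maps of the quiver
(`coeffs_laplacian`). A homogeneity argument shows that the perturbation preserves the total degree.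
On the finitely many coefficients of total degree `m`, the operators `x_l` and `∂_l` are bounded by
`m` in the maximum norm, hence for small maps the perturbation is bounded by `m / 2`
(`LadderBound.norm_le`). Thus the anticommutator is invertible on every space of positive total
degree, and its inverse is bounded uniformly, so that it preserves the growth condition which
characterizes the Taylor coefficients of entire functions (`LadderBound.exists_sol`,
`decay_taylorCoeff`, `exists_taylorCoeff_eq`). An invertible anticommutator makes the kernel acyclic
(`exists_dDR_eq_succ`).

The bound on the maps depends on the edge framing through the matrix entries of the edge maps, but a
change of the framing multiplies the substitution and the map of top forms by inverse scalars, so the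
complex does not depend on the framing (`dDR_eq_dDR`).
-/

noncomputable section

namespace QuiverDR

/-! ### Operators that preserve the total degree of power series -/

section Ladder

variable {N : ℕ} {I : Type*} [Fintype I] {W : I → Type*} [∀ i, NormedAddCommGroup (W i)]
  [∀ i, NormedSpace ℂ (W i)]

/-- The total order `|k|` of a multi-index `k`. -/
def order (k : Fin N → ℕ) : ℕ := ∑ l, k l

theorem le_order (k : Fin N → ℕ) (l : Fin N) : k l ≤ order k :=
  Finset.single_le_sum (f := k) (fun _ _ => Nat.zero_le _) (Finset.mem_univ l)

theorem order_add_single (k : Fin N → ℕ) (l : Fin N) :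
    order (k + Pi.single l 1) = order k + 1 := by
  simp [order, Finset.sum_add_distrib]

theorem sub_single_add {k : Fin N → ℕ} {l : Fin N} (h : k l ≠ 0) :
    k - Pi.single l 1 + Pi.single l 1 = k := by
  refine tsub_add_cancel_of_le fun m => ?_
  by_cases hm : m = l
  · subst hm; simp; omega
  · simp [hm]

theorem order_sub_single {k : Fin N → ℕ} {l : Fin N} (h : k l ≠ 0) :
    order (k - Pi.single l 1) + 1 = order k := by
  rw [← order_add_single, sub_single_add h]

theorem order_eq_zero {k : Fin N → ℕ} : order k = 0 ↔ k = 0 := by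
  simp [order, funext_iff]

/-- The operator `∑ (x_l ⊗ Q_l + ∂_l ⊗ R_l)` on families of formal power series, in terms of the
coefficients of these series. -/
def ladder (Q R : Fin N → ∀ i j, W j →ₗ[ℂ] W i) :
    (∀ i, (Fin N → ℕ) → W i) →ₗ[ℂ] (∀ i, (Fin N → ℕ) → W i) where
  toFun a i k := ∑ j, ∑ l, ((if k l = 0 then 0 else Q l i j (a j (k - Pi.single l 1))) +
    ((k l : ℂ) + 1) • R l i j (a j (k + Pi.single l 1)))
  map_add' a a' := by
    funext i k
    simp only [Pi.add_apply, map_add, smul_add, ← Finset.sum_add_distrib]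
    refine Finset.sum_congr rfl fun j _ => Finset.sum_congr rfl fun l _ => ?_
    split_ifs <;> abel
  map_smul' r a := by
    funext i k
    simp only [Pi.smul_apply, map_smul, Finset.smul_sum, RingHom.id_apply]
    refine Finset.sum_congr rfl fun j _ => Finset.sum_congr rfl fun l _ => ?_
    rw [smul_add, smul_comm r]
    split_ifs <;> simp

/-- The operators `Q_l`, `R_l` make `∑ (x_l ⊗ Q_l + ∂_l ⊗ R_l)` preserve the total degree, and their
norms are at most `δ`. -/
structure LadderBound (wt : I → ℕ) (δ : ℝ) (Q R : Fin N → ∀ i j, W j →ₗ[ℂ] W i) : Prop where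
  nonneg : 0 ≤ δ
  Q_le : ∀ l i j v, ‖Q l i j v‖ ≤ δ * ‖v‖
  R_le : ∀ l i j v, ‖R l i j v‖ ≤ δ * ‖v‖
  Q_eq_zero : ∀ l i j, wt i + 1 ≠ wt j → Q l i j = 0
  R_eq_zero : ∀ l i j, wt i ≠ wt j + 1 → R l i j = 0
  small : 4 * (Fintype.card I * N) * δ ≤ 1

variable {wt : I → ℕ} {δ : ℝ} {Q R : Fin N → ∀ i j, W j →ₗ[ℂ] W i}

/-- On coefficients of total degree `m`, multiplications with coordinates and partial derivatives have
factors at most `m`, and their number is absorbed by the smallness of `δ`. -/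
theorem LadderBound.norm_le (H : LadderBound wt δ Q R) {a : ∀ i, (Fin N → ℕ) → W i} {m : ℕ} {M : ℝ}
    (hM : 0 ≤ M) (ha : ∀ i k, order k + wt i = m → ‖a i k‖ ≤ M) {i : I} {k : Fin N → ℕ}
    (hk : order k + wt i = m) : ‖ladder Q R a i k‖ ≤ m / 2 * M := by
  have hδ := H.nonneg
  have key : ∀ j l, ‖(if k l = 0 then 0 else Q l i j (a j (k - Pi.single l 1))) +
      ((k l : ℂ) + 1) • R l i j (a j (k + Pi.single l 1))‖ ≤ 2 * m * δ * M := by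
    intro j l
    have h1 : ‖(if k l = 0 then 0 else Q l i j (a j (k - Pi.single l 1)))‖ ≤ m * δ * M := by
      split_ifs with h0
      · rw [norm_zero]; positivity
      · by_cases hw : wt i + 1 = wt j
        · have e1 := order_sub_single h0
          have e2 : (1 : ℝ) ≤ m := by
            have := le_order k l
            exact_mod_cast (by omega : 1 ≤ m)
          have e3 := ha j (k - Pi.single l 1) (by omega)
          calc _ ≤ δ * ‖a j (k - Pi.single l 1)‖ := H.Q_le l i j _
            _ ≤ 1 * (δ * M) := by rw [one_mul]; gcongr
            _ ≤ m * (δ * M) := by gcongr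
            _ = _ := by ring
        · rw [H.Q_eq_zero l i j hw, LinearMap.zero_apply, norm_zero]; positivity
    have h2 : ‖((k l : ℂ) + 1) • R l i j (a j (k + Pi.single l 1))‖ ≤ m * δ * M := by
      by_cases hw : wt i = wt j + 1
      · have e1 := order_add_single k l
        have e2 : ((k l + 1 : ℕ) : ℝ) ≤ m := by
          have := le_order k l
          exact_mod_cast (by omega : k l + 1 ≤ m)
        have e3 := ha j (k + Pi.single l 1) (by omega)
        have e4 : ‖(k l : ℂ) + 1‖ = ((k l + 1 : ℕ) : ℝ) := by
          rw [← Complex.norm_natCast]; push_cast; rfl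
        rw [norm_smul, e4]
        calc _ ≤ ((k l + 1 : ℕ) : ℝ) * (δ * ‖a j (k + Pi.single l 1)‖) := by
              gcongr; exact H.R_le l i j _
          _ ≤ m * (δ * M) := by gcongr
          _ = _ := by ring
      · rw [H.R_eq_zero l i j hw, LinearMap.zero_apply, smul_zero, norm_zero]; positivity
    calc _ ≤ _ := norm_add_le _ _
      _ ≤ _ := by linarith
  calc ‖ladder Q R a i k‖ ≤ ∑ j : I, ∑ l : Fin N, 2 * m * δ * M :=
        (norm_sum_le _ _).trans (Finset.sum_le_sum fun j _ =>
          (norm_sum_le _ _).trans (Finset.sum_le_sum fun l _ => key j l))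
    _ = (4 * (Fintype.card I * N) * δ) * (m / 2 * M) := by
        simp only [Finset.sum_const, Finset.card_univ, Fintype.card_fin, nsmul_eq_mul]; ring
    _ ≤ 1 * (m / 2 * M) := by
        gcongr; exact H.small
    _ = _ := one_mul _

theorem finite_order (wt : I → ℕ) (m : ℕ) :
    Finite {x : I × (Fin N → ℕ) // order x.2 + wt x.1 = m} := by
  have : Set.Finite {x : I × (Fin N → ℕ) | order x.2 + wt x.1 = m} := by
    refine Set.Finite.subset (Set.finite_univ.prod (Set.Finite.pi fun _ : Fin N =>
      Set.finite_Iic m)) ?_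
    rintro ⟨i, k⟩ hx
    simp only [Set.mem_ofPred_eq] at hx
    simp only [Set.mem_prod, Set.mem_univ, true_and, Set.mem_pi, Set.mem_Iic]
    intro l _
    have := le_order k l
    omega
  exact this.to_subtype

/-- The a priori estimate for solutions of the equation `(E - B) a = v`, where `E` is the total
degree and `B` a bounded operator that preserves it. -/
theorem LadderBound.norm_sol_le (H : LadderBound wt δ Q R) {a v : ∀ i, (Fin N → ℕ) → W i} {m : ℕ}
    (hm : m ≠ 0) {M : ℝ} (hM : 0 ≤ M)
    (h : ∀ i k, order k + wt i = m → (m : ℂ) • a i k = ladder Q R a i k + v i k)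
    (hv : ∀ i k, order k + wt i = m → ‖v i k‖ ≤ M) {i : I} {k : Fin N → ℕ}
    (hk : order k + wt i = m) : ‖a i k‖ ≤ 2 * M := by
  have := finite_order (N := N) wt m
  have : Nonempty {x : I × (Fin N → ℕ) // order x.2 + wt x.1 = m} := ⟨⟨(i, k), hk⟩⟩
  obtain ⟨⟨⟨j, k'⟩, hx⟩, hmax⟩ := Finite.exists_max
    fun x : {x : I × (Fin N → ℕ) // order x.2 + wt x.1 = m} => ‖a x.1.1 x.1.2‖
  have h1 := hmax ⟨(i, k), hk⟩
  have h2 := H.norm_le (norm_nonneg (a j k')) (fun i k h => hmax ⟨(i, k), h⟩) hx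
  have h3 := congrArg norm (h j k' hx)
  rw [norm_smul, Complex.norm_natCast] at h3
  have h4 := norm_add_le (ladder Q R a j k') (v j k')
  have h5 := hv j k' hx
  have h6 : (1 : ℝ) ≤ m := by exact_mod_cast Nat.one_le_iff_ne_zero.mpr hm
  simp only at h1
  nlinarith [norm_nonneg (a j k')]

/-- The total degree minus the perturbation is injective on families without component of total degree
zero. -/
theorem LadderBound.eq_zero (H : LadderBound wt δ Q R) {a : ∀ i, (Fin N → ℕ) → W i}
    (h0 : ∀ i k, order k + wt i = 0 → a i k = 0)
    (h : ∀ i k, ((order k + wt i : ℕ) : ℂ) • a i k = ladder Q R a i k) : a = 0 := by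
  funext i k
  by_cases hk : order k + wt i = 0
  · exact h0 i k hk
  · have := H.norm_sol_le (v := 0) hk le_rfl
      (fun j k' hk' => by rw [← hk', h, Pi.zero_apply, Pi.zero_apply, add_zero])
      (fun j k' _ => by simp) (i := i) (k := k) rfl
    simpa using this

/-- The operator preserves the total degree: its values there depend only on the coefficients of the
same total degree. -/
theorem LadderBound.ladder_congr (H : LadderBound wt δ Q R) {a a' : ∀ i, (Fin N → ℕ) → W i} {m : ℕ}
    (ha : ∀ i k, order k + wt i = m → a i k = a' i k) {i : I} {k : Fin N → ℕ}
    (hk : order k + wt i = m) : ladder Q R a i k = ladder Q R a' i k := by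
  have := H.norm_le (a := a - a') (M := 0) le_rfl (fun i k h => by simp [ha i k h]) hk
  rw [map_sub, mul_zero, norm_le_zero_iff] at this
  exact sub_eq_zero.mp this

/-- The coefficients decrease faster than every geometric sequence, i.e. they are the Taylor
coefficients of an entire function. -/
def Decay {W : Type*} [NormedAddCommGroup W] (a : (Fin N → ℕ) → W) : Prop :=
  ∀ R : ℝ, 1 ≤ R → ∃ C, ∀ k, ‖a k‖ * R ^ order k ≤ C

/-- The total degree minus the perturbation is surjective on families of Taylor coefficients of entire
functions without component of total degree zero. The a priori estimate bounds the solution by the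
right side of the same total degree, hence the solution is again such a family. -/
theorem LadderBound.exists_sol [∀ i, FiniteDimensional ℂ (W i)] (H : LadderBound wt δ Q R)
    {v : ∀ i, (Fin N → ℕ) → W i} (h0 : ∀ i k, order k + wt i = 0 → v i k = 0)
    (hv : ∀ i, Decay (v i)) :
    ∃ a : ∀ i, (Fin N → ℕ) → W i, (∀ i k, order k + wt i = 0 → a i k = 0) ∧
      (∀ i k, ((order k + wt i : ℕ) : ℂ) • a i k = ladder Q R a i k + v i k) ∧
      ∀ i, Decay (a i) := by
  -- in each positive total degree the equation is a linear equation in a space of finite dimension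
  have hm : ∀ m : ℕ, m ≠ 0 → ∃ a : ∀ i, (Fin N → ℕ) → W i,
      ∀ i k, order k + wt i = m → (m : ℂ) • a i k = ladder Q R a i k + v i k := by
    intro m hm
    have := finite_order (N := N) wt m
    let X := {x : I × (Fin N → ℕ) // order x.2 + wt x.1 = m}
    let ext : (∀ x : X, W x.1.1) →ₗ[ℂ] (∀ i, (Fin N → ℕ) → W i) :=
      { toFun := fun y i k => if h : order k + wt i = m then y ⟨(i, k), h⟩ else 0
        map_add' := fun y y' => by
          funext i k
          simp only [Pi.add_apply]
          split_ifs <;> simp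
        map_smul' := fun r y => by
          funext i k
          simp only [Pi.smul_apply, RingHom.id_apply]
          split_ifs <;> simp }
    let res : (∀ i, (Fin N → ℕ) → W i) →ₗ[ℂ] (∀ x : X, W x.1.1) :=
      LinearMap.pi fun x => LinearMap.proj x.1.2 ∘ₗ LinearMap.proj x.1.1
    let T : (∀ x : X, W x.1.1) →ₗ[ℂ] (∀ x : X, W x.1.1) :=
      (m : ℂ) • LinearMap.id - res ∘ₗ ladder Q R ∘ₗ ext
    have hext : ∀ y (x : X), ext y x.1.1 x.1.2 = y x := by
      intro y x
      exact dif_pos x.2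
    have hT : ∀ y (x : X), T y x = (m : ℂ) • ext y x.1.1 x.1.2 - ladder Q R (ext y) x.1.1 x.1.2 := by
      intro y x
      rw [hext]
      rfl
    have hinj : Function.Injective T := by
      refine (injective_iff_map_eq_zero T).mpr fun y hy => funext fun x => ?_
      have h1 : ∀ i k, order k + wt i = m → (m : ℂ) • ext y i k = ladder Q R (ext y) i k +
          (0 : ∀ i, (Fin N → ℕ) → W i) i k := by
        intro i k hk
        have := hT y ⟨(i, k), hk⟩
        rw [hy] at this
        simpa using (sub_eq_zero.mp this.symm)
      have h2 := H.norm_sol_le hm le_rfl h1 (by simp) x.2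
      rw [mul_zero, norm_le_zero_iff, hext] at h2
      exact h2
    obtain ⟨y, hy⟩ := LinearMap.injective_iff_surjective.mp hinj (res v)
    refine ⟨ext y, fun i k hk => ?_⟩
    have := hT y ⟨(i, k), hk⟩
    rw [hy] at this
    exact (sub_eq_iff_eq_add'.mp this.symm)
  choose! b hb using hm
  obtain ⟨a, ha0, ha⟩ : ∃ a : ∀ i, (Fin N → ℕ) → W i, (∀ i k, order k + wt i = 0 → a i k = 0) ∧
      ∀ i k, order k + wt i ≠ 0 → a i k = b (order k + wt i) i k :=
    ⟨fun i k => if order k + wt i = 0 then 0 else b (order k + wt i) i k,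
      fun i k h => if_pos h, fun i k h => if_neg h⟩
  refine ⟨a, ha0, fun i k => ?_, fun i R' hR' => ?_⟩
  · by_cases hk : order k + wt i = 0
    · rw [hk, h0 i k hk, H.ladder_congr (a' := 0) (m := 0) ha0 hk]
      simp
    · rw [H.ladder_congr (a' := b (order k + wt i)) (m := order k + wt i)
        (fun j k' hk' => by rw [ha j k' (by rwa [hk']), hk']) rfl, ha i k hk]
      exact hb _ hk i k rfl
  · choose C hC using fun i => hv i R' hR'
    have hR0 : 0 < R' := by linarith
    have hC0 : ∀ i, 0 ≤ C i := fun i => le_trans (by positivity) (hC i 0)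
    -- the weights change the exponents of `R'` by a bounded amount
    obtain ⟨w, hw⟩ : ∃ w, ∀ j, wt j ≤ w :=
      ⟨∑ j, wt j, fun j => Finset.single_le_sum (f := wt) (fun _ _ => Nat.zero_le _)
        (Finset.mem_univ j)⟩
    refine ⟨2 * ((∑ j, C j) * R' ^ w), fun k => ?_⟩
    by_cases hk : order k + wt i = 0
    · rw [ha0 i k hk, norm_zero, zero_mul]
      have : 0 ≤ ∑ j, C j := Finset.sum_nonneg fun j _ => hC0 j
      positivity
    · rw [ha i k hk]
      have hS : 0 ≤ ∑ j, C j := Finset.sum_nonneg fun j _ => hC0 j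
      have h1 : ∀ j k', order k' + wt j = order k + wt i →
          ‖v j k'‖ ≤ (∑ j, C j) * R' ^ w / R' ^ (order k + wt i) := by
        intro j k' hk'
        rw [le_div_iff₀ (by positivity), ← hk', pow_add, ← mul_assoc]
        exact mul_le_mul ((hC j k').trans (Finset.single_le_sum (fun j _ => hC0 j)
          (Finset.mem_univ j))) (pow_le_pow_right₀ hR' (hw j)) (by positivity) hS
      have h2 := H.norm_sol_le hk (by positivity) (fun j k' hk' => hb _ hk j k' hk') h1
        (i := i) (k := k) rfl
      have h3 : R' ^ order k ≤ R' ^ (order k + wt i) := pow_le_pow_right₀ hR' (by omega)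
      calc _ ≤ ‖b (order k + wt i) i k‖ * R' ^ (order k + wt i) := by gcongr
        _ ≤ 2 * ((∑ j, C j) * R' ^ w / R' ^ (order k + wt i)) * R' ^ (order k + wt i) := by gcongr
        _ = _ := by field_simp

end Ladder
/-! ### Taylor coefficients of holomorphic forms -/

section Taylor

variable {N : ℕ}

/-- The standard basis of `ℂ^N`. -/
def stdBasis (N : ℕ) : Fin N → Pt N := fun l => Pi.single l 1

theorem eq_sum_stdBasis (v : Pt N) : v = ∑ l, v l • stdBasis N l := by
  funext m
  simp [stdBasis, Finset.sum_apply, Pi.single_apply]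

/-- The value of the coefficient of an `N`-form `ω` with respect to the standard coordinates at a
point. -/
def HolForm.coeffAt (z : Pt N) : HolForm N →ₗ[ℂ] ℂ where
  toFun ω := ω.1 z (stdBasis N)
  map_add' _ _ := rfl
  map_smul' _ _ := rfl

theorem HolForm.ext_coeffAt {ω ω' : HolForm N} (h : ∀ z, ω.coeffAt z = ω'.coeffAt z) :
    ω = ω' := by
  refine HolForm.ext fun z => ?_
  refine ContinuousAlternatingMap.toAlternatingMap_injective ?_
  rw [← sub_eq_zero, ← AlternatingMap.map_basis_eq_zero_iff (Pi.basisFun ℂ (Fin N))]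
  have hb : (Pi.basisFun ℂ (Fin N) : Fin N → Pt N) = stdBasis N := by
    funext l
    simp [stdBasis]
  rw [hb]
  exact sub_eq_zero.mpr (h z)

/-- The derivative of `N`-forms in the direction of a constant vector field. -/
def dirDeriv : Pt N →ₗ[ℂ] HolForm N →ₗ[ℂ] HolForm N := -negLie

theorem dirDeriv_apply (v : Pt N) (ω : HolForm N) (z : Pt N) :
    (dirDeriv v ω).1 z = fderiv ℂ ω.1 z v :=
  neg_neg (fderiv ℂ ω.1 z v)

theorem coeffAt_mulFun (g : Module.Dual ℂ (Pt N)) (ω : HolForm N) (z : Pt N) :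
    (mulFun g ω).coeffAt z = g z * ω.coeffAt z := rfl

theorem dirDeriv_mulFun (v : Pt N) (g : Module.Dual ℂ (Pt N)) (ω : HolForm N) :
    dirDeriv v (mulFun g ω) = mulFun g (dirDeriv v ω) + g v • ω := by
  refine HolForm.ext fun z => ?_
  have h1 := fderiv_smul (g.toContinuousLinearMap.differentiableAt (x := z)) (differentiable ω z)
  rw [dirDeriv_apply]
  change fderiv ℂ (fun y => g.toContinuousLinearMap y • ω.1 y) z v =
    g z • (dirDeriv v ω).1 z + g v • ω.1 z
  erw [h1]
  rw [ContinuousLinearMap.fderiv, dirDeriv_apply]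
  rfl

theorem dirDeriv_comm (v w : Pt N) (ω : HolForm N) :
    dirDeriv v (dirDeriv w ω) = dirDeriv w (dirDeriv v ω) := by
  have h := rightAct_comm (v, 0) (w, 0) (by simp) (by simp) ω
  simp only [rightAct, LinearMap.coprod_apply, map_zero, add_zero] at h
  simp only [dirDeriv, LinearMap.neg_apply, map_neg, neg_neg, h]

theorem mulFun_comm (g k : Module.Dual ℂ (Pt N)) (ω : HolForm N) :
    mulFun g (mulFun k ω) = mulFun k (mulFun g ω) :=
  HolForm.ext fun z => smul_comm (g z) (k z) (ω.1 z)

/-- The partial derivative in a coordinate direction. -/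
def partialD (l : Fin N) : Module.End ℂ (HolForm N) := dirDeriv (stdBasis N l)

/-- Multiplication by a coordinate function. -/
def coordMul (l : Fin N) : Module.End ℂ (HolForm N) := mulFun (LinearMap.proj l)

/-- Iterated partial derivatives. -/
def iterD : (Fin N → Multiplicative ℕ) →* Module.End ℂ (HolForm N) :=
  MonoidHom.noncommPiCoprod (fun l => powersHom _ (partialD l)) fun l m _ x y => by
    refine Commute.pow_pow ?_ _ _
    exact LinearMap.ext fun ω => dirDeriv_comm _ _ ω

/-- The iterated partial derivative `∂^k`. -/
def partialDs (k : Fin N → ℕ) : Module.End ℂ (HolForm N) :=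
  iterD fun l => Multiplicative.ofAdd (k l)

theorem partialDs_zero : partialDs (0 : Fin N → ℕ) = 1 := map_one iterD

theorem partialDs_add (k k' : Fin N → ℕ) : partialDs (k + k') = partialDs k * partialDs k' :=
  map_mul iterD _ _

theorem partialDs_single (l : Fin N) (j : ℕ) : partialDs (Pi.single l j) = partialD l ^ j := by
  have : (fun m => Multiplicative.ofAdd ((Pi.single l j : Fin N → ℕ) m)) =
      Pi.mulSingle l (Multiplicative.ofAdd j) := by
    funext m
    by_cases h : m = l
    · subst h; simp
    · simp [h]
  rw [partialDs, this]
  exact (MonoidHom.noncommPiCoprod_mulSingle (N := fun _ : Fin N => Multiplicative ℕ) _ l _)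

theorem partialDs_apply_partialD (k : Fin N → ℕ) (l : Fin N) (ω : HolForm N) :
    partialDs k (partialD l ω) = partialDs (k + Pi.single l 1) ω := by
  rw [partialDs_add, partialDs_single, pow_one]
  rfl

theorem multiIndex_induction {P : (Fin N → ℕ) → Prop} (h0 : P 0)
    (h : ∀ k l, P k → P (k + Pi.single l 1)) (k : Fin N → ℕ) : P k := by
  induction hn : order k generalizing k with
  | zero => rwa [order_eq_zero.mp hn]
  | succ n ih =>
    obtain ⟨l, hl⟩ : ∃ l, k l ≠ 0 := by
      by_contra hc
      push Not at hc
      rw [order_eq_zero.mpr (funext hc)] at hn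
      omega
    rw [← sub_single_add hl]
    refine h _ _ (ih _ ?_)
    have := order_sub_single hl
    omega

theorem partialD_coordMul (l m : Fin N) (ω : HolForm N) :
    partialD l (coordMul m ω) = coordMul m (partialD l ω) + (if l = m then ω else 0) := by
  rw [partialD, coordMul, dirDeriv_mulFun]
  congr 1
  by_cases h : l = m
  · subst h; simp [stdBasis]
  · simp [stdBasis, h, Ne.symm h]

theorem partialDs_coordMul (k : Fin N → ℕ) (m : Fin N) (ω : HolForm N) :
    partialDs k (coordMul m ω) =
      coordMul m (partialDs k ω) + (k m : ℂ) • partialDs (k - Pi.single m 1) ω := by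
  induction k using multiIndex_induction generalizing ω with
  | h0 => simp [partialDs_zero]
  | h k l ih =>
    rw [← partialDs_apply_partialD, partialD_coordMul, map_add, ih, partialDs_apply_partialD,
      partialDs_apply_partialD, add_assoc]
    congr 1
    by_cases h : l = m
    · subst h
      rw [if_pos rfl, add_tsub_cancel_right]
      by_cases h0 : k l = 0
      · simp [h0]
      · rw [sub_single_add h0]
        simp [add_smul]
    · rw [if_neg h, map_zero, add_zero]
      by_cases h0 : k m = 0
      · simp [h0, h]
      · have : k + Pi.single l 1 - Pi.single m 1 = k - Pi.single m 1 + Pi.single l 1 := by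
          funext j
          simp only [Pi.add_apply, Pi.sub_apply, Pi.single_apply]
          split_ifs <;> (subst_vars; simp_all)
        rw [this]
        simp [Ne.symm h]

/-- The product of the factorials of a multi-index. -/
def multiFactorial (k : Fin N → ℕ) : ℕ := ∏ l, (k l).factorial

theorem multiFactorial_ne_zero (k : Fin N → ℕ) : multiFactorial k ≠ 0 :=
  Finset.prod_ne_zero_iff.mpr fun l _ => (k l).factorial_ne_zero

theorem multiFactorial_add_single (k : Fin N → ℕ) (l : Fin N) :
    multiFactorial (k + Pi.single l 1) = (k l + 1) * multiFactorial k := by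
  rw [multiFactorial, multiFactorial, ← Finset.mul_prod_erase _ _ (Finset.mem_univ l),
    ← Finset.mul_prod_erase _ (fun l => (k l).factorial) (Finset.mem_univ l), ← mul_assoc]
  congr 1
  · simp [Nat.factorial_succ]
  · refine Finset.prod_congr rfl fun m hm => ?_
    simp [Finset.ne_of_mem_erase hm]

/-- The Taylor coefficients at the origin of the coefficient of an `N`-form. -/
def taylorCoeff (k : Fin N → ℕ) : HolForm N →ₗ[ℂ] ℂ :=
  (multiFactorial k : ℂ)⁻¹ • (HolForm.coeffAt 0 ∘ₗ partialDs k)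

theorem taylorCoeff_zero (ω : HolForm N) : taylorCoeff 0 ω = ω.coeffAt 0 := by
  simp [taylorCoeff, partialDs_zero, multiFactorial]

theorem taylorCoeff_partialD (k : Fin N → ℕ) (l : Fin N) (ω : HolForm N) :
    taylorCoeff k (partialD l ω) = ((k l : ℂ) + 1) * taylorCoeff (k + Pi.single l 1) ω := by
  simp only [taylorCoeff, LinearMap.smul_apply, LinearMap.comp_apply, partialDs_apply_partialD,
    multiFactorial_add_single, smul_eq_mul]
  have h1 : (multiFactorial k : ℂ) ≠ 0 := by exact_mod_cast multiFactorial_ne_zero k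
  have h2 : (k l : ℂ) + 1 ≠ 0 := by exact_mod_cast Nat.succ_ne_zero (k l)
  push_cast
  field_simp

theorem taylorCoeff_coordMul (k : Fin N → ℕ) (l : Fin N) (ω : HolForm N) :
    taylorCoeff k (coordMul l ω) = if k l = 0 then 0 else taylorCoeff (k - Pi.single l 1) ω := by
  have h0 : HolForm.coeffAt 0 (coordMul l (partialDs k ω)) = 0 := by
    rw [coordMul, coeffAt_mulFun]; simp
  simp only [taylorCoeff, LinearMap.smul_apply, LinearMap.comp_apply, partialDs_coordMul, map_add,
    map_smul, h0, zero_add, smul_eq_mul]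
  split_ifs with h
  · simp [h]
  · have h3 := multiFactorial_add_single (k - Pi.single l 1) l
    rw [sub_single_add h] at h3
    have h4 : (k - Pi.single l 1 : Fin N → ℕ) l + 1 = k l := by simp; omega
    rw [h4] at h3
    rw [h3]
    have h1 : (multiFactorial (k - Pi.single l 1) : ℂ) ≠ 0 := by
      exact_mod_cast multiFactorial_ne_zero _
    have h2 : (k l : ℂ) ≠ 0 := by exact_mod_cast h
    push_cast
    field_simp

/-- The Euler operator acts on the homogeneous component of degree `m` by multiplication
with `m`. -/
theorem taylorCoeff_euler (k : Fin N → ℕ) (ω : HolForm N) :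
    taylorCoeff k (∑ l, coordMul l (partialD l ω)) = (order k : ℂ) * taylorCoeff k ω := by
  rw [map_sum, order, Nat.cast_sum, Finset.sum_mul]
  refine Finset.sum_congr rfl fun l _ => ?_
  rw [taylorCoeff_coordMul]
  split_ifs with h
  · simp [h]
  · rw [taylorCoeff_partialD, sub_single_add h]
    congr 1
    have h4 : (k - Pi.single l 1 : Fin N → ℕ) l + 1 = k l := by simp; omega
    exact_mod_cast h4

theorem deriv_slice (ω : HolForm N) (z v : Pt N) (t : ℂ) :
    HasDerivAt (fun t : ℂ => ω.coeffAt (z + t • v)) ((dirDeriv v ω).coeffAt (z + t • v)) t := by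
  have h1 : HasDerivAt (fun t : ℂ => z + t • v) v t := by
    simpa using ((hasDerivAt_id t).smul_const v).const_add z
  have h2 := (differentiable ω (z + t • v)).hasFDerivAt.comp_hasDerivAt t h1
  rw [← dirDeriv_apply] at h2
  exact (ContinuousAlternatingMap.apply ℂ (Pt N) ℂ (stdBasis N)).hasFDerivAt.comp_hasDerivAt t h2

theorem iteratedDeriv_slice (ω : HolForm N) (z v : Pt N) (j : ℕ) :
    iteratedDeriv j (fun t : ℂ => ω.coeffAt (z + t • v)) =
      fun t => (((dirDeriv v : Module.End ℂ (HolForm N)) ^ j) ω).coeffAt (z + t • v) := by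
  induction j generalizing ω with
  | zero => rw [iteratedDeriv_zero]; rfl
  | succ j ih =>
    rw [iteratedDeriv_succ', funext fun t => (deriv_slice ω z v t).deriv, ih, pow_succ]
    rfl

/-- A form is determined by its Taylor coefficients, since this holds for its restrictions to lines
through the origin. -/
theorem eq_zero_of_taylorCoeff (ω : HolForm N) (h : ∀ k, taylorCoeff k ω = 0) : ω = 0 := by
  refine HolForm.ext_coeffAt fun v => ?_
  have hU : ∀ (j : ℕ) (k : Fin N → ℕ),
      taylorCoeff k (((dirDeriv v : Module.End ℂ (HolForm N)) ^ j) ω) = 0 := by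
    intro j
    induction j with
    | zero => exact h
    | succ j ih =>
      intro k
      have hv : (dirDeriv v : Module.End ℂ (HolForm N)) = ∑ l, v l • partialD l := by
        conv_lhs => rw [eq_sum_stdBasis v, map_sum]
        exact Finset.sum_congr rfl fun l _ => map_smul _ _ _
      rw [pow_succ', Module.End.mul_apply, hv, LinearMap.sum_apply, map_sum, ← hv]
      refine Finset.sum_eq_zero fun l _ => ?_
      rw [LinearMap.smul_apply, map_smul, taylorCoeff_partialD, ih, mul_zero, smul_zero]
  have hd : Differentiable ℂ (fun t : ℂ => ω.coeffAt (0 + t • v)) := fun t =>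
    (deriv_slice ω 0 v t).differentiableAt
  have := Complex.taylorSeries_eq_of_entire' 0 1 hd
  have h0 : ∀ n, iteratedDeriv n (fun t : ℂ => ω.coeffAt (0 + t • v)) 0 = 0 := fun n => by
    rw [iteratedDeriv_slice]
    simp only [zero_smul, add_zero, ← taylorCoeff_zero, hU]
  simp only [zero_add] at h0
  simp only [zero_add, h0, mul_zero, zero_mul, tsum_zero, one_smul] at this
  rw [← this, map_zero]

/-- Cauchy's estimate on a polydisc, for the derivatives with respect to a part of the
coordinates. -/
theorem norm_partialDs_le {ω : HolForm N} {ρ M : ℝ} (hρ : 0 < ρ)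
    (hM : ∀ z : Pt N, ‖z‖ ≤ ρ → ‖ω.coeffAt z‖ ≤ M) (s : Finset (Fin N)) :
    ∀ k : Fin N → ℕ, (∀ l ∉ s, k l = 0) → ∀ z : Pt N, ‖z‖ ≤ ρ → (∀ l ∈ s, z l = 0) →
      ‖(partialDs k ω).coeffAt z‖ * ρ ^ order k ≤ multiFactorial k * M := by
  induction s using Finset.induction_on with
  | empty =>
    intro k hk z hz _
    have : k = 0 := funext fun l => hk l (by simp)
    subst this
    simpa [partialDs_zero, order, multiFactorial] using hM z hz
  | insert l s hl ih =>
    intro k hk z hz hzs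
    obtain ⟨k', hk'⟩ : ∃ k', k' = k - Pi.single l (k l) := ⟨_, rfl⟩
    have hk'l : k' l = 0 := by simp [hk']
    have hkk' : k = Pi.single l (k l) + k' := by
      rw [hk', add_comm]
      refine (tsub_add_cancel_of_le fun m => ?_).symm
      by_cases hm : m = l
      · subst hm; simp
      · simp [hm]
    have hfac : multiFactorial k = (k l).factorial * multiFactorial k' := by
      rw [multiFactorial, multiFactorial, ← Finset.mul_prod_erase _ _ (Finset.mem_univ l),
        ← Finset.mul_prod_erase _ (fun l => (k' l).factorial) (Finset.mem_univ l), hk'l,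
        Nat.factorial_zero, one_mul]
      congr 1
      refine Finset.prod_congr rfl fun m hm => ?_
      simp [hk', Finset.ne_of_mem_erase hm]
    have hord : order k = k l + order k' := by
      conv_lhs => rw [hkk']
      simp [order, Finset.sum_add_distrib]
    have hsupp : ∀ m ∉ s, k' m = 0 := by
      intro m hm
      by_cases hml : m = l
      · rw [hml, hk'l]
      · simp [hk', hml, hk m (by simp [hm, hml])]
    have hzl := hzs l (Finset.mem_insert_self l s)
    have hd : Differentiable ℂ (fun t : ℂ => (partialDs k' ω).coeffAt (z + t • stdBasis N l)) :=
      fun t => (deriv_slice _ z _ t).differentiableAt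
    have h1 := Complex.norm_iteratedDeriv_le_of_forall_mem_sphere_norm_le (c := 0)
      (C := multiFactorial k' * M / ρ ^ order k') (k l) hρ hd.diffContOnCl (by
        intro t ht
        rw [le_div_iff₀ (by positivity)]
        refine ih k' hsupp _ ((pi_norm_le_iff_of_nonneg hρ.le).mpr fun m => ?_) fun m hm => ?_
        · by_cases hml : m = l
          · subst hml
            simpa [stdBasis, hzl] using ht.le
          · simpa [stdBasis, hml] using (norm_le_pi_norm z m).trans hz
        · have hml : m ≠ l := fun h => hl (h ▸ hm)
          simp [stdBasis, hml, hzs m (Finset.mem_insert_of_mem hm)])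
    rw [iteratedDeriv_slice] at h1
    simp only [zero_smul, add_zero] at h1
    rw [show partialDs k ω = (dirDeriv (stdBasis N l) ^ k l) (partialDs k' ω) by
      conv_lhs => rw [hkk', partialDs_add, partialDs_single]
      rfl, hord, pow_add, hfac]
    rw [le_div_iff₀ (by positivity)] at h1
    calc _ = _ * ρ ^ k l * ρ ^ order k' := by ring
      _ ≤ (k l).factorial * (multiFactorial k' * M / ρ ^ order k') * ρ ^ order k' := by gcongr
      _ = _ := by push_cast; field_simp

theorem norm_taylorCoeff_le {ω : HolForm N} {ρ M : ℝ} (hρ : 0 < ρ)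
    (hM : ∀ z : Pt N, ‖z‖ ≤ ρ → ‖ω.coeffAt z‖ ≤ M) (k : Fin N → ℕ) :
    ‖taylorCoeff k ω‖ * ρ ^ order k ≤ M := by
  have h1 := norm_partialDs_le hρ hM Finset.univ k (by simp) 0 (by simpa using hρ.le) (by simp)
  have h2 : (0 : ℝ) < multiFactorial k := by exact_mod_cast (multiFactorial_ne_zero k).bot_lt
  simp only [taylorCoeff, LinearMap.smul_apply, LinearMap.comp_apply, norm_smul, norm_inv,
    Complex.norm_natCast]
  rw [mul_assoc, inv_mul_le_iff₀ h2]
  exact h1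

theorem continuous_coeffAt (ω : HolForm N) : Continuous fun z => ω.coeffAt z :=
  (ContinuousAlternatingMap.apply ℂ (Pt N) ℂ (stdBasis N)).continuous.comp
    (differentiable ω).continuous

theorem decay_taylorCoeff (ω : HolForm N) : Decay fun k => taylorCoeff k ω := by
  intro R hR
  obtain ⟨M, hM⟩ := (isCompact_closedBall (0 : Pt N) R).exists_bound_of_continuousOn
    (continuous_coeffAt ω).continuousOn
  exact ⟨M, norm_taylorCoeff_le (by linarith) fun z hz => hM z (by simpa using hz)⟩

end Taylor
/-! ### Entire functions with given Taylor coefficients -/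

section Realization

variable {N : ℕ}

/-- The standard volume form. -/
def volForm (N : ℕ) : Pt N [⋀^Fin N]→L[ℂ] ℂ :=
  { (Pi.basisFun ℂ (Fin N)).det with
    cont := by
      have : (fun v : Fin N → Pt N => (Pi.basisFun ℂ (Fin N)).det v) =
          fun v => Matrix.det (fun i j => v i j) := by
        funext v
        rw [Pi.basisFun_det_apply]
        rfl
      change Continuous fun v : Fin N → Pt N => (Pi.basisFun ℂ (Fin N)).det v
      rw [this]
      fun_prop }

theorem volForm_stdBasis : volForm N (stdBasis N) = 1 := by
  have hb : (Pi.basisFun ℂ (Fin N) : Fin N → Pt N) = stdBasis N := by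
    funext l
    simp [stdBasis]
  change (Pi.basisFun ℂ (Fin N)).det (stdBasis N) = 1
  rw [← hb, Module.Basis.det_self]

/-- The `N`-form with a given coefficient. -/
def formOf (f : Pt N → ℂ) (hf : AnalyticOnNhd ℂ f Set.univ) : HolForm N :=
  HolForm.mk (fun z => f z • volForm N) (hf.smul analyticOnNhd_const)

theorem coeffAt_formOf (f : Pt N → ℂ) (hf : AnalyticOnNhd ℂ f Set.univ) (z : Pt N) :
    (formOf f hf).coeffAt z = f z := by
  change f z * volForm N (stdBasis N) = f z
  rw [volForm_stdBasis, mul_one]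

theorem analyticOnNhd_monomial (k : Fin N → ℕ) :
    AnalyticOnNhd ℂ (fun z : Pt N => ∏ l, z l ^ k l) Set.univ := fun z _ => by
  refine Finset.analyticAt_fun_prod _ fun l _ => AnalyticAt.pow ?_ _
  exact (ContinuousLinearMap.proj (R := ℂ) (φ := fun _ : Fin N => ℂ) l).analyticAt z

/-- The `N`-form whose coefficient is a monomial. -/
def monomialForm (k : Fin N → ℕ) : HolForm N := formOf _ (analyticOnNhd_monomial k)

theorem monomialForm_add_single (k : Fin N → ℕ) (l : Fin N) :
    monomialForm (k + Pi.single l 1) = coordMul l (monomialForm k) := by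
  refine HolForm.ext_coeffAt fun z => ?_
  rw [coordMul, coeffAt_mulFun, monomialForm, monomialForm, coeffAt_formOf, coeffAt_formOf]
  simp only [Pi.add_apply, pow_add, Finset.prod_mul_distrib, LinearMap.proj_apply]
  rw [mul_comm]
  congr 1
  rw [Finset.prod_eq_single l (fun m _ hm => by simp [hm]) (by simp)]
  simp

theorem partialD_monomialForm_zero (l : Fin N) :
    partialD l (monomialForm (0 : Fin N → ℕ)) = 0 := by
  refine HolForm.ext fun z => ?_
  rw [partialD, dirDeriv_apply]
  have : (monomialForm (0 : Fin N → ℕ)).1 = fun _ => volForm N := by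
    funext z
    change (∏ l, z l ^ 0) • volForm N = _
    simp
  rw [this]
  simp
  rfl

theorem taylorCoeff_monomialForm (k k' : Fin N → ℕ) :
    taylorCoeff k (monomialForm k') = if k = k' then 1 else 0 := by
  induction k' using multiIndex_induction generalizing k with
  | h0 =>
    induction k using multiIndex_induction with
    | h0 => rw [taylorCoeff_zero, monomialForm, coeffAt_formOf]; simp
    | h k l _ =>
      have h1 : k + Pi.single l 1 ≠ 0 := fun h => by simpa using congrFun h l
      have h2 := taylorCoeff_partialD k l (monomialForm 0)
      rw [partialD_monomialForm_zero, map_zero] at h2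
      have h3 : (k l : ℂ) + 1 ≠ 0 := by exact_mod_cast Nat.succ_ne_zero (k l)
      rw [if_neg h1]
      simpa [h3] using h2.symm
  | h k' l ih =>
    rw [monomialForm_add_single, taylorCoeff_coordMul]
    split_ifs with h1 h2 h2
    · subst h2; simp at h1
    · rfl
    · subst h2
      rw [ih, if_pos (by simp)]
    · rw [ih, if_neg fun h3 => h2 (by rw [← h3, sub_single_add h1])]

/-- The monomial `z^k`, as a multilinear map on the diagonal. -/
theorem exists_multilinear_monomial (k : Fin N → ℕ) {m : ℕ} (hk : order k = m) :
    ∃ q : ContinuousMultilinearMap ℂ (fun _ : Fin m => Pt N) ℂ, ‖q‖ ≤ 1 ∧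
      ∀ z : Pt N, q (fun _ => z) = ∏ l, z l ^ k l := by
  subst hk
  let w : Fin (order k) → Fin N := fun i => (finSigmaFinEquiv.symm i).1
  refine ⟨(ContinuousMultilinearMap.mkPiAlgebra ℂ (Fin (order k)) ℂ).compContinuousLinearMap
    fun i => ContinuousLinearMap.proj (R := ℂ) (φ := fun _ : Fin N => ℂ) (w i), ?_, fun z => ?_⟩
  · refine ContinuousMultilinearMap.opNorm_le_bound zero_le_one fun v => ?_
    simp only [ContinuousMultilinearMap.compContinuousLinearMap_apply,
      ContinuousMultilinearMap.mkPiAlgebra_apply, norm_prod, one_mul]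
    exact Finset.prod_le_prod (fun _ _ => norm_nonneg _) fun i _ => norm_le_pi_norm (v i) (w i)
  · simp only [ContinuousMultilinearMap.compContinuousLinearMap_apply,
      ContinuousMultilinearMap.mkPiAlgebra_apply]
    change ∏ i, z (finSigmaFinEquiv.symm i).1 = _
    rw [Equiv.prod_comp finSigmaFinEquiv.symm (fun x : (l : Fin N) × Fin (k l) => z x.1),
      Fintype.prod_sigma]
    simp

theorem card_piAntidiag_le (m : ℕ) :
    ((Finset.univ : Finset (Fin N)).piAntidiag m).card ≤ (2 ^ N) ^ m := by
  calc _ ≤ (Fintype.piFinset fun _ : Fin N => Finset.range (m + 1)).card := by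
        refine Finset.card_le_card fun k hk => ?_
        simp only [Finset.mem_piAntidiag] at hk
        simp only [Fintype.mem_piFinset, Finset.mem_range]
        intro l
        have := le_order k l
        have : order k = m := hk.1
        omega
    _ = (m + 1) ^ N := by simp
    _ ≤ (2 ^ m) ^ N := Nat.pow_le_pow_left (Nat.lt_two_pow_self) N
    _ = _ := by rw [← pow_mul, ← pow_mul, mul_comm]

/-- Coefficients that decrease faster than every geometric sequence are the Taylor coefficients of an
entire function. -/
theorem exists_taylorCoeff_eq {a : (Fin N → ℕ) → ℂ} (ha : Decay a) :
    ∃ ω : HolForm N, ∀ k, taylorCoeff k ω = a k := by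
  classical
  -- the sum of the monomials of degree `m` is written as a multilinear map on the diagonal in order
  -- to apply the theory of formal multilinear series
  have hex : ∀ (m : ℕ) (k : Fin N → ℕ), ∃ q : ContinuousMultilinearMap ℂ (fun _ : Fin m => Pt N) ℂ,
      order k = m → ‖q‖ ≤ 1 ∧ ∀ z : Pt N, q (fun _ => z) = ∏ l, z l ^ k l := by
    intro m k
    by_cases h : order k = m
    · obtain ⟨q, hq⟩ := exists_multilinear_monomial k h
      exact ⟨q, fun _ => hq⟩
    · exact ⟨0, fun h' => absurd h' h⟩
  choose q hq using hex
  let S : ℕ → Finset (Fin N → ℕ) := fun m => Finset.univ.piAntidiag m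
  have hS : ∀ {m k}, k ∈ S m ↔ order k = m := by
    intro m k
    simp [S, order]
  let p : FormalMultilinearSeries ℂ (Pt N) ℂ := fun m => ∑ k ∈ S m, a k • q m k
  have hp : ∀ m z, p m (fun _ => z) = ∑ k ∈ S m, a k * ∏ l, z l ^ k l := by
    intro m z
    simp only [p, sum_apply, smul_apply,
      smul_eq_mul]
    exact Finset.sum_congr rfl fun k hk => by rw [(hq m k (hS.mp hk)).2]
  have hrad : p.radius = ⊤ := by
    refine p.radius_eq_top_of_summable_norm fun r => ?_
    have hR1 : (1 : ℝ) ≤ 2 ^ N := one_le_pow₀ (by norm_num)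
    have hr : (0 : ℝ) ≤ r := r.2
    -- the factor `2 ^ N` absorbs the number of monomials of degree `m`, and `2` makes the series
    -- converge geometrically
    obtain ⟨C, hC⟩ := ha (2 ^ N * (2 * (r + 1))) (by nlinarith)
    have hC0 : 0 ≤ C := le_trans (by positivity) (hC 0)
    refine Summable.of_nonneg_of_le (fun m => by positivity) (fun m => ?_)
      ((summable_geometric_of_lt_one (r := 1 / 2) (by norm_num) (by norm_num)).mul_left C)
    have h1 : ‖p m‖ ≤ ∑ k ∈ S m, C / (2 ^ N * (2 * (r + 1))) ^ m := by
      refine norm_sum_le_of_le _ fun k hk => ?_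
      rw [norm_smul]
      have h2 := hC k
      rw [hS.mp hk] at h2
      rw [le_div_iff₀ (by positivity)]
      calc _ ≤ ‖a k‖ * 1 * (2 ^ N * (2 * (r + 1))) ^ m := by
            gcongr; exact (hq m k (hS.mp hk)).1
        _ ≤ C := by rwa [mul_one]
    rw [Finset.sum_const, nsmul_eq_mul] at h1
    have h3 : ((S m).card : ℝ) ≤ (2 ^ N) ^ m := by exact_mod_cast card_piAntidiag_le m
    calc ‖p m‖ * r ^ m ≤ ((2 ^ N) ^ m * (C / (2 ^ N * (2 * (r + 1))) ^ m)) * (r + 1) ^ m := by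
          gcongr
          · exact h1.trans (by gcongr)
          · linarith
      _ = C * (1 / 2) ^ m := by
          rw [mul_pow, mul_pow, div_pow, one_pow]
          field_simp
  have hps := p.hasFPowerSeriesOnBall (by rw [hrad]; exact ENNReal.zero_lt_top)
  rw [hrad] at hps
  have han : AnalyticOnNhd ℂ p.sum Set.univ := by
    have := hps.analyticOnNhd
    rwa [Metric.eball_top] at this
  refine ⟨formOf p.sum han, fun k => ?_⟩
  -- the partial sums converge uniformly on the unit ball, hence so do their Taylor coefficients
  let F : ℕ → HolForm N := fun n => ∑ m ∈ Finset.range n, ∑ k ∈ S m, a k • monomialForm k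
  have hF1 : ∀ n z, (F n).coeffAt z = p.partialSum n z := by
    intro n z
    simp only [F, map_sum, map_smul, FormalMultilinearSeries.partialSum, hp, monomialForm,
      coeffAt_formOf, smul_eq_mul]
  have hF2 : ∀ n, order k < n → taylorCoeff k (F n) = a k := by
    intro n hn
    simp only [F, map_sum, map_smul, taylorCoeff_monomialForm, smul_eq_mul]
    rw [Finset.sum_eq_single (order k)]
    · rw [Finset.sum_eq_single k]
      · simp
      · intro b _ hb; simp [Ne.symm hb]
      · intro h; exact absurd (hS.mpr rfl) h
    · intro m _ hm
      refine Finset.sum_eq_zero fun b hb => ?_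
      rw [if_neg fun h => hm (by rw [h, hS.mp hb]), mul_zero]
    · intro h; exact absurd (Finset.mem_range.mpr hn) h
  have hunif := hps.tendstoUniformlyOn (r' := 2) (by simp)
  rw [Metric.tendstoUniformlyOn_iff] at hunif
  rw [← sub_eq_zero, ← norm_le_zero_iff]
  refine le_of_forall_pos_le_add fun ε hε => ?_
  obtain ⟨n, hn1, hn2⟩ := ((hunif ε hε).and (Filter.eventually_gt_atTop (order k))).exists
  have h1 := norm_taylorCoeff_le (ω := formOf p.sum han - F n) (ρ := 1) (M := ε) one_pos (by
    intro z hz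
    have h2 := hn1 z (by simp; linarith)
    rw [map_sub, coeffAt_formOf, hF1]
    rw [zero_add, dist_eq_norm] at h2
    exact h2.le) k
  rw [map_sub, hF2 n hn2, one_pow, mul_one] at h1
  linarith

end Realization
/-! ### Koszul complexes and their homotopies -/

section Exterior

variable {M M' S : Type*} [AddCommGroup M] [Module ℂ M] [AddCommGroup M'] [Module ℂ M']
  [AddCommGroup S] [Module ℂ S]

/-- Left exterior multiplication by a vector. -/
def wedgeLeft (m : M) (n : ℕ) : ⋀[ℂ]^n M →ₗ[ℂ] ⋀[ℂ]^(n + 1) M :=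
  exteriorPower.alternatingMapLinearEquiv ((exteriorPower.ιMulti ℂ (n + 1)).curryLeft m)

theorem wedgeLeft_ιMulti (m : M) (n : ℕ) (t : Fin n → M) :
    wedgeLeft m n (exteriorPower.ιMulti ℂ n t) =
      exteriorPower.ιMulti ℂ (n + 1) (Matrix.vecCons m t) := by
  rw [wedgeLeft, exteriorPower.alternatingMapLinearEquiv_apply_ιMulti]
  rfl

theorem interior_wedgeLeft_zero (φ : Module.Dual ℂ M) (m : M) :
    interior φ 0 ∘ₗ wedgeLeft m 0 = φ m • LinearMap.id := by
  refine exteriorPower.linearMap_ext ?_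
  ext1 t
  simp only [LinearMap.compAlternatingMap_apply, LinearMap.comp_apply, wedgeLeft_ιMulti,
    interior_ιMulti, Fin.sum_univ_succ, Fin.sum_univ_zero, LinearMap.smul_apply, LinearMap.id_apply]
  simp

/-- Exterior and interior multiplication satisfy the relation of a Clifford algebra. -/
theorem interior_wedgeLeft_succ (φ : Module.Dual ℂ M) (m : M) (n : ℕ) :
    interior φ (n + 1) ∘ₗ wedgeLeft m (n + 1) =
      φ m • LinearMap.id - wedgeLeft m n ∘ₗ interior φ n := by
  refine exteriorPower.linearMap_ext ?_
  ext1 t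
  simp only [LinearMap.compAlternatingMap_apply, LinearMap.comp_apply, wedgeLeft_ιMulti,
    interior_ιMulti, LinearMap.sub_apply, map_sum, map_smul, LinearMap.smul_apply,
    LinearMap.id_apply]
  rw [Fin.sum_univ_succ, sub_eq_add_neg, ← Finset.sum_neg_distrib]
  congr 1
  · simp
  · refine Finset.sum_congr rfl fun i _ => ?_
    have h : i.succ.removeNth (Matrix.vecCons m t) = Matrix.vecCons m (i.removeNth t) := by
      funext j
      refine Fin.cases rfl (fun j => ?_) j
      simp [Fin.removeNth]
    rw [h, Fin.val_succ, pow_succ, mul_neg_one, Matrix.cons_val_succ]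
    module

variable {ι : Type*} [Fintype ι]

theorem koszul_eq_sum (a : M →ₗ[ℂ] S →ₗ[ℂ] S) (e : Module.Basis ι ℂ M) (n : ℕ) :
    koszul a n = ∑ j, TensorProduct.map (a (e j)) (interior (e.coord j) n) := by
  refine tmul_ext fun s t => ?_
  rw [koszul_tmul]
  simp only [LinearMap.sum_apply, TensorProduct.map_tmul, interior_ιMulti, TensorProduct.tmul_sum,
    TensorProduct.tmul_smul]
  rw [Finset.sum_comm]
  refine Finset.sum_congr rfl fun i _ => ?_
  rw [← Finset.smul_sum]
  congr 1
  conv_lhs => rw [← e.sum_repr (t i)]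
  simp only [map_sum, map_smul, LinearMap.sum_apply, LinearMap.smul_apply, TensorProduct.sum_tmul,
    TensorProduct.smul_tmul', Module.Basis.coord_apply]

/-- The homotopy `∑ b_j ⊗ (e_j ∧ ·)` of a Koszul complex. -/
def koszulHomotopy (b : ι → S →ₗ[ℂ] S) (e : ι → M) (n : ℕ) :
    S ⊗[ℂ] ⋀[ℂ]^n M →ₗ[ℂ] S ⊗[ℂ] ⋀[ℂ]^(n + 1) M :=
  ∑ j, TensorProduct.map (b j) (wedgeLeft (e j) n)

/-- The operator that multiplies the exterior product of the basis vectors with indices in a finite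
set `J` with the sum of the numbers `s_j`, `j ∈ J`. -/
def numberOp (s : ι → ℂ) (e : Module.Basis ι ℂ M) : ∀ n, ⋀[ℂ]^n M →ₗ[ℂ] ⋀[ℂ]^n M
  | 0 => 0
  | n + 1 => ∑ j, s j • (wedgeLeft (e j) n ∘ₗ interior (e.coord j) n)

theorem koszul_homotopy_zero (a : M →ₗ[ℂ] S →ₗ[ℂ] S) (b : ι → S →ₗ[ℂ] S)
    (e : Module.Basis ι ℂ M) :
    koszul a 0 ∘ₗ koszulHomotopy b e 0 =
      TensorProduct.map (∑ j, a (e j) ∘ₗ b j) LinearMap.id := by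
  refine TensorProduct.ext' fun x y => ?_
  have h : ∀ i j, interior (e.coord i) 0 (wedgeLeft (e j) 0 y) = e.coord i (e j) • y := fun i j =>
    LinearMap.congr_fun (interior_wedgeLeft_zero (e.coord i) (e j)) y
  classical
  rw [koszul_eq_sum a e, koszulHomotopy]
  simp only [LinearMap.comp_apply, LinearMap.sum_apply, TensorProduct.map_tmul, map_sum, h,
    LinearMap.id_apply, TensorProduct.sum_tmul]
  refine Finset.sum_congr rfl fun j _ => ?_
  rw [Finset.sum_eq_single j]
  · simp
  · intro i _ hi
    simp [Ne.symm hi]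
  · simp

/-- If the operators `b_j` commute with the action of the `e_i` up to the numbers `s_j` for `i = j`, the
anticommutator of the Koszul differential with the homotopy is the sum of an operator on `S` and an
operator on the exterior algebra. -/
theorem koszul_homotopy_succ [DecidableEq ι] (a : M →ₗ[ℂ] S →ₗ[ℂ] S) (b : ι → S →ₗ[ℂ] S) (s : ι → ℂ)
    (e : Module.Basis ι ℂ M)
    (hab : ∀ i j x, b j (a (e i) x) = a (e i) (b j x) + (if i = j then s i • x else 0)) (n : ℕ) :
    koszul a (n + 1) ∘ₗ koszulHomotopy b e (n + 1) + koszulHomotopy b e n ∘ₗ koszul a n =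
      TensorProduct.map (∑ j, a (e j) ∘ₗ b j) LinearMap.id +
        TensorProduct.map LinearMap.id (numberOp s e (n + 1)) := by
  refine TensorProduct.ext' fun x y => ?_
  have h : ∀ i j, interior (e.coord i) (n + 1) (wedgeLeft (e j) (n + 1) y) =
      e.coord i (e j) • y - wedgeLeft (e j) n (interior (e.coord i) n y) := fun i j =>
    LinearMap.congr_fun (interior_wedgeLeft_succ (e.coord i) (e j) n) y
  rw [koszul_eq_sum a e, koszul_eq_sum a e, koszulHomotopy, koszulHomotopy, numberOp]
  simp only [LinearMap.add_apply, LinearMap.comp_apply, LinearMap.sum_apply, TensorProduct.map_tmul,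
    map_sum, h, hab, LinearMap.id_apply, TensorProduct.sum_tmul, TensorProduct.tmul_sub,
    TensorProduct.add_tmul, Finset.sum_sub_distrib, Finset.sum_add_distrib, LinearMap.smul_apply,
    TensorProduct.tmul_sum, TensorProduct.tmul_smul]
  have h1 : ∀ i, ∑ j, (a (e j)) ((b i) x) ⊗ₜ[ℂ] (e.coord j (e i) • y) =
      (a (e i)) ((b i) x) ⊗ₜ[ℂ] y := by
    intro i
    rw [Finset.sum_eq_single i]
    · simp
    · intro j _ hj
      simp [Ne.symm hj]
    · simp
  have h2 : ∀ i, ∑ j, (if i = j then s i • x else 0) ⊗ₜ[ℂ]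
      wedgeLeft (e j) n (interior (e.coord i) n y) =
      s i • (x ⊗ₜ[ℂ] wedgeLeft (e i) n (interior (e.coord i) n y)) := by
    intro i
    rw [Finset.sum_eq_single i]
    · simp [TensorProduct.smul_tmul']
    · intro j _ hj
      simp [Ne.symm hj]
    · simp
  simp only [TensorProduct.tmul_smul] at h1
  simp only [h1, h2]
  rw [Finset.sum_comm (f := fun i j => (a (e j)) ((b i) x) ⊗ₜ[ℂ]
    wedgeLeft (e i) n (interior (e.coord j) n y))]
  abel

theorem numberOp_ιMulti (s : ι → ℂ) (e : Module.Basis ι ℂ M) (n : ℕ) (c : Fin n → ι) :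
    numberOp s e n (exteriorPower.ιMulti ℂ n (e ∘ c)) =
      (∑ i, s (c i)) • exteriorPower.ιMulti ℂ n (e ∘ c) := by
  cases n with
  | zero => simp [numberOp]
  | succ n =>
    simp only [numberOp, LinearMap.sum_apply, LinearMap.smul_apply, LinearMap.comp_apply,
      interior_ιMulti, map_sum, map_smul, wedgeLeft_ιMulti, Finset.smul_sum, Finset.sum_smul]
    rw [Finset.sum_comm]
    refine Finset.sum_congr rfl fun i _ => ?_
    rw [Finset.sum_eq_single (c i)]
    · have h := AlternatingMap.neg_one_pow_smul_map_insertNth (exteriorPower.ιMulti ℂ (n + 1)) i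
        (e (c i)) (i.removeNth (e ∘ c))
      rw [← h, ← Int.cast_smul_eq_zsmul ℂ]
      have h2 : i.insertNth (α := fun _ => M) (e (c i)) (i.removeNth (e ∘ c)) = e ∘ c :=
        Fin.insertNth_self_removeNth i (e ∘ c)
      rw [h2]
      simp [smul_smul, ← mul_pow]
    · intro j _ hj
      simp [Ne.symm hj]
    · simp

/-- Naturality of the exterior multiplication. -/
theorem map_wedgeLeft (P : M →ₗ[ℂ] M') (m : M) (n : ℕ) :
    exteriorPower.map (n + 1) P ∘ₗ wedgeLeft m n = wedgeLeft (P m) n ∘ₗ exteriorPower.map n P := by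
  refine exteriorPower.linearMap_ext ?_
  ext1 t
  simp only [LinearMap.compAlternatingMap_apply, LinearMap.comp_apply, wedgeLeft_ιMulti,
    exteriorPower.map_apply_ιMulti]
  congr 1
  funext i
  exact Fin.cases rfl (fun i => rfl) i

theorem interior_smul (r : ℂ) (p : Module.Dual ℂ M)
    (n : ℕ) : interior (r • p) n = r • interior p n := by
  refine exteriorPower.linearMap_ext ?_
  ext1 t
  simp only [LinearMap.compAlternatingMap_apply, LinearMap.smul_apply, interior_ιMulti,
    Finset.smul_sum]
  refine Finset.sum_congr rfl fun i _ => ?_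
  rw [smul_eq_mul]
  module

end Exterior
/-! ### Independence of the edge framing -/

namespace Arrangement

variable {N : ℕ} {𝒞 : Arrangement N}

section FramingIndependence

namespace EdgeFraming

variable (φ φ₀ : EdgeFraming 𝒞) {α β : 𝒞.Vertex}

/-- Seen in the ambient exterior algebra, the substitution is the interior multiplication, whose values
already lie in the exterior power of the kernel. -/
theorem map_subtype_substitution (h : α ≻ β ∨ β ≻ α) (n : ℕ) :
    exteriorPower.map n β.TF.subtype ∘ₗ φ.substitution h n =
      exteriorPower.map n α.TF.subtype ∘ₗ interior (φ.pairing α β) n := by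
  have e : β.TF.subtype ∘ₗ φ.shift h =
      α.TF.subtype - (φ.pairing α β).smulRight (φ.vec α β) := rfl
  rw [substitution, ← LinearMap.comp_assoc, ← exteriorPower.map_comp, e, map_sub_interior]

/-- The substitution depends on the framing only through the linear function that is
substituted. -/
theorem substitution_eq_smul (h : α ≻ β ∨ β ≻ α) {r : ℂ}
    (hr : φ.pairing α β = r • φ₀.pairing α β) (n : ℕ) :
    φ.substitution h n = r • φ₀.substitution h n := by
  have hinj : Function.Injective (exteriorPower.map n β.TF.subtype) :=
    exteriorPower.map_injective_field β.TF.injective_subtype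
  refine LinearMap.ext fun x => hinj ?_
  have h1 := LinearMap.congr_fun (φ.map_subtype_substitution h n) x
  have h2 := LinearMap.congr_fun (φ₀.map_subtype_substitution h n) x
  simp only [LinearMap.comp_apply] at h1 h2
  rw [LinearMap.smul_apply, map_smul, h1, h2, hr, interior_smul, LinearMap.smul_apply, map_smul]

theorem pairing_eq_smul_down (h : α ≻ β) :
    φ.pairing α β = ((φ₀.c α β)⁻¹ * φ.f α β (φ₀.ξ α β)) • φ₀.pairing α β := by
  refine LinearMap.ext fun t => ?_
  have h1 := φ.f_apply_eq_zero h (φ₀.sub_mem h t.2.1)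
  rw [LinearMap.smul_apply, φ.pairing_down h, φ₀.pairing_down h]
  simp only [map_sub, map_smul, smul_eq_mul] at h1 ⊢
  linear_combination h1

theorem piDown_eq_smul (h : α ≻ β) {a b : ℕ} (hab : a = b + 1) (ha : finrank ℂ α.T = a) :
    φ₀.piDown h hab = ((φ₀.c α β)⁻¹ * φ.f α β (φ₀.ξ α β)) • φ.piDown h hab := by
  subst hab
  refine LinearMap.ext fun ω => ?_
  ext u
  have h1 := φ.f_mul_piDown h ha ω ⟨φ₀.ξ α β, φ₀.ξ_mem h⟩ u
  rw [LinearMap.smul_apply, AlternatingMap.smul_apply, smul_eq_mul, mul_assoc, h1,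
    φ₀.piDown_apply]

theorem pairing_eq_smul_up (h : β ≻ α) :
    φ.pairing α β = ((φ₀.c β α)⁻¹ * φ₀.f β α (φ.ξ β α)) • φ₀.pairing α β := by
  refine LinearMap.ext fun t => ?_
  have h1 := (Submodule.mem_dualAnnihilator _).mp t.2.2 _ (φ₀.sub_mem h (φ.ξ_mem h))
  rw [LinearMap.smul_apply, φ.pairing_up h, φ₀.pairing_up h]
  simp only [map_sub, map_smul, smul_eq_mul] at h1 ⊢
  linear_combination h1

theorem piUp_eq_smul (h : β ≻ α) {a b : ℕ} (hab : a = b + 1) (ha : finrank ℂ β.T = a) :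
    φ₀.piUp h hab = ((φ₀.c β α)⁻¹ * φ₀.f β α (φ.ξ β α)) • φ.piUp h hab := by
  subst hab
  refine LinearMap.ext fun ω => φ.form_ext h ha fun u => ?_
  rw [LinearMap.smul_apply, AlternatingMap.smul_apply, φ.piUp_cons, smul_eq_mul]
  change (φ₀.c β α)⁻¹ * φ₀.wedge h rfl ω _ = _
  rw [φ₀.wedge_cons h _ _ _ (fun i => (u i).2), ← mul_assoc]
  rfl

theorem exists_pairing_eq_smul (h : α ≻ β ∨ β ≻ α) :
    ∃ r : ℂ, φ.pairing α β = r • φ₀.pairing α β ∧ φ₀.π h = r • φ.π h := by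
  by_cases h' : α ≻ β
  · refine ⟨_, φ.pairing_eq_smul_down φ₀ h', ?_⟩
    rw [φ.π_down h', φ₀.π_down h']
    exact φ.piDown_eq_smul φ₀ h' _ rfl
  · have h'' := h.resolve_left h'
    refine ⟨_, φ.pairing_eq_smul_up φ₀ h'', ?_⟩
    rw [φ.π_up h'', φ₀.π_up h'']
    exact φ.piUp_eq_smul φ₀ h'' _ rfl

end EdgeFraming

variable {V : 𝒞.Vertex → Type u} [∀ α, AddCommGroup (V α)] [∀ α, Module ℂ (V α)]

/-- A change of the framing multiplies the substitution and `π` by inverse scalars. -/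
theorem edgeMap_eq_edgeMap (φ φ₀ : EdgeFraming 𝒞) (𝒱 : Quiver 𝒞 V) (α β : 𝒞.Vertex) (n : ℕ) :
    edgeMap φ 𝒱 α β n = edgeMap φ₀ 𝒱 α β n := by
  by_cases h : α ≻ β ∨ β ≻ α
  · obtain ⟨r, hr1, hr2⟩ := φ.exists_pairing_eq_smul φ₀ h
    refine Vertex.term_ext fun s x w v => ?_
    rw [edgeMap_pure φ 𝒱 h, edgeMap_pure φ₀ 𝒱 h, φ.substitution_eq_smul φ₀ h hr1, hr2]
    simp only [Vertex.pure, LinearMap.smul_apply, TensorProduct.tmul_smul,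
      ← TensorProduct.smul_tmul']
    rfl
  · rw [edgeMap_eq_zero φ 𝒱 h, edgeMap_eq_zero φ₀ 𝒱 h]

theorem dDR_eq_dDR (φ φ₀ : EdgeFraming 𝒞) (𝒱 : Quiver 𝒞 V) (n : ℕ) :
    dDR φ 𝒱 n = dDR φ₀ 𝒱 n := by
  simp only [dDR, d₀, edgeMap_eq_edgeMap φ φ₀]

end FramingIndependence

end Arrangement
/-! ### Bases adapted to a stratum and conjugate operators -/

section Adapted

variable {N : ℕ}

/-- A basis of `ℂ^N` adapted to a subspace `T`: a part of the basis vectors lies in `T`, and the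
coordinate functions of the others vanish on `T`. -/
structure AdaptedBasis (T : Submodule ℂ (Pt N)) where
  /-- the basis -/
  ε : Module.Basis (Fin N) ℂ (Pt N)
  /-- the set of indices of the basis vectors in `T` -/
  τ : Finset (Fin N)
  mem : ∀ j ∈ τ, ε j ∈ T
  coord_mem : ∀ j ∉ τ, ε.coord j ∈ T.dualAnnihilator
  card_eq : τ.card = finrank ℂ T

theorem nonempty_adaptedBasis (T : Submodule ℂ (Pt N)) : Nonempty (AdaptedBasis T) := by
  obtain ⟨C, hC⟩ := T.exists_isCompl
  let b := ((Module.finBasis ℂ T).prod (Module.finBasis ℂ C)).map (T.prodEquivOfIsCompl C hC)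
  have hcard : finrank ℂ T + finrank ℂ C = N := by
    rw [Submodule.finrank_add_eq_of_isCompl hC, Module.finrank_fin_fun]
  let e : Fin (finrank ℂ T) ⊕ Fin (finrank ℂ C) ≃ Fin N := finSumFinEquiv.trans (finCongr hcard)
  refine ⟨⟨b.reindex e, Finset.univ.map (Function.Embedding.inl.trans e.toEmbedding), ?_, ?_, ?_⟩⟩
  · intro j hj
    obtain ⟨i, -, rfl⟩ := Finset.mem_map.mp hj
    simp [b]
  · intro j hj
    obtain ⟨i | i, rfl⟩ := e.surjective j
    · exact absurd (Finset.mem_map.mpr ⟨i, Finset.mem_univ _, rfl⟩) hj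
    · rw [Submodule.mem_dualAnnihilator]
      intro x hx
      have : (T.prodEquivOfIsCompl C hC).symm x = (⟨x, hx⟩, 0) :=
        Submodule.prodEquivOfIsCompl_symm_apply_left T C hC ⟨x, hx⟩
      simp [b, this]
  · simp

namespace AdaptedBasis

variable {T : Submodule ℂ (Pt N)} (A : AdaptedBasis T)

theorem coord_eq_zero {x : Pt N} (hx : x ∈ T) {j : Fin N} (hj : j ∉ A.τ) : A.ε.coord j x = 0 :=
  (Submodule.mem_dualAnnihilator _).mp (A.coord_mem j hj) x hx

theorem apply_eq_zero {g : Module.Dual ℂ (Pt N)} (hg : g ∈ T.dualAnnihilator) {j : Fin N}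
    (hj : j ∈ A.τ) : g (A.ε j) = 0 :=
  (Submodule.mem_dualAnnihilator _).mp hg _ (A.mem j hj)

/-- The coordinates on `T ⊕ T^⊥`. -/
def equivFun : (T.prod T.dualAnnihilator) ≃ₗ[ℂ] (Fin N → ℂ) where
  toFun t j := if j ∈ A.τ then A.ε.coord j t.1.1 else t.1.2 (A.ε j)
  map_add' t t' := by
    funext j
    by_cases h : j ∈ A.τ <;> simp [h]
  map_smul' r t := by
    funext j
    by_cases h : j ∈ A.τ <;> simp [h]
  invFun c := ⟨(∑ j ∈ A.τ, c j • A.ε j, ∑ j ∈ A.τᶜ, c j • A.ε.coord j),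
    ⟨Submodule.sum_mem _ fun j hj => Submodule.smul_mem _ _ (A.mem j hj),
      Submodule.sum_mem _ fun j hj =>
        Submodule.smul_mem _ _ (A.coord_mem j (Finset.mem_compl.mp hj))⟩⟩
  left_inv t := by
    refine Subtype.ext (Prod.ext ?_ ?_)
    · conv_rhs => rw [← A.ε.sum_repr t.1.1, ← Finset.sum_add_sum_compl A.τ]
      have h : ∑ j ∈ A.τᶜ, A.ε.repr t.1.1 j • A.ε j = 0 :=
        Finset.sum_eq_zero fun j hj => by
          have := A.coord_eq_zero t.2.1 (Finset.mem_compl.mp hj)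
          rw [Module.Basis.coord_apply] at this
          rw [this, zero_smul]
      rw [h, add_zero]
      exact Finset.sum_congr rfl fun j hj => by simp only [if_pos hj]; rfl
    · have h0 := A.ε.sum_dual_apply_smul_coord t.1.2
      conv_rhs => rw [← h0, ← Finset.sum_add_sum_compl A.τ]
      have h : ∑ j ∈ A.τ, t.1.2 (A.ε j) • A.ε.coord j = 0 :=
        Finset.sum_eq_zero fun j hj => by rw [A.apply_eq_zero t.2.2 hj, zero_smul]
      rw [h, zero_add]
      exact Finset.sum_congr rfl fun j hj => by simp only [if_neg (Finset.mem_compl.mp hj)]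
  right_inv c := by
    funext j
    by_cases h : j ∈ A.τ
    · simp only [h, if_true, map_sum, map_smul, Module.Basis.coord_apply, Module.Basis.repr_self]
      simp [Finsupp.single_apply, h]
    · simp only [h, if_false, LinearMap.sum_apply, LinearMap.smul_apply, Module.Basis.coord_apply,
        Module.Basis.repr_self]
      simp [Finsupp.single_apply, h]

/-- The basis of `T ⊕ T^⊥` that consists of the basis vectors in `T` and of the coordinate functions
vanishing on `T`. -/
def basis : Module.Basis (Fin N) ℂ (T.prod T.dualAnnihilator) := Module.Basis.ofEquivFun A.equivFun

theorem coe_basis_of_mem {j : Fin N} (hj : j ∈ A.τ) : (A.basis j).1 = (A.ε j, 0) := by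
  have : A.basis j = A.equivFun.symm (Pi.single j 1) := by simp [basis]
  rw [this]
  change (∑ i ∈ A.τ, (Pi.single j 1 : Fin N → ℂ) i • A.ε i,
    ∑ i ∈ A.τᶜ, (Pi.single j 1 : Fin N → ℂ) i • A.ε.coord i) = _
  simp [Pi.single_apply, hj]

theorem coe_basis_of_notMem {j : Fin N} (hj : j ∉ A.τ) : (A.basis j).1 = (0, A.ε.coord j) := by
  have : A.basis j = A.equivFun.symm (Pi.single j 1) := by simp [basis]
  rw [this]
  change (∑ i ∈ A.τ, (Pi.single j 1 : Fin N → ℂ) i • A.ε i,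
    ∑ i ∈ A.τᶜ, (Pi.single j 1 : Fin N → ℂ) i • A.ε.coord i) = _
  simp [Pi.single_apply, hj]

/-- The sign of a basis element: its contribution to the total degree. -/
def sgn (j : Fin N) : ℂ := if j ∈ A.τ then -1 else 1

/-- The operators conjugate to the action of the basis elements on `N`-forms: multiplication with
coordinates in directions of `T`, and derivatives in the other directions. -/
def conj (j : Fin N) : HolForm N →ₗ[ℂ] HolForm N :=
  if j ∈ A.τ then - mulFun (A.ε.coord j) else dirDeriv (A.ε j)

theorem rightAct_basis_of_mem {j : Fin N} (hj : j ∈ A.τ) (ω : HolForm N) :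
    rightAct (A.basis j).1 ω = - dirDeriv (A.ε j) ω := by
  rw [A.coe_basis_of_mem hj]
  simp [rightAct, dirDeriv]

theorem rightAct_basis_of_notMem {j : Fin N} (hj : j ∉ A.τ) (ω : HolForm N) :
    rightAct (A.basis j).1 ω = mulFun (A.ε.coord j) ω := by
  rw [A.coe_basis_of_notMem hj]
  simp [rightAct]

/-- The canonical commutation relations. -/
theorem conj_rightAct (i j : Fin N) (ω : HolForm N) :
    A.conj j (rightAct (A.basis i).1 ω) =
      rightAct (A.basis i).1 (A.conj j ω) + if i = j then A.sgn i • ω else 0 := by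
  have hij : A.ε.coord j (A.ε i) = if i = j then 1 else 0 := by
    simp [Finsupp.single_apply]
  have hji : A.ε.coord i (A.ε j) = if i = j then 1 else 0 := by
    simp [Finsupp.single_apply, eq_comm]
  by_cases hi : i ∈ A.τ
  · rw [A.rightAct_basis_of_mem hi, A.rightAct_basis_of_mem hi]
    by_cases hj : j ∈ A.τ
    · simp only [conj, sgn, hi, hj, if_true, LinearMap.neg_apply, map_neg, neg_neg,
        dirDeriv_mulFun, hij]
      split_ifs <;> simp
    · have : i ≠ j := fun h => hj (h ▸ hi)
      simp only [conj, hj, this, if_false, map_neg, add_zero]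
      rw [dirDeriv_comm]
  · rw [A.rightAct_basis_of_notMem hi, A.rightAct_basis_of_notMem hi]
    by_cases hj : j ∈ A.τ
    · have : i ≠ j := fun h => hi (h ▸ hj)
      simp only [conj, hj, this, if_true, if_false, LinearMap.neg_apply, map_neg, add_zero]
      rw [mulFun_comm]
    · simp only [conj, sgn, hi, hj, if_false, dirDeriv_mulFun, hji]
      split_ifs <;> simp

theorem sum_coord_dirDeriv (b : Module.Basis (Fin N) ℂ (Pt N)) (ω : HolForm N) (z : Pt N) :
    (∑ j, mulFun (b.coord j) (dirDeriv (b j) ω)).coeffAt z =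
      HolForm.coeffAt z (∑ l, coordMul l (partialD l ω)) := by
  have key : ∀ b : Module.Basis (Fin N) ℂ (Pt N),
      (∑ j, mulFun (b.coord j) (dirDeriv (b j) ω)).coeffAt z = (dirDeriv z ω).coeffAt z := by
    intro b
    have hz : dirDeriv z = ∑ j, b.repr z j • dirDeriv (b j) := by
      conv_lhs => rw [← b.sum_repr z]
      simp only [map_sum, map_smul]
    rw [hz]
    simp only [map_sum, coeffAt_mulFun, map_smul, LinearMap.sum_apply, LinearMap.smul_apply,
      smul_eq_mul, Module.Basis.coord_apply]
  rw [key b, ← key (Pi.basisFun ℂ (Fin N))]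
  congr 1
  refine Finset.sum_congr rfl fun l _ => ?_
  have h1 : (Pi.basisFun ℂ (Fin N)).coord l = LinearMap.proj l := by ext; simp
  have h2 : Pi.basisFun ℂ (Fin N) l = stdBasis N l := by simp [stdBasis]
  rw [h1, h2]
  rfl

/-- The sum of the products of conjugate operators is the Euler operator, up to a constant. -/
theorem sum_rightAct_conj (ω : HolForm N) :
    ∑ j, rightAct (A.basis j).1 (A.conj j ω) =
      ∑ l, coordMul l (partialD l ω) + (A.τ.card : ℂ) • ω := by
  have h : ∀ j, rightAct (A.basis j).1 (A.conj j ω) =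
      mulFun (A.ε.coord j) (dirDeriv (A.ε j) ω) + if j ∈ A.τ then ω else 0 := by
    intro j
    by_cases hj : j ∈ A.τ
    · rw [A.rightAct_basis_of_mem hj]
      simp [conj, hj, dirDeriv_mulFun]
    · rw [A.rightAct_basis_of_notMem hj]
      simp [conj, hj]
  rw [Finset.sum_congr rfl fun j _ => h j, Finset.sum_add_distrib]
  congr 1
  · exact HolForm.ext_coeffAt fun z => sum_coord_dirDeriv A.ε ω z
  · simp [Nat.cast_smul_eq_nsmul]

/-- The weight of an exterior product of basis elements, shifted by the dimension of `T` in order to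
be nonnegative: the number of basis vectors in `T` that are missing, plus the number of functions
that occur. -/
def weight (J : Finset (Fin N)) : ℕ := (A.τ \ J).card + (J \ A.τ).card

theorem weight_eq_zero {J : Finset (Fin N)} : A.weight J = 0 ↔ J = A.τ := by
  rw [weight, Nat.add_eq_zero_iff, Finset.card_eq_zero, Finset.card_eq_zero,
    Finset.sdiff_eq_empty_iff_subset, Finset.sdiff_eq_empty_iff_subset]
  exact ⟨fun h => h.2.antisymm h.1, fun h => h ▸ ⟨subset_rfl, subset_rfl⟩⟩

theorem sum_sgn (J : Finset (Fin N)) :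
    ∑ j ∈ J, A.sgn j + (A.τ.card : ℂ) = A.weight J := by
  have h1 : ∑ j ∈ J, A.sgn j = ((J \ A.τ).card : ℂ) - ((J ∩ A.τ).card : ℂ) := by
    simp only [sgn]
    rw [Finset.sum_ite, ← Finset.filter_mem_eq_inter, Finset.sdiff_eq_filter]
    simp
    ring
  have h2 : A.τ.card = (A.τ \ J).card + (J ∩ A.τ).card := by
    rw [Finset.inter_comm, Finset.card_sdiff_add_card_inter]
  rw [h1, h2, weight]
  push_cast
  ring

end AdaptedBasis
end Adapted
/-! ### Coefficients with respect to an adapted basis -/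

section Decay

variable {N : ℕ} {W : Type*} [NormedAddCommGroup W]

theorem Decay.add {a b : (Fin N → ℕ) → W} (ha : Decay a) (hb : Decay b) : Decay (a + b) := by
  intro R hR
  obtain ⟨C, hC⟩ := ha R hR
  obtain ⟨D, hD⟩ := hb R hR
  refine ⟨C + D, fun k => ?_⟩
  have h0 : (0 : ℝ) ≤ R ^ order k := pow_nonneg (zero_le_one.trans hR) _
  calc ‖a k + b k‖ * R ^ order k ≤ (‖a k‖ + ‖b k‖) * R ^ order k := by gcongr; exact norm_add_le _ _
    _ ≤ C + D := by rw [add_mul]; exact add_le_add (hC k) (hD k)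

theorem Decay.sum {ι : Type*} (s : Finset ι) {a : ι → (Fin N → ℕ) → W}
    (ha : ∀ i ∈ s, Decay (a i)) : Decay fun k => ∑ i ∈ s, a i k := by
  classical
  induction s using Finset.induction_on with
  | empty => exact fun R _ => ⟨0, fun k => by simp⟩
  | insert i s hi ih =>
    simp only [Finset.sum_insert hi]
    exact (ha i (Finset.mem_insert_self _ _)).add
      (ih fun j hj => ha j (Finset.mem_insert_of_mem hj))

theorem Decay.map {W' : Type*} [NormedAddCommGroup W'] [NormedSpace ℂ W] [NormedSpace ℂ W']
    [FiniteDimensional ℂ W] {a : (Fin N → ℕ) → W} (ha : Decay a) (f : W →ₗ[ℂ] W') :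
    Decay fun k => f (a k) := by
  intro R hR
  obtain ⟨C, hC⟩ := ha R hR
  refine ⟨‖f.toContinuousLinearMap‖ * C, fun k => ?_⟩
  have h0 : (0 : ℝ) ≤ R ^ order k := pow_nonneg (zero_le_one.trans hR) _
  calc ‖f (a k)‖ * R ^ order k ≤ (‖f.toContinuousLinearMap‖ * ‖a k‖) * R ^ order k := by
        gcongr; exact f.toContinuousLinearMap.le_opNorm (a k)
    _ ≤ ‖f.toContinuousLinearMap‖ * C := by
        rw [mul_assoc]; exact mul_le_mul_of_nonneg_left (hC k) (norm_nonneg _)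

end Decay

namespace AdaptedBasis

variable {N : ℕ} {T : Submodule ℂ (Pt N)} (A : AdaptedBasis T)

/-- The basis vectors in `T`, in increasing order of their indices. -/
def topVec (i : Fin (finrank ℂ T)) : T :=
  ⟨A.ε (A.τ.orderEmbOfFin A.card_eq i), A.mem _ (Finset.orderEmbOfFin_mem _ _ _)⟩

theorem linearIndependent_topVec : LinearIndependent ℂ A.topVec := by
  have h := A.ε.linearIndependent.comp (A.τ.orderEmbOfFin A.card_eq)
    (A.τ.orderEmbOfFin A.card_eq).injective
  exact LinearIndependent.of_comp T.subtype h

/-- The basis of `T` that consists of the basis vectors in `T`. -/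
def topBasis : Module.Basis (Fin (finrank ℂ T)) ℂ T :=
  Module.Basis.mk A.linearIndependent_topVec
    (A.linearIndependent_topVec.span_eq_top_of_card_eq_finrank' (by simp)).ge

theorem coe_topBasis : ⇑A.topBasis = A.topVec := Module.Basis.coe_mk _ _

/-- Evaluation of top forms on `T` at the basis of `T`. -/
def evTop : (T [⋀^Fin (finrank ℂ T)]→ₗ[ℂ] ℂ) →ₗ[ℂ] ℂ where
  toFun w := w A.topBasis
  map_add' _ _ := rfl
  map_smul' _ _ := rfl

theorem evTop_smul_det (w : T [⋀^Fin (finrank ℂ T)]→ₗ[ℂ] ℂ) : A.evTop w • A.topBasis.det = w :=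
  (w.eq_smul_basis_det A.topBasis).symm

theorem evTop_det : A.evTop A.topBasis.det = 1 := A.topBasis.det_self

/-- The basis of the exterior power of `T ⊕ T^⊥` that consists of the exterior products of the
elements of the basis. -/
abbrev wedgeBasis (n : ℕ) :
    Module.Basis (Set.powersetCard (Fin N) n) ℂ (⋀[ℂ]^n (T.prod T.dualAnnihilator)) :=
  A.basis.exteriorPower n

theorem wedgeBasis_apply (n : ℕ) (J : Set.powersetCard (Fin N) n) :
    A.wedgeBasis n J = exteriorPower.ιMulti ℂ n (A.basis ∘ J.1.orderEmbOfFin J.2) := by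
  rw [wedgeBasis, exteriorPower.basis_apply]
  rfl

theorem coord_wedgeBasis {n : ℕ} (J J' : Set.powersetCard (Fin N) n) :
    (A.wedgeBasis n).coord J (A.wedgeBasis n J') = if J' = J then 1 else 0 := by
  rw [Module.Basis.coord_apply, Module.Basis.repr_self, Finsupp.single_apply]

end AdaptedBasis

theorem sum_orderEmbOfFin {N : ℕ} {R : Type*} [AddCommMonoid R] {n : ℕ}
    (J : Set.powersetCard (Fin N) n) (s : Fin N → R) :
    ∑ i, s (J.1.orderEmbOfFin J.2 i) = ∑ j ∈ J.1, s j := by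
  have : J.1 = Finset.univ.map (J.1.orderEmbOfFin J.2).toEmbedding := by
    rw [← Finset.coe_inj, Finset.coe_map, Finset.coe_univ, Set.image_univ]
    exact (Finset.range_orderEmbOfFin J.1 J.2).symm
  conv_rhs => rw [this]
  rw [Finset.sum_map]
  rfl

namespace Arrangement

variable {N : ℕ} {𝒞 : Arrangement N} {V : 𝒞.Vertex → Type u}

section Module

variable [∀ α, AddCommGroup (V α)] [∀ α, Module ℂ (V α)] {α : 𝒞.Vertex} {n : ℕ}

variable (V) in
/-- The coefficient of an element of the summand of the vertex `α` at an element of the basis of the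
exterior power and at a monomial. -/
def coeff (A : AdaptedBasis α.T) (J : Set.powersetCard (Fin N) n) (k : Fin N → ℕ) :
    α.Term V n →ₗ[ℂ] V α :=
  (TensorProduct.lid ℂ (V α)).toLinearMap ∘ₗ TensorProduct.map
    (LinearMap.mul' ℂ ℂ ∘ₗ TensorProduct.map (taylorCoeff k) ((A.wedgeBasis n).coord J))
    ((TensorProduct.lid ℂ (V α)).toLinearMap ∘ₗ LinearMap.rTensor (V α) A.evTop)

theorem coeff_pure (A : AdaptedBasis α.T) (J : Set.powersetCard (Fin N) n) (k : Fin N → ℕ)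
    (s : HolForm N) (x : ⋀[ℂ]^n α.TF) (w : α.TopForm) (v : V α) :
    coeff V A J k (Vertex.pure V s x (w ⊗ₜ v)) =
      (taylorCoeff k s * (A.wedgeBasis n).coord J x) • A.evTop w • v := rfl

variable (V) in
/-- A pure tensor as a linear function of its middle factor. -/
def pureMid (s : HolForm N) (y : α.TopForm ⊗[ℂ] V α) : ⋀[ℂ]^n α.TF →ₗ[ℂ] α.Term V n :=
  (TensorProduct.mk ℂ (HolForm N ⊗[ℂ] ⋀[ℂ]^n α.TF) (α.TopForm ⊗[ℂ] V α)).flip y ∘ₗ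
    TensorProduct.mk ℂ (HolForm N) (⋀[ℂ]^n α.TF) s

variable (V) in
/-- A pure tensor as a linear function of its last factor. -/
def pureRight (s : HolForm N) (x : ⋀[ℂ]^n α.TF) : α.TopForm ⊗[ℂ] V α →ₗ[ℂ] α.Term V n :=
  TensorProduct.mk ℂ (HolForm N ⊗[ℂ] ⋀[ℂ]^n α.TF) (α.TopForm ⊗[ℂ] V α) (s ⊗ₜ x)

variable (V) in
/-- A pure tensor as a linear function of its first factor. -/
def pureLeft (x : ⋀[ℂ]^n α.TF) (y : α.TopForm ⊗[ℂ] V α) : HolForm N →ₗ[ℂ] α.Term V n :=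
  (TensorProduct.mk ℂ (HolForm N ⊗[ℂ] ⋀[ℂ]^n α.TF) (α.TopForm ⊗[ℂ] V α)).flip y ∘ₗ
    (TensorProduct.mk ℂ (HolForm N) (⋀[ℂ]^n α.TF)).flip x

theorem pure_sum_mid {κ : Type*} (t : Finset κ) (s : HolForm N) (x : κ → ⋀[ℂ]^n α.TF)
    (y : α.TopForm ⊗[ℂ] V α) :
    Vertex.pure V s (∑ i ∈ t, x i) y = ∑ i ∈ t, Vertex.pure V s (x i) y :=
  map_sum (pureMid V s y) x t

theorem pure_smul_mid (r : ℂ) (s : HolForm N) (x : ⋀[ℂ]^n α.TF) (y : α.TopForm ⊗[ℂ] V α) :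
    Vertex.pure V s (r • x) y = r • Vertex.pure V s x y :=
  map_smul (pureMid V s y) r x

theorem pure_sum_right {κ : Type*} (t : Finset κ) (s : HolForm N) (x : ⋀[ℂ]^n α.TF)
    (y : κ → α.TopForm ⊗[ℂ] V α) :
    Vertex.pure V s x (∑ i ∈ t, y i) = ∑ i ∈ t, Vertex.pure V s x (y i) :=
  map_sum (pureRight V s x) y t

theorem pure_smul_right (r : ℂ) (s : HolForm N) (x : ⋀[ℂ]^n α.TF) (y : α.TopForm ⊗[ℂ] V α) :
    Vertex.pure V s x (r • y) = r • Vertex.pure V s x y :=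
  map_smul (pureRight V s x) r y

theorem pure_smul_left (r : ℂ) (s : HolForm N) (x : ⋀[ℂ]^n α.TF) (y : α.TopForm ⊗[ℂ] V α) :
    Vertex.pure V (r • s) x y = r • Vertex.pure V s x y :=
  map_smul (pureLeft V x y) r s

/-- Linear maps on the summand of a vertex are determined by their values on pure tensors with a basis
element in the middle. -/
theorem term_ext_basis (A : AdaptedBasis α.T) {W : Type*} [AddCommMonoid W] [Module ℂ W]
    {f g : α.Term V n →ₗ[ℂ] W}
    (h : ∀ s J w v, f (Vertex.pure V s (A.wedgeBasis n J) (w ⊗ₜ[ℂ] v)) =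
      g (Vertex.pure V s (A.wedgeBasis n J) (w ⊗ₜ[ℂ] v))) : f = g := by
  refine Vertex.term_ext fun s x w v => ?_
  have : f ∘ₗ pureMid V s (w ⊗ₜ v) = g ∘ₗ pureMid V s (w ⊗ₜ v) := (A.wedgeBasis n).ext fun J => h s J w v
  exact LinearMap.congr_fun this x

variable (V) in
/-- The component of an element of the summand of the vertex `α` at an element of the basis of the
exterior power and at a linear function on `V α`. -/
def component (A : AdaptedBasis α.T) (f : Module.Dual ℂ (V α)) (J : Set.powersetCard (Fin N) n) :
    α.Term V n →ₗ[ℂ] HolForm N :=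
  (TensorProduct.rid ℂ (HolForm N)).toLinearMap ∘ₗ TensorProduct.map
    ((TensorProduct.rid ℂ (HolForm N)).toLinearMap ∘ₗ LinearMap.lTensor (HolForm N) ((A.wedgeBasis n).coord J))
    (LinearMap.mul' ℂ ℂ ∘ₗ TensorProduct.map A.evTop f)

theorem component_pure (A : AdaptedBasis α.T) (f : Module.Dual ℂ (V α))
    (J : Set.powersetCard (Fin N) n) (s : HolForm N) (x : ⋀[ℂ]^n α.TF) (w : α.TopForm) (v : V α) :
    component V A f J (Vertex.pure V s x (w ⊗ₜ v)) =
      (A.evTop w * f v) • (A.wedgeBasis n).coord J x • s := rfl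

theorem taylorCoeff_component (A : AdaptedBasis α.T) (f : Module.Dual ℂ (V α))
    (J : Set.powersetCard (Fin N) n) (k : Fin N → ℕ) (z : α.Term V n) :
    taylorCoeff k (component V A f J z) = f (coeff V A J k z) := by
  suffices H : taylorCoeff k ∘ₗ component V A f J = f ∘ₗ coeff V A J k from
    LinearMap.congr_fun H z
  refine Vertex.term_ext fun s x w v => ?_
  rw [LinearMap.comp_apply, LinearMap.comp_apply, component_pure, coeff_pure]
  simp only [map_smul, smul_eq_mul]
  ring

variable (V) in
/-- The inclusion of the space of holomorphic forms for an element of the basis of the exterior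
power and an element of `V α`. -/
def inclusion (A : AdaptedBasis α.T) (v : V α) (J : Set.powersetCard (Fin N) n) :
    HolForm N →ₗ[ℂ] α.Term V n :=
  (TensorProduct.mk ℂ (HolForm N ⊗[ℂ] ⋀[ℂ]^n α.TF) (α.TopForm ⊗[ℂ] V α)).flip
      (A.topBasis.det ⊗ₜ v) ∘ₗ
    (TensorProduct.mk ℂ (HolForm N) (⋀[ℂ]^n α.TF)).flip (A.wedgeBasis n J)

theorem inclusion_apply (A : AdaptedBasis α.T) (v : V α) (J : Set.powersetCard (Fin N) n)
    (s : HolForm N) :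
    inclusion V A v J s = Vertex.pure V s (A.wedgeBasis n J) (A.topBasis.det ⊗ₜ v) := rfl

theorem sum_inclusion_component (A : AdaptedBasis α.T) {ι : Type*} [Fintype ι]
    (b : Module.Basis ι ℂ (V α)) (z : α.Term V n) :
    ∑ J, ∑ i, inclusion V A (b i) J (component V A (b.coord i) J z) = z := by
  suffices H : ∑ J, ∑ i, inclusion V A (b i) J ∘ₗ component V A (b.coord i) J =
      (LinearMap.id : α.Term V n →ₗ[ℂ] α.Term V n) by
    have h := LinearMap.congr_fun H z
    simp only [LinearMap.sum_apply, LinearMap.comp_apply] at h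
    exact h
  refine Vertex.term_ext fun s x w v => ?_
  simp only [LinearMap.sum_apply, LinearMap.comp_apply, component_pure, inclusion_apply,
    LinearMap.id_apply]
  have h1 : ∀ J i, Vertex.pure V ((A.evTop w * b.coord i v) • (A.wedgeBasis n).coord J x • s)
      (A.wedgeBasis n J) (A.topBasis.det ⊗ₜ b i) =
      Vertex.pure V s ((A.wedgeBasis n).coord J x • A.wedgeBasis n J)
        ((A.evTop w • A.topBasis.det) ⊗ₜ (b.coord i v • b i)) := by
    intro J i
    rw [pure_smul_left, pure_smul_left, pure_smul_mid, TensorProduct.tmul_smul,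
      ← TensorProduct.smul_tmul', pure_smul_right, pure_smul_right, smul_smul, smul_smul, smul_smul]
    congr 1
    ring
  rw [Finset.sum_congr rfl fun J _ => Finset.sum_congr rfl fun i _ => h1 J i]
  simp only [← pure_sum_right, ← TensorProduct.tmul_sum, ← pure_sum_mid, A.evTop_smul_det,
    Module.Basis.coord_apply, Module.Basis.sum_repr]

theorem coeff_inclusion (A : AdaptedBasis α.T) (v : V α) (J J' : Set.powersetCard (Fin N) n)
    (k : Fin N → ℕ) (s : HolForm N) :
    coeff V A J k (inclusion V A v J' s) = if J' = J then taylorCoeff k s • v else 0 := by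
  rw [inclusion_apply, coeff_pure, A.coord_wedgeBasis, A.evTop_det]
  split_ifs <;> simp

theorem eq_zero_of_coeff [FiniteDimensional ℂ (V α)] (A : AdaptedBasis α.T) (z : α.Term V n)
    (h : ∀ J k, coeff V A J k z = 0) : z = 0 := by
  rw [← sum_inclusion_component A (Module.finBasis ℂ (V α)) z]
  refine Finset.sum_eq_zero fun J _ => Finset.sum_eq_zero fun i _ => ?_
  rw [eq_zero_of_taylorCoeff (component V A _ J z)
    (fun k => by rw [taylorCoeff_component, h, map_zero]), map_zero]

end Module

variable [∀ α, NormedAddCommGroup (V α)] [∀ α, NormedSpace ℂ (V α)]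
  [∀ α, FiniteDimensional ℂ (V α)] {α : 𝒞.Vertex} {n : ℕ}

/-- The coefficients are Taylor coefficients of entire functions with values in `V α`. -/
theorem decay_coeff (A : AdaptedBasis α.T) (z : α.Term V n) (J : Set.powersetCard (Fin N) n) :
    Decay fun k => coeff V A J k z := by
  let b := Module.finBasis ℂ (V α)
  have h : (fun k => coeff V A J k z) = fun k =>
      ∑ i, LinearMap.toSpanSingleton ℂ (V α) (b i)
        (taylorCoeff k (component V A (b.coord i) J z)) := by
    funext k
    simp only [taylorCoeff_component, LinearMap.toSpanSingleton_apply, Module.Basis.coord_apply,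
      Module.Basis.sum_repr]
  rw [h]
  exact Decay.sum _ fun i _ => (decay_taylorCoeff _).map _

theorem exists_coeff_eq (A : AdaptedBasis α.T)
    {a : Set.powersetCard (Fin N) n → (Fin N → ℕ) → V α} (ha : ∀ J, Decay (a J)) :
    ∃ z : α.Term V n, ∀ J k, coeff V A J k z = a J k := by
  let b := Module.finBasis ℂ (V α)
  choose ω hω using fun J i => exists_taylorCoeff_eq ((ha J).map (b.coord i))
  refine ⟨∑ J, ∑ i, inclusion V A (b i) J (ω J i), fun J k => ?_⟩
  simp only [map_sum, coeff_inclusion]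
  rw [Finset.sum_eq_single J (fun J' _ hJ => by simp [hJ]) (by simp)]
  simp only [if_true, hω, Module.Basis.coord_apply, Module.Basis.sum_repr]

end Arrangement
/-! ### Homogeneous maps of exterior powers -/

section Homogeneous

variable {E E' E'' : Type*} [AddCommGroup E] [Module ℂ E] [AddCommGroup E'] [Module ℂ E']
  [AddCommGroup E''] [Module ℂ E''] {g : E →ₗ[ℂ] E} {g' : E' →ₗ[ℂ] E'} {g'' : E'' →ₗ[ℂ] E''}

/-- For spaces that are graded by the eigenvalues `2 ^ a` of endomorphisms `g` and `g'`, a linear map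
is homogeneous of degree `-d` if commuting it with the endomorphisms produces the factor `2 ^ d`. -/
def IsHomogeneous (g : E →ₗ[ℂ] E) (g' : E' →ₗ[ℂ] E') (Φ : E →ₗ[ℂ] E') (d : ℤ) : Prop :=
  ∀ x, Φ (g x) = (2 : ℂ) ^ d • g' (Φ x)

theorem IsHomogeneous.comp {Φ : E →ₗ[ℂ] E'} {Ψ : E' →ₗ[ℂ] E''} {d e : ℤ}
    (hΨ : IsHomogeneous g' g'' Ψ e) (hΦ : IsHomogeneous g g' Φ d) :
    IsHomogeneous g g'' (Ψ ∘ₗ Φ) (d + e) := by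
  intro x
  rw [LinearMap.comp_apply, LinearMap.comp_apply, hΦ x, map_smul, hΨ (Φ x), smul_smul,
    zpow_add₀ two_ne_zero]

theorem wedgeLeft_smul (r : ℂ) (m : E) (n : ℕ) : wedgeLeft (r • m) n = r • wedgeLeft m n := by
  simp only [wedgeLeft, map_smul]

theorem isHomogeneous_wedgeLeft {m : E} {d : ℤ} (h : g m = (2 : ℂ) ^ d • m) (n : ℕ) :
    IsHomogeneous (exteriorPower.map n g) (exteriorPower.map (n + 1) g) (wedgeLeft m n) (-d) := by
  intro x
  have h1 := LinearMap.congr_fun (map_wedgeLeft g m n) x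
  rw [LinearMap.comp_apply, LinearMap.comp_apply, h, wedgeLeft_smul, LinearMap.smul_apply] at h1
  rw [h1, smul_smul, ← zpow_add₀ two_ne_zero, neg_add_cancel, zpow_zero, one_smul]

theorem isHomogeneous_map_interior {p : Module.Dual ℂ E} {σ : E →ₗ[ℂ] E'} {d : ℤ}
    (hp : p ∘ₗ g = (2 : ℂ) ^ d • p) (hσ : σ ∘ₗ g = g' ∘ₗ σ) (n : ℕ) :
    IsHomogeneous (exteriorPower.map (n + 1) g) (exteriorPower.map n g')
      (exteriorPower.map n σ ∘ₗ interior p n) d := by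
  intro x
  have h1 := LinearMap.congr_fun (interior_map p g n) x
  rw [hp, LinearMap.comp_apply, LinearMap.comp_apply, QuiverDR.interior_smul, LinearMap.smul_apply,
    map_smul] at h1
  have h2 := LinearMap.congr_fun (exteriorPower.map_comp (n := n) g σ) (interior p n x)
  rw [hσ, exteriorPower.map_comp, LinearMap.comp_apply, LinearMap.comp_apply] at h2
  rw [LinearMap.comp_apply, LinearMap.comp_apply, h1, map_smul, h2]

variable {ι ι' : Type*} (b : Module.Basis ι ℂ E) (b' : Module.Basis ι' ℂ E')

/-- The matrix entries of a homogeneous map vanish unless the degrees match. -/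
theorem IsHomogeneous.coord_eq_zero {a : ι → ℤ} {a' : ι' → ℤ} (hb : ∀ i, g (b i) = (2 : ℂ) ^ a i • b i)
    (hb' : ∀ i, g' (b' i) = (2 : ℂ) ^ a' i • b' i) {Φ : E →ₗ[ℂ] E'} {d : ℤ}
    (hΦ : IsHomogeneous g g' Φ d) {i : ι} {i' : ι'} (h : a i ≠ d + a' i') :
    b'.coord i' (Φ (b i)) = 0 := by
  classical
  have hc : b'.coord i' ∘ₗ g' = (2 : ℂ) ^ a' i' • b'.coord i' := b'.ext fun j => by
    rw [LinearMap.comp_apply, hb', map_smul, LinearMap.smul_apply, Module.Basis.coord_apply,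
      Module.Basis.repr_self, Finsupp.single_apply]
    split_ifs with hj
    · rw [hj]
    · simp
  have hc' := LinearMap.congr_fun hc (Φ (b i))
  rw [LinearMap.comp_apply, LinearMap.smul_apply, smul_eq_mul] at hc'
  have h1 := congrArg (b'.coord i') (hΦ (b i))
  rw [hb, map_smul, map_smul, map_smul, hc', smul_eq_mul, smul_eq_mul, ← mul_assoc,
    ← zpow_add₀ two_ne_zero] at h1
  by_contra hne
  have h2 := congrArg norm (mul_right_cancel₀ hne h1)
  rw [norm_zpow, norm_zpow, Complex.norm_two] at h2
  exact h (zpow_right_injective₀ two_pos (by norm_num) h2)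

theorem prod_two_zpow {κ : Type*} (s : Finset κ) (d : κ → ℤ) :
    ∏ i ∈ s, (2 : ℂ) ^ d i = 2 ^ ∑ i ∈ s, d i := by
  classical
  induction s using Finset.induction_on with
  | empty => simp
  | insert i s hi ih => rw [Finset.prod_insert hi, Finset.sum_insert hi, ih, zpow_add₀ two_ne_zero]

theorem map_exteriorPower_basis {N : ℕ} (b : Module.Basis (Fin N) ℂ E) {a : Fin N → ℤ}
    (hb : ∀ i, g (b i) = (2 : ℂ) ^ a i • b i) (n : ℕ) (J : Set.powersetCard (Fin N) n) :
    exteriorPower.map n g (b.exteriorPower n J) =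
      (2 : ℂ) ^ (∑ j ∈ J.1, a j) • b.exteriorPower n J := by
  have h0 : b.exteriorPower n J = exteriorPower.ιMulti ℂ n (b ∘ J.1.orderEmbOfFin J.2) := by
    rw [exteriorPower.basis_apply]
    rfl
  have h : g ∘ b ∘ J.1.orderEmbOfFin J.2 = fun i =>
      (2 : ℂ) ^ a (J.1.orderEmbOfFin J.2 i) • (b ∘ J.1.orderEmbOfFin J.2) i :=
    funext fun i => hb _
  rw [h0, exteriorPower.map_apply_ιMulti, h, ← AlternatingMap.coe_multilinearMap,
    MultilinearMap.map_smul_univ, prod_two_zpow, sum_orderEmbOfFin J a]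

end Homogeneous

section Scaling

variable {N : ℕ} {T : Submodule ℂ (Pt N)}

/-- The scaling of `T ⊕ T^⊥` with the factor `2⁻¹` on vector fields and the factor `2` on
functions. -/
def scale (T : Submodule ℂ (Pt N)) : (T.prod T.dualAnnihilator) →ₗ[ℂ] (T.prod T.dualAnnihilator) :=
  (LinearMap.prodMap ((2 : ℂ)⁻¹ • LinearMap.id) ((2 : ℂ) • LinearMap.id)).restrict
    fun _ h => ⟨T.smul_mem _ h.1, T.dualAnnihilator.smul_mem _ h.2⟩

theorem coe_scale (t : T.prod T.dualAnnihilator) :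
    (scale T t).1 = ((2 : ℂ)⁻¹ • t.1.1, (2 : ℂ) • t.1.2) := rfl

namespace AdaptedBasis

variable (A : AdaptedBasis T)

/-- The degree of a basis element: `-1` for vector fields and `1` for functions. -/
def deg (j : Fin N) : ℤ := if j ∈ A.τ then -1 else 1

theorem scale_basis (j : Fin N) : scale T (A.basis j) = (2 : ℂ) ^ A.deg j • A.basis j := by
  refine Subtype.ext ?_
  rw [coe_scale, Submodule.coe_smul, deg]
  by_cases hj : j ∈ A.τ
  · rw [A.coe_basis_of_mem hj, if_pos hj, zpow_neg_one]
    simp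
  · rw [A.coe_basis_of_notMem hj, if_neg hj, zpow_one]
    simp

theorem sum_deg (J : Finset (Fin N)) : ∑ j ∈ J, A.deg j = A.weight J - A.τ.card := by
  have h := A.sum_sgn J
  have h' : ∀ j, A.sgn j = (A.deg j : ℂ) := by
    intro j
    simp only [sgn, deg]
    split_ifs <;> simp
  simp only [h'] at h
  have : ((∑ j ∈ J, A.deg j + A.τ.card : ℤ) : ℂ) = ((A.weight J : ℤ) : ℂ) := by
    push_cast
    exact h
  have := Int.cast_injective this
  omega

theorem map_scale_wedgeBasis (n : ℕ) (J : Set.powersetCard (Fin N) n) :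
    exteriorPower.map n (scale T) (A.wedgeBasis n J) =
      (2 : ℂ) ^ ((A.weight J.1 : ℤ) - A.τ.card) • A.wedgeBasis n J := by
  rw [map_exteriorPower_basis A.basis A.scale_basis, A.sum_deg]

/-- The coefficients of the multiplications with the standard coordinates in the operators `conj`. -/
def mulCoef (j l : Fin N) : ℂ := if j ∈ A.τ then - A.ε.coord j (stdBasis N l) else 0

/-- The coefficients of the partial derivatives in the operators `conj`. -/
def derCoef (j l : Fin N) : ℂ := if j ∈ A.τ then 0 else A.ε j l

theorem mulFun_eq_sum (g : Module.Dual ℂ (Pt N)) (ω : HolForm N) :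
    mulFun g ω = ∑ l, g (stdBasis N l) • coordMul l ω := by
  refine HolForm.ext_coeffAt fun z => ?_
  rw [coeffAt_mulFun, map_sum]
  conv_lhs => rw [eq_sum_stdBasis z]
  simp only [map_sum, map_smul, coordMul, coeffAt_mulFun, smul_eq_mul, LinearMap.proj_apply,
    Finset.sum_mul]
  refine Finset.sum_congr rfl fun l _ => ?_
  rw [← eq_sum_stdBasis z]
  ring

theorem dirDeriv_eq_sum (v : Pt N) (ω : HolForm N) :
    dirDeriv v ω = ∑ l, v l • partialD l ω := by
  conv_lhs => rw [eq_sum_stdBasis v]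
  simp only [map_sum, map_smul, LinearMap.sum_apply, LinearMap.smul_apply]
  rfl

theorem taylorCoeff_conj (j : Fin N) (k : Fin N → ℕ) (ω : HolForm N) :
    taylorCoeff k (A.conj j ω) = ∑ l, (A.mulCoef j l *
      (if k l = 0 then 0 else taylorCoeff (k - Pi.single l 1) ω) +
      A.derCoef j l * (((k l : ℂ) + 1) * taylorCoeff (k + Pi.single l 1) ω)) := by
  by_cases hj : j ∈ A.τ
  · simp only [conj, mulCoef, derCoef, hj, if_true, LinearMap.neg_apply, mulFun_eq_sum, map_neg,
      map_sum, map_smul, taylorCoeff_coordMul, smul_eq_mul, zero_mul, add_zero, neg_mul,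
      Finset.sum_neg_distrib]
  · simp only [conj, mulCoef, derCoef, hj, if_false, dirDeriv_eq_sum, map_sum, map_smul,
      taylorCoeff_partialD, smul_eq_mul, zero_mul, zero_add]

end AdaptedBasis

end Scaling

namespace Arrangement

variable {N : ℕ} {𝒞 : Arrangement N}

/-- Substitutions change the number of vector fields and functions in the same way as the dimension
of the stratum. -/
theorem EdgeFraming.isHomogeneous_substitution (φ : EdgeFraming 𝒞) {α β : 𝒞.Vertex}
    (h : α ≻ β ∨ β ≻ α) (n : ℕ) :
    IsHomogeneous (exteriorPower.map (n + 1) (scale α.T)) (exteriorPower.map n (scale β.T))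
      (φ.substitution h n) ((finrank ℂ β.T : ℤ) - finrank ℂ α.T) := by
  have h1 : ∃ d : ℤ, d = (finrank ℂ β.T : ℤ) - finrank ℂ α.T ∧
      φ.pairing α β ∘ₗ scale α.T = (2 : ℂ) ^ d • φ.pairing α β ∧
      φ.shift h ∘ₗ scale α.T = scale β.T ∘ₗ φ.shift h := by
    rcases h with h' | h'
    · refine ⟨-1, ?_, ?_, ?_⟩
      · have := h'.2
        omega
      · refine LinearMap.ext fun t => ?_
        rw [LinearMap.comp_apply, LinearMap.smul_apply, φ.pairing_down h', φ.pairing_down h',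
          coe_scale, map_smul, zpow_neg_one]
      · refine LinearMap.ext fun t => Subtype.ext (Prod.ext ?_ ?_)
        · rw [LinearMap.comp_apply, LinearMap.comp_apply, coe_scale, φ.shift_down_fst h',
            φ.shift_down_fst h', ← Submodule.coe_smul, ← map_smul]
          rfl
        · rw [LinearMap.comp_apply, LinearMap.comp_apply, coe_scale, φ.shift_down_snd h',
            φ.shift_down_snd h', coe_scale]
    · refine ⟨1, ?_, ?_, ?_⟩
      · have := h'.2
        omega
      · refine LinearMap.ext fun t => ?_
        rw [LinearMap.comp_apply, LinearMap.smul_apply, φ.pairing_up h', φ.pairing_up h',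
          coe_scale, zpow_one, LinearMap.smul_apply]
      · refine LinearMap.ext fun t => Subtype.ext (Prod.ext ?_ ?_)
        · rw [LinearMap.comp_apply, LinearMap.comp_apply, coe_scale, φ.shift_up_fst h',
            φ.shift_up_fst h', coe_scale]
        · rw [LinearMap.comp_apply, LinearMap.comp_apply, coe_scale, φ.shift_up_snd h',
            φ.shift_up_snd h', coe_scale, smul_sub, smul_smul, LinearMap.smul_apply, smul_eq_mul]
          congr 2
          ring
  obtain ⟨d, hd, h2, h3⟩ := h1
  rw [← hd]
  exact isHomogeneous_map_interior h2 h3 n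

end Arrangement
/-! ### The homotopy and its commutators with the edge maps -/

namespace Arrangement

variable {N : ℕ} {𝒞 : Arrangement N} {V : 𝒞.Vertex → Type u} [∀ α, AddCommGroup (V α)]
  [∀ α, Module ℂ (V α)] {α β : 𝒞.Vertex}

theorem rTensor_comp_add_comp {X Y₁ Y₂ W : Type*} [AddCommGroup X] [Module ℂ X] [AddCommGroup Y₁]
    [Module ℂ Y₁] [AddCommGroup Y₂] [Module ℂ Y₂] [AddCommGroup W] [Module ℂ W] {f : Y₁ →ₗ[ℂ] X}
    {g : X →ₗ[ℂ] Y₁} {f' : Y₂ →ₗ[ℂ] X} {g' : X →ₗ[ℂ] Y₂} {e : X →ₗ[ℂ] X}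
    (h : f ∘ₗ g + f' ∘ₗ g' = e) :
    LinearMap.rTensor W f ∘ₗ LinearMap.rTensor W g +
      LinearMap.rTensor W f' ∘ₗ LinearMap.rTensor W g' = LinearMap.rTensor W e := by
  rw [← h, LinearMap.rTensor_add, LinearMap.rTensor_comp, LinearMap.rTensor_comp]

section Homotopy

variable (A : AdaptedBasis α.T)

variable (V) in
/-- The homotopy of the Koszul complex of the vertex `α` given by the conjugate operators. -/
def homotopy (n : ℕ) : α.Term V n →ₗ[ℂ] α.Term V (n + 1) :=
  LinearMap.rTensor (α.TopForm ⊗[ℂ] V α) (koszulHomotopy A.conj A.basis n)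

theorem homotopy_pure (n : ℕ) (s : HolForm N) (x : ⋀[ℂ]^n α.TF) (y : α.TopForm ⊗[ℂ] V α) :
    homotopy V A n (Vertex.pure V s x y) =
      ∑ j, Vertex.pure V (A.conj j s) (wedgeLeft (A.basis j) n x) y := by
  change (koszulHomotopy A.conj A.basis n (s ⊗ₜ[ℂ] x)) ⊗ₜ[ℂ] y = _
  rw [koszulHomotopy, LinearMap.sum_apply, TensorProduct.sum_tmul]
  rfl

variable (V) in
/-- The Euler operator of the vertex `α`, which multiplies each coefficient with its total degree. -/
def euler (n : ℕ) : α.Term V n →ₗ[ℂ] α.Term V n :=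
  LinearMap.rTensor (α.TopForm ⊗[ℂ] V α)
    (TensorProduct.map (∑ j, α.act (A.basis j) ∘ₗ A.conj j) LinearMap.id +
      TensorProduct.map LinearMap.id (numberOp A.sgn A.basis n))

theorem euler_pure (n : ℕ) (s : HolForm N) (x : ⋀[ℂ]^n α.TF) (y : α.TopForm ⊗[ℂ] V α) :
    euler V A n (Vertex.pure V s x y) =
      Vertex.pure V (∑ l, coordMul l (partialD l s) + (A.τ.card : ℂ) • s) x y +
        Vertex.pure V s (numberOp A.sgn A.basis n x) y := by
  rw [← A.sum_rightAct_conj]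
  change ((∑ j, α.act (A.basis j) ∘ₗ A.conj j) s ⊗ₜ[ℂ] x +
    s ⊗ₜ[ℂ] numberOp A.sgn A.basis n x) ⊗ₜ[ℂ] y = _
  rw [TensorProduct.add_tmul, LinearMap.sum_apply]
  rfl

theorem koszulTerm_homotopy_zero :
    α.koszulTerm V 0 ∘ₗ homotopy V A 0 = euler V A 0 := by
  have h := koszul_homotopy_zero (M := α.TF) α.act A.conj A.basis
  rw [euler, ← h, numberOp, TensorProduct.map_zero_right, add_zero, LinearMap.rTensor_comp]
  rfl

theorem koszulTerm_homotopy_succ (n : ℕ) :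
    α.koszulTerm V (n + 1) ∘ₗ homotopy V A (n + 1) + homotopy V A n ∘ₗ α.koszulTerm V n =
      euler V A (n + 1) := by
  have h := koszul_homotopy_succ (M := α.TF) α.act A.conj A.sgn A.basis
    (fun i j x => A.conj_rightAct i j x) n
  exact rTensor_comp_add_comp h

/-- The Euler operator multiplies each coefficient with its total degree. -/
theorem coeff_euler {n : ℕ} (J : Set.powersetCard (Fin N) n) (k : Fin N → ℕ) (z : α.Term V n) :
    coeff V A J k (euler V A n z) = ((order k + A.weight J.1 : ℕ) : ℂ) • coeff V A J k z := by
  suffices H : coeff V A J k ∘ₗ euler V A n =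
      ((order k + A.weight J.1 : ℕ) : ℂ) • coeff V A J k from LinearMap.congr_fun H z
  refine term_ext_basis A fun s J' w v => ?_
  have h1 : numberOp A.sgn A.basis n (A.wedgeBasis n J') =
      (∑ j ∈ J'.1, A.sgn j) • A.wedgeBasis n J' := by
    rw [A.wedgeBasis_apply, numberOp_ιMulti, sum_orderEmbOfFin J' A.sgn]
  rw [LinearMap.comp_apply, LinearMap.smul_apply, euler_pure, h1, pure_smul_mid, map_add, map_smul,
    coeff_pure, coeff_pure, A.coord_wedgeBasis]
  by_cases hJ : J' = J
  · subst hJ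
    rw [if_pos rfl, map_add, taylorCoeff_euler, map_smul, Nat.cast_add, ← A.sum_sgn]
    simp only [smul_eq_mul, smul_smul, mul_one, ← add_smul]
    congr 1
    ring
  · simp [hJ]

end Homotopy

section Perturbation

variable (φ : EdgeFraming 𝒞) (𝒱 : Quiver 𝒞 V) (A : AdaptedBasis α.T) (B : AdaptedBasis β.T)

/-- Substitution followed by exterior multiplication by a basis element. -/
def substWedge (h : α ≻ β ∨ β ≻ α) (j : Fin N) : ∀ n, ⋀[ℂ]^n α.TF →ₗ[ℂ] ⋀[ℂ]^n β.TF
  | 0 => 0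
  | n + 1 => wedgeLeft (B.basis j) n ∘ₗ φ.substitution h n

/-- Exterior multiplication by a basis element followed by substitution. -/
def wedgeSubst (h : α ≻ β ∨ β ≻ α) (j : Fin N) (n : ℕ) : ⋀[ℂ]^n α.TF →ₗ[ℂ] ⋀[ℂ]^n β.TF :=
  φ.substitution h n ∘ₗ wedgeLeft (A.basis j) n

/-- Edge map followed by the homotopy. The edge map lowers the degree of the exterior power, so this is
zero on the exterior power of degree `0`. -/
def edgeHomotopy : ∀ n, α.Term V n →ₗ[ℂ] β.Term V n
  | 0 => 0
  | n + 1 => homotopy V B n ∘ₗ edgeMap φ 𝒱 α β n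

theorem edgeHomotopy_eq_zero (h : ¬ (α ≻ β ∨ β ≻ α)) (n : ℕ) (z : α.Term V n) :
    edgeHomotopy φ 𝒱 B n z = 0 := by
  cases n with
  | zero => rfl
  | succ n => rw [edgeHomotopy, edgeMap_eq_zero φ 𝒱 h, LinearMap.comp_zero, LinearMap.zero_apply]

theorem edgeHomotopy_pure (h : α ≻ β ∨ β ≻ α) (n : ℕ) (s : HolForm N) (x : ⋀[ℂ]^n α.TF)
    (w : α.TopForm) (v : V α) :
    edgeHomotopy φ 𝒱 B n (Vertex.pure V s x (w ⊗ₜ v)) =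
      ∑ j, Vertex.pure V (B.conj j s) (substWedge φ B h j n x) (φ.π h w ⊗ₜ 𝒱.A β α v) := by
  cases n with
  | zero =>
    simp only [edgeHomotopy, substWedge, LinearMap.zero_apply]
    exact (Finset.sum_eq_zero fun j _ => map_zero (pureMid V _ _)).symm
  | succ n =>
    rw [edgeHomotopy, LinearMap.comp_apply, edgeMap_pure φ 𝒱 h, homotopy_pure]
    rfl

theorem edgeMap_homotopy_pure (h : α ≻ β ∨ β ≻ α) (n : ℕ) (s : HolForm N) (x : ⋀[ℂ]^n α.TF)
    (w : α.TopForm) (v : V α) :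
    edgeMap φ 𝒱 α β n (homotopy V A n (Vertex.pure V s x (w ⊗ₜ v))) =
      ∑ j, Vertex.pure V (A.conj j s) (wedgeSubst φ A h j n x) (φ.π h w ⊗ₜ 𝒱.A β α v) := by
  rw [homotopy_pure, map_sum]
  exact Finset.sum_congr rfl fun j _ => edgeMap_pure φ 𝒱 h n _ _ w v

open Classical in
/-- The matrix entries of the multiplication operators in the commutator of the edge maps with the
homotopies. They do not depend on the quiver. -/
def mulEntry (n : ℕ) (l : Fin N) (J' J : Set.powersetCard (Fin N) n) : ℂ :=
  if h : α ≻ β ∨ β ≻ α then B.evTop (φ.π h A.topBasis.det) *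
    ∑ j, (B.mulCoef j l * (B.wedgeBasis n).coord J' (substWedge φ B h j n (A.wedgeBasis n J)) +
      A.mulCoef j l * (B.wedgeBasis n).coord J' (wedgeSubst φ A h j n (A.wedgeBasis n J)))
  else 0

open Classical in
/-- The matrix entries of the partial derivatives in the commutator of the edge maps with the
homotopies. They do not depend on the quiver. -/
def derEntry (n : ℕ) (l : Fin N) (J' J : Set.powersetCard (Fin N) n) : ℂ :=
  if h : α ≻ β ∨ β ≻ α then B.evTop (φ.π h A.topBasis.det) *
    ∑ j, (B.derCoef j l * (B.wedgeBasis n).coord J' (substWedge φ B h j n (A.wedgeBasis n J)) +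
      A.derCoef j l * (B.wedgeBasis n).coord J' (wedgeSubst φ A h j n (A.wedgeBasis n J)))
  else 0

/-- The total weight changes by the degree of the basis element alone: the changes made by the
substitution and by the shift with the dimension of the stratum cancel. -/
theorem coord_substWedge_eq_zero (h : α ≻ β ∨ β ≻ α) {n : ℕ} {j : Fin N}
    {J' J : Set.powersetCard (Fin N) n} (hd : (A.weight J.1 : ℤ) ≠ B.weight J'.1 - B.deg j) :
    (B.wedgeBasis n).coord J' (substWedge φ B h j n (A.wedgeBasis n J)) = 0 := by
  cases n with
  | zero => exact map_zero _
  | succ n =>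
    refine IsHomogeneous.coord_eq_zero _ _ (A.map_scale_wedgeBasis _) (B.map_scale_wedgeBasis _)
      ((isHomogeneous_wedgeLeft (B.scale_basis j) n).comp
        (φ.isHomogeneous_substitution h n)) (fun he => hd ?_)
    rw [A.card_eq, B.card_eq] at he
    omega

theorem coord_wedgeSubst_eq_zero (h : α ≻ β ∨ β ≻ α) {n : ℕ} {j : Fin N}
    {J' J : Set.powersetCard (Fin N) n} (hd : (A.weight J.1 : ℤ) ≠ B.weight J'.1 - A.deg j) :
    (B.wedgeBasis n).coord J' (wedgeSubst φ A h j n (A.wedgeBasis n J)) = 0 := by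
  refine IsHomogeneous.coord_eq_zero _ _ (A.map_scale_wedgeBasis _) (B.map_scale_wedgeBasis _)
    ((φ.isHomogeneous_substitution h n).comp
      (isHomogeneous_wedgeLeft (A.scale_basis j) n)) (fun he => hd ?_)
  rw [A.card_eq, B.card_eq] at he
  omega

theorem mulEntry_eq_zero {n : ℕ} (l : Fin N) {J' J : Set.powersetCard (Fin N) n}
    (hd : B.weight J'.1 + 1 ≠ A.weight J.1) : mulEntry φ A B n l J' J = 0 := by
  rw [mulEntry]
  split_ifs with h
  · rw [Finset.sum_eq_zero, mul_zero]
    intro j _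
    have h1 : B.mulCoef j l * (B.wedgeBasis n).coord J'
        (substWedge φ B h j n (A.wedgeBasis n J)) = 0 := by
      by_cases hj : j ∈ B.τ
      · rw [coord_substWedge_eq_zero φ A B h (by simp only [AdaptedBasis.deg, hj, if_true]; omega),
          mul_zero]
      · rw [AdaptedBasis.mulCoef, if_neg hj, zero_mul]
    have h2 : A.mulCoef j l * (B.wedgeBasis n).coord J'
        (wedgeSubst φ A h j n (A.wedgeBasis n J)) = 0 := by
      by_cases hj : j ∈ A.τ
      · rw [coord_wedgeSubst_eq_zero φ A B h (by simp only [AdaptedBasis.deg, hj, if_true]; omega),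
          mul_zero]
      · rw [AdaptedBasis.mulCoef, if_neg hj, zero_mul]
    rw [h1, h2, add_zero]
  · rfl

theorem derEntry_eq_zero {n : ℕ} (l : Fin N) {J' J : Set.powersetCard (Fin N) n}
    (hd : B.weight J'.1 ≠ A.weight J.1 + 1) : derEntry φ A B n l J' J = 0 := by
  rw [derEntry]
  split_ifs with h
  · rw [Finset.sum_eq_zero, mul_zero]
    intro j _
    have h1 : B.derCoef j l * (B.wedgeBasis n).coord J'
        (substWedge φ B h j n (A.wedgeBasis n J)) = 0 := by
      by_cases hj : j ∈ B.τ
      · rw [AdaptedBasis.derCoef, if_pos hj, zero_mul]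
      · rw [coord_substWedge_eq_zero φ A B h (by simp only [AdaptedBasis.deg, hj, if_false]; omega),
          mul_zero]
    have h2 : A.derCoef j l * (B.wedgeBasis n).coord J'
        (wedgeSubst φ A h j n (A.wedgeBasis n J)) = 0 := by
      by_cases hj : j ∈ A.τ
      · rw [AdaptedBasis.derCoef, if_pos hj, zero_mul]
      · rw [coord_wedgeSubst_eq_zero φ A B h (by simp only [AdaptedBasis.deg, hj, if_false]; omega),
          mul_zero]
    rw [h1, h2, add_zero]
  · rfl

theorem evTop_π (h : α ≻ β ∨ β ≻ α) (w : α.TopForm) :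
    B.evTop (φ.π h w) = B.evTop (φ.π h A.topBasis.det) * A.evTop w := by
  conv_lhs => rw [← A.evTop_smul_det w]
  rw [map_smul, map_smul, smul_eq_mul, mul_comm]

set_option maxHeartbeats 1000000 in
theorem coeff_edge_homotopy_pure (h : α ≻ β ∨ β ≻ α) {n : ℕ} (J' J : Set.powersetCard (Fin N) n)
    (k : Fin N → ℕ) (s : HolForm N) (w : α.TopForm) (v : V α) :
    coeff V B J' k (edgeHomotopy φ 𝒱 B n (Vertex.pure V s (A.wedgeBasis n J) (w ⊗ₜ v)) +
      edgeMap φ 𝒱 α β n (homotopy V A n (Vertex.pure V s (A.wedgeBasis n J) (w ⊗ₜ v)))) =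
      (∑ J₁, ∑ l, ((if k l = 0 then 0 else (mulEntry φ A B n l J' J₁ • 𝒱.A β α) ∘ₗ
            coeff V A J₁ (k - Pi.single l 1)) +
          ((k l : ℂ) + 1) • (derEntry φ A B n l J' J₁ • 𝒱.A β α) ∘ₗ
            coeff V A J₁ (k + Pi.single l 1)))
        (Vertex.pure V s (A.wedgeBasis n J) (w ⊗ₜ v)) := by
  rw [edgeHomotopy_pure _ _ _ h,
    edgeMap_homotopy_pure _ _ _ h, map_add, map_sum, map_sum]
  simp only [coeff_pure, LinearMap.sum_apply, AdaptedBasis.taylorCoeff_conj, evTop_π φ A B h w]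
  have hR : ∀ J₁ l, ((if k l = 0 then 0 else (mulEntry φ A B n l J' J₁ • 𝒱.A β α) ∘ₗ
          coeff V A J₁ (k - Pi.single l 1)) +
        ((k l : ℂ) + 1) • (derEntry φ A B n l J' J₁ • 𝒱.A β α) ∘ₗ
          coeff V A J₁ (k + Pi.single l 1)) (Vertex.pure V s (A.wedgeBasis n J) (w ⊗ₜ v)) =
      if J = J₁ then ((mulEntry φ A B n l J' J *
        (if k l = 0 then 0 else taylorCoeff (k - Pi.single l 1) s) +
          derEntry φ A B n l J' J * (((k l : ℂ) + 1) * taylorCoeff (k + Pi.single l 1) s)) *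
            A.evTop w) • 𝒱.A β α v else 0 := by
    intro J₁ l
    rw [LinearMap.add_apply, LinearMap.smul_apply, LinearMap.comp_apply, coeff_pure,
      A.coord_wedgeBasis]
    by_cases hJ : J = J₁
    · subst hJ
      by_cases hk : k l = 0
      · simp only [hk, if_true, LinearMap.zero_apply, LinearMap.smul_apply, map_smul, smul_smul]
        rw [zero_add]
        congr 1
        ring
      · simp only [hk, if_true, if_false, LinearMap.comp_apply, coeff_pure, A.coord_wedgeBasis,
          LinearMap.smul_apply, map_smul, smul_smul, ← add_smul]
        congr 1
        ring
    · by_cases hk : k l = 0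
      · simp [hJ, hk]
      · simp [hJ, hk, coeff_pure]
  simp only [hR]
  rw [Finset.sum_eq_single J (fun J₁ _ hJ => by simp [Ne.symm hJ]) (by simp)]
  simp only [if_true, mulEntry, derEntry, dif_pos h]
  simp only [smul_smul, ← Finset.sum_smul, ← add_smul]
  congr 1
  simp only [Finset.mul_sum, Finset.sum_mul, ← Finset.sum_add_distrib]
  rw [Finset.sum_comm]
  refine Finset.sum_congr rfl fun l _ => Finset.sum_congr rfl fun j _ => ?_
  ring

/-- The coefficients of the commutator of the edge maps with the homotopies. -/
theorem coeff_edge_homotopy {n : ℕ} (J' : Set.powersetCard (Fin N) n) (k : Fin N → ℕ)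
    (z : α.Term V n) :
    coeff V B J' k (edgeHomotopy φ 𝒱 B n z + edgeMap φ 𝒱 α β n (homotopy V A n z)) =
      ∑ J, ∑ l, ((if k l = 0 then 0 else (mulEntry φ A B n l J' J • 𝒱.A β α)
          (coeff V A J (k - Pi.single l 1) z)) +
        ((k l : ℂ) + 1) • (derEntry φ A B n l J' J • 𝒱.A β α)
          (coeff V A J (k + Pi.single l 1) z)) := by
  by_cases h : α ≻ β ∨ β ≻ α
  · suffices H : coeff V B J' k ∘ₗ (edgeHomotopy φ 𝒱 B n + edgeMap φ 𝒱 α β n ∘ₗ homotopy V A n) =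
        ∑ J, ∑ l, ((if k l = 0 then 0 else (mulEntry φ A B n l J' J • 𝒱.A β α) ∘ₗ
            coeff V A J (k - Pi.single l 1)) +
          ((k l : ℂ) + 1) • (derEntry φ A B n l J' J • 𝒱.A β α) ∘ₗ
            coeff V A J (k + Pi.single l 1)) by
      have H' := LinearMap.congr_fun H z
      simp only [LinearMap.sum_apply, LinearMap.comp_apply, LinearMap.add_apply] at H'
      rw [H']
      refine Finset.sum_congr rfl fun J _ => Finset.sum_congr rfl fun l _ => ?_
      split_ifs <;> rfl
    exact term_ext_basis A fun s J w v => coeff_edge_homotopy_pure φ 𝒱 A B h J' J k s w v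
  · have e1 : edgeHomotopy φ 𝒱 B n z = 0 := edgeHomotopy_eq_zero φ 𝒱 B h n z
    have e2 : edgeMap φ 𝒱 α β n (homotopy V A n z) = 0 :=
      LinearMap.congr_fun (edgeMap_eq_zero φ 𝒱 h n) _
    have h1 : ∀ l J, mulEntry φ A B n l J' J = 0 := fun l J => dif_neg h
    have h2 : ∀ l J, derEntry φ A B n l J' J = 0 := fun l J => dif_neg h
    rw [e1, e2, add_zero, map_zero]
    refine (Finset.sum_eq_zero fun J _ => Finset.sum_eq_zero fun l _ => ?_).symm
    rw [h1, h2, zero_smul, LinearMap.zero_apply, LinearMap.zero_apply, smul_zero, add_zero, ite_self]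

end Perturbation

end Arrangement
/-! ### The anticommutator of the differential with the homotopy -/

namespace Arrangement

variable {N : ℕ} {𝒞 : Arrangement N} {V : 𝒞.Vertex → Type u}

section Laplacian

variable [∀ α, AddCommGroup (V α)] [∀ α, Module ℂ (V α)]
  (φ : EdgeFraming 𝒞) (𝒱 : Quiver 𝒞 V) (A : ∀ α : 𝒞.Vertex, AdaptedBasis α.T)

variable (V) in
/-- The sum of the homotopies of all vertices. -/
def totalHomotopy (n : ℕ) : DRTerm V n →ₗ[ℂ] DRTerm V (n + 1) :=
  LinearMap.pi fun α => homotopy V (A α) n ∘ₗ LinearMap.proj α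

theorem totalHomotopy_apply (n : ℕ) (z : DRTerm V n) (α : 𝒞.Vertex) :
    totalHomotopy V A n z α = homotopy V (A α) n (z α) := rfl

theorem dDR_apply (n : ℕ) (z : DRTerm V (n + 1)) (β : 𝒞.Vertex) :
    dDR φ 𝒱 n z β = β.koszulTerm V n (z β) - ∑ α, edgeMap φ 𝒱 α β n (z α) := by
  simp only [dDR, d₁, d₀, LinearMap.sub_apply, Pi.sub_apply, LinearMap.pi_apply,
    LinearMap.comp_apply, LinearMap.proj_apply, LinearMap.sum_apply]

/-- The anticommutator of the differential with the homotopy. -/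
def laplacian : ∀ n, DRTerm V n →ₗ[ℂ] DRTerm V n
  | 0 => dDR φ 𝒱 0 ∘ₗ totalHomotopy V A 0
  | n + 1 => dDR φ 𝒱 (n + 1) ∘ₗ totalHomotopy V A (n + 1) + totalHomotopy V A n ∘ₗ dDR φ 𝒱 n

theorem laplacian_apply (n : ℕ) (z : DRTerm V n) (β : 𝒞.Vertex) :
    laplacian φ 𝒱 A n z β = euler V (A β) n (z β) -
      ∑ α, (edgeHomotopy φ 𝒱 (A β) n (z α) + edgeMap φ 𝒱 α β n (homotopy V (A α) n (z α))) := by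
  cases n with
  | zero =>
    have h := LinearMap.congr_fun (koszulTerm_homotopy_zero (V := V) (A β)) (z β)
    rw [laplacian, LinearMap.comp_apply, dDR_apply, ← h]
    congr 1
    refine Finset.sum_congr rfl fun α _ => ?_
    exact (zero_add _).symm
  | succ n =>
    have h := LinearMap.congr_fun (koszulTerm_homotopy_succ (V := V) (A β) n) (z β)
    rw [laplacian, LinearMap.add_apply, Pi.add_apply, LinearMap.comp_apply, LinearMap.comp_apply,
      dDR_apply, ← h, totalHomotopy_apply, totalHomotopy_apply, dDR_apply, map_sub, map_sum,
      Finset.sum_add_distrib, LinearMap.add_apply, LinearMap.comp_apply, LinearMap.comp_apply]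
    simp only [edgeHomotopy, LinearMap.comp_apply, totalHomotopy_apply]
    abel

/-- The anticommutator is a morphism of complexes. -/
theorem laplacian_dDR (n : ℕ) (z : DRTerm V (n + 1)) :
    laplacian φ 𝒱 A n (dDR φ 𝒱 n z) = dDR φ 𝒱 n (laplacian φ 𝒱 A (n + 1) z) := by
  have hd : ∀ n (y : DRTerm V (n + 1 + 1)), dDR φ 𝒱 n (dDR φ 𝒱 (n + 1) y) = 0 := fun n y =>
    LinearMap.congr_fun (dDR_comp_dDR φ 𝒱 n) y
  cases n with
  | zero =>
    rw [laplacian, laplacian, LinearMap.comp_apply, LinearMap.add_apply, LinearMap.comp_apply,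
      LinearMap.comp_apply, map_add, hd]
    exact (zero_add _).symm
  | succ n =>
    rw [laplacian, laplacian, LinearMap.add_apply, LinearMap.add_apply, LinearMap.comp_apply,
      LinearMap.comp_apply, LinearMap.comp_apply, LinearMap.comp_apply, map_add, hd, hd, map_zero,
      zero_add, add_zero]

/-- The pairs of a vertex and an element of the basis of the exterior power. -/
abbrev BasisIndex (𝒞 : Arrangement N) (n : ℕ) : Type := Σ _ : 𝒞.Vertex, Set.powersetCard (Fin N) n

/-- The weight of the pair of a vertex and an element of the basis of the exterior power. -/
def indexWeight (n : ℕ) (i : BasisIndex 𝒞 n) : ℕ := (A i.1).weight i.2.1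

/-- The coefficients of the multiplications with coordinates in the perturbation of the Euler
operator. -/
def mulPart (n : ℕ) (l : Fin N) (i j : BasisIndex 𝒞 n) : V j.1 →ₗ[ℂ] V i.1 :=
  mulEntry φ (A j.1) (A i.1) n l i.2 j.2 • 𝒱.A i.1 j.1

/-- The coefficients of the partial derivatives in the perturbation of the Euler operator. -/
def derPart (n : ℕ) (l : Fin N) (i j : BasisIndex 𝒞 n) : V j.1 →ₗ[ℂ] V i.1 :=
  derEntry φ (A j.1) (A i.1) n l i.2 j.2 • 𝒱.A i.1 j.1

/-- All coefficients of an element of a term of the de Rham complex. -/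
def coeffs (n : ℕ) (z : DRTerm V n) (i : BasisIndex 𝒞 n) (k : Fin N → ℕ) : V i.1 :=
  coeff V (A i.1) i.2 k (z i.1)

end Laplacian

variable [∀ α, NormedAddCommGroup (V α)] [∀ α, NormedSpace ℂ (V α)]
  (φ : EdgeFraming 𝒞) (𝒱 : Quiver 𝒞 V) (A : ∀ α : 𝒞.Vertex, AdaptedBasis α.T)

/-- In terms of the coefficients, the anticommutator of the differential with the homotopy is the
total degree minus an operator of the form `∑ (x_l ⊗ Q_l + ∂_l ⊗ R_l)`. -/
theorem coeffs_laplacian (n : ℕ) (z : DRTerm V n) (i : BasisIndex 𝒞 n) (k : Fin N → ℕ) :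
    coeffs A n (laplacian φ 𝒱 A n z) i k =
      ((order k + indexWeight A n i : ℕ) : ℂ) • coeffs A n z i k -
        ladder (mulPart φ 𝒱 A n) (derPart φ 𝒱 A n) (coeffs A n z) i k := by
  have h : ladder (mulPart φ 𝒱 A n) (derPart φ 𝒱 A n) (coeffs A n z) i k =
      ∑ j : BasisIndex 𝒞 n, ∑ l, ((if k l = 0 then 0 else
        mulPart φ 𝒱 A n l i j (coeffs A n z j (k - Pi.single l 1))) +
        ((k l : ℂ) + 1) • derPart φ 𝒱 A n l i j (coeffs A n z j (k + Pi.single l 1))) := rfl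
  rw [h, Fintype.sum_sigma, coeffs, laplacian_apply, map_sub, coeff_euler, map_sum]
  congr 1
  refine Finset.sum_congr rfl fun α _ => ?_
  rw [coeff_edge_homotopy]
  rfl

/-- The bound on the maps of the quiver in a fixed degree of the complex. -/
theorem exists_ladderBound_of_level (n : ℕ) : ∃ ε : ℝ, 0 < ε ∧
    ∀ (V : 𝒞.Vertex → Type u) [∀ α, NormedAddCommGroup (V α)] [∀ α, NormedSpace ℂ (V α)]
      (𝒱 : 𝒞.Quiver V), (∀ (α β : 𝒞.Vertex) (v : V β), ‖𝒱.A α β v‖ ≤ ε * ‖v‖) →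
      ∃ δ, LadderBound (indexWeight A n) δ (mulPart φ 𝒱 A n) (derPart φ 𝒱 A n) := by
  -- a common bound for the matrix entries, which do not depend on the quiver
  let q : Fin N × BasisIndex 𝒞 n × BasisIndex 𝒞 n → ℝ := fun x =>
    ‖mulEntry φ (A x.2.2.1) (A x.2.1.1) n x.1 x.2.1.2 x.2.2.2‖
  let r : Fin N × BasisIndex 𝒞 n × BasisIndex 𝒞 n → ℝ := fun x =>
    ‖derEntry φ (A x.2.2.1) (A x.2.1.1) n x.1 x.2.1.2 x.2.2.2‖
  have hq0 : ∀ x, 0 ≤ q x := fun x => norm_nonneg _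
  have hr0 : ∀ x, 0 ≤ r x := fun x => norm_nonneg _
  let C : ℝ := ∑ x, (q x + r x)
  have hC : 0 ≤ C := Finset.sum_nonneg fun x _ => add_nonneg (hq0 x) (hr0 x)
  have hCq : ∀ x, q x ≤ C := fun x =>
    (le_add_of_nonneg_right (hr0 x)).trans (Finset.single_le_sum (f := fun x => q x + r x)
      (fun x _ => add_nonneg (hq0 x) (hr0 x)) (Finset.mem_univ x))
  have hCr : ∀ x, r x ≤ C := fun x =>
    (le_add_of_nonneg_left (hq0 x)).trans (Finset.single_le_sum (f := fun x => q x + r x)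
      (fun x _ => add_nonneg (hq0 x) (hr0 x)) (Finset.mem_univ x))
  let K : ℝ := 4 * (Fintype.card (BasisIndex 𝒞 n) * N)
  have hK : 0 ≤ K := by positivity
  have hpos : 0 < K * C + 1 := by positivity
  refine ⟨(K * C + 1)⁻¹, inv_pos.mpr hpos, fun V _ _ 𝒱 hA => ⟨C * (K * C + 1)⁻¹, ?_⟩⟩
  have hA' : ∀ (c : ℂ) (α β : 𝒞.Vertex) (v : V β), ‖c‖ ≤ C →
      ‖(c • 𝒱.A α β) v‖ ≤ C * (K * C + 1)⁻¹ * ‖v‖ := by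
    intro c α β v hc
    rw [LinearMap.smul_apply, norm_smul, mul_assoc]
    exact mul_le_mul hc (hA α β v) (norm_nonneg _) hC
  exact
    { nonneg := by positivity
      Q_le := fun l i j v => hA' _ _ _ v (hCq (l, i, j))
      R_le := fun l i j v => hA' _ _ _ v (hCr (l, i, j))
      Q_eq_zero := fun l i j h => by
        rw [mulPart, mulEntry_eq_zero φ (A j.1) (A i.1) l h, zero_smul]
      R_eq_zero := fun l i j h => by
        rw [derPart, derEntry_eq_zero φ (A j.1) (A i.1) l h, zero_smul]
      small := by
        change K * (C * (K * C + 1)⁻¹) ≤ 1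
        rw [← mul_assoc, mul_inv_le_iff₀ hpos]
        linarith }

/-- Above degree `N` there are no exterior products, hence finitely many conditions on the norms of
the maps of the quiver suffice in all degrees. -/
theorem exists_ladderBound : ∃ ε : ℝ, 0 < ε ∧
    ∀ (V : 𝒞.Vertex → Type u) [∀ α, NormedAddCommGroup (V α)] [∀ α, NormedSpace ℂ (V α)]
      (𝒱 : 𝒞.Quiver V), (∀ (α β : 𝒞.Vertex) (v : V β), ‖𝒱.A α β v‖ ≤ ε * ‖v‖) →
      ∀ n, ∃ δ, LadderBound (indexWeight A n) δ (mulPart φ 𝒱 A n) (derPart φ 𝒱 A n) := by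
  choose ε hε h using fun n => exists_ladderBound_of_level.{u} φ A n
  obtain ⟨m, -, hm⟩ := Finset.exists_min_image (Finset.range (N + 1)) ε ⟨0, by simp⟩
  refine ⟨ε m, hε m, fun V _ _ 𝒱 hA n => ?_⟩
  by_cases hn : n < N + 1
  · exact h n V 𝒱 fun α β v => (hA α β v).trans
      (mul_le_mul_of_nonneg_right (hm n (Finset.mem_range.mpr hn)) (norm_nonneg _))
  · have : IsEmpty (BasisIndex 𝒞 n) := ⟨fun i => by
      have h1 := Finset.card_le_univ i.2.1
      have h2 : i.2.1.card = n := i.2.2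
      rw [Fintype.card_fin] at h1
      omega⟩
    exact ⟨0, le_rfl, fun _ i => isEmptyElim i, fun _ i => isEmptyElim i, fun _ i => isEmptyElim i,
      fun _ i => isEmptyElim i, by simp⟩

end Arrangement
/-! ### The component of total degree zero -/

section Pullback

variable {N : ℕ} {T : Submodule ℂ (Pt N)}

/-- The projection of `T ⊕ T^⊥` onto `T`. -/
def vectorPart (T : Submodule ℂ (Pt N)) : (T.prod T.dualAnnihilator) →ₗ[ℂ] T :=
  LinearMap.codRestrict T (LinearMap.fst ℂ _ _ ∘ₗ (T.prod T.dualAnnihilator).subtype)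
    fun t => t.2.1

theorem coe_vectorPart (t : T.prod T.dualAnnihilator) : (vectorPart T t : Pt N) = t.1.1 := rfl

/-- A top form on `T` as a linear function on the exterior power of `T ⊕ T^⊥`. -/
def pullForm {n : ℕ} (h : finrank ℂ T = n) (w : T [⋀^Fin (finrank ℂ T)]→ₗ[ℂ] ℂ) :
    ⋀[ℂ]^n (T.prod T.dualAnnihilator) →ₗ[ℂ] ℂ :=
  exteriorPower.alternatingMapLinearEquiv
    ((w.domDomCongr (finCongr h)).compLinearMap (vectorPart T))

theorem pullForm_ιMulti {n : ℕ} (h : finrank ℂ T = n) (w : T [⋀^Fin (finrank ℂ T)]→ₗ[ℂ] ℂ)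
    (t : Fin n → T.prod T.dualAnnihilator) :
    pullForm h w (exteriorPower.ιMulti ℂ n t) =
      w.domDomCongr (finCongr h) fun i => vectorPart T (t i) := by
  rw [pullForm, exteriorPower.alternatingMapLinearEquiv_apply_ιMulti]
  rfl

theorem pullForm_wedgeLeft {n : ℕ} (h : finrank ℂ T = n + 1)
    (w : T [⋀^Fin (finrank ℂ T)]→ₗ[ℂ] ℂ) {m : T.prod T.dualAnnihilator} (hm : m.1.1 = 0)
    (x : ⋀[ℂ]^n (T.prod T.dualAnnihilator)) : pullForm h w (wedgeLeft m n x) = 0 := by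
  suffices H : pullForm h w ∘ₗ wedgeLeft m n = 0 from LinearMap.congr_fun H x
  refine exteriorPower.linearMap_ext ?_
  ext1 t
  simp only [LinearMap.compAlternatingMap_apply, LinearMap.comp_apply, wedgeLeft_ιMulti,
    pullForm_ιMulti]
  exact AlternatingMap.map_coord_zero _ 0 (Subtype.ext hm)

namespace AdaptedBasis

variable (A : AdaptedBasis T)

/-- The set of the indices of the basis vectors in `T`, as an index of the basis of the exterior
power. -/
def topIndex {n : ℕ} (h : finrank ℂ T = n) : Set.powersetCard (Fin N) n :=
  ⟨A.τ, A.card_eq.trans h⟩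

theorem coord_topIndex_mul {n : ℕ} (h : finrank ℂ T = n) (w : T [⋀^Fin (finrank ℂ T)]→ₗ[ℂ] ℂ)
    (x : ⋀[ℂ]^n (T.prod T.dualAnnihilator)) :
    (A.wedgeBasis n).coord (A.topIndex h) x * A.evTop w = pullForm h w x := by
  subst h
  suffices H : A.evTop w • (A.wedgeBasis _).coord (A.topIndex rfl) = pullForm rfl w by
    rw [← H, LinearMap.smul_apply, smul_eq_mul, mul_comm]
  refine (A.wedgeBasis _).ext fun J => ?_
  rw [LinearMap.smul_apply, A.coord_wedgeBasis, A.wedgeBasis_apply, pullForm_ιMulti]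
  by_cases hJ : J = A.topIndex rfl
  · rw [if_pos hJ, smul_eq_mul, mul_one, hJ]
    have : (fun i => vectorPart T ((A.basis ∘ (A.topIndex rfl).1.orderEmbOfFin
        (A.topIndex rfl).2) i)) = A.topBasis := by
      rw [A.coe_topBasis]
      funext i
      refine Subtype.ext ?_
      exact congrArg Prod.fst (A.coe_basis_of_mem (Finset.orderEmbOfFin_mem A.τ A.card_eq i))
    rw [this]
    rfl
  · rw [if_neg hJ, smul_zero]
    have : ∃ j ∈ J.1, j ∉ A.τ := by
      by_contra! hc
      exact hJ (Subtype.ext (Finset.eq_of_subset_of_card_le hc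
        (A.card_eq.trans (Eq.symm J.2)).le))
    obtain ⟨j, hj, hj'⟩ := this
    rw [← Finset.mem_coe, ← Finset.range_orderEmbOfFin J.1 J.2] at hj
    obtain ⟨i, rfl⟩ := hj
    refine (AlternatingMap.map_coord_zero _ i (Subtype.ext ?_)).symm
    rw [coe_vectorPart, Function.comp_apply, A.coe_basis_of_notMem hj']
    rfl

end AdaptedBasis

end Pullback

namespace Arrangement

variable {N : ℕ} {𝒞 : Arrangement N} {V : 𝒞.Vertex → Type u}
variable [∀ α, AddCommGroup (V α)] [∀ α, Module ℂ (V α)] {α β : 𝒞.Vertex} {n : ℕ}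

theorem term_ext_ιMulti {W : Type*} [AddCommGroup W] [Module ℂ W] {f g : α.Term V n →ₗ[ℂ] W}
    (h : ∀ s t w v, f (Vertex.pure V s (exteriorPower.ιMulti ℂ n t) (w ⊗ₜ[ℂ] v)) =
      g (Vertex.pure V s (exteriorPower.ιMulti ℂ n t) (w ⊗ₜ[ℂ] v))) : f = g := by
  refine Vertex.term_ext fun s x w v => ?_
  have : f ∘ₗ pureMid (n := n) V s (w ⊗ₜ v) = g ∘ₗ pureMid V s (w ⊗ₜ v) := by
    refine exteriorPower.linearMap_ext ?_
    ext1 t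
    exact h s t w v
  exact LinearMap.congr_fun this x

variable (V) in
/-- The projection of the summand of the vertex `α` in degree `dim α` onto `V α`: the coefficient of
total degree zero. -/
def bottom (A : AdaptedBasis α.T) (h : finrank ℂ α.T = n) : α.Term V n →ₗ[ℂ] V α :=
  coeff V A (A.topIndex h) 0

variable (A : AdaptedBasis α.T) (B : AdaptedBasis β.T)

theorem bottom_pure (h : finrank ℂ α.T = n) (s : HolForm N) (x : ⋀[ℂ]^n α.TF) (w : α.TopForm)
    (v : V α) :
    bottom V A h (Vertex.pure V s x (w ⊗ₜ v)) = (s.coeffAt 0 * pullForm h w x) • v := by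
  rw [bottom, coeff_pure, smul_smul, mul_assoc, A.coord_topIndex_mul, taylorCoeff_zero]

theorem bottom_homotopy (h : finrank ℂ α.T = n + 1) (z : α.Term V n) :
    bottom V A h (homotopy V A n z) = 0 := by
  suffices H : bottom V A h ∘ₗ homotopy V A n = 0 from LinearMap.congr_fun H z
  refine Vertex.term_ext fun s x w v => ?_
  rw [LinearMap.comp_apply, homotopy_pure, map_sum, LinearMap.zero_apply]
  refine Finset.sum_eq_zero fun j _ => ?_
  rw [bottom_pure]
  by_cases hj : j ∈ A.τ
  · rw [AdaptedBasis.conj, if_pos hj, LinearMap.neg_apply, map_neg, coeffAt_mulFun, map_zero,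
      zero_mul, neg_zero, zero_mul, zero_smul]
  · rw [pullForm_wedgeLeft h w (by rw [A.coe_basis_of_notMem hj]), mul_zero, zero_smul]

theorem koszulTerm_pure (s : HolForm N) (t : Fin (n + 1) → α.TF) (y : α.TopForm ⊗[ℂ] V α) :
    α.koszulTerm V n (Vertex.pure V s (exteriorPower.ιMulti ℂ (n + 1) t) y) =
      ∑ i : Fin (n + 1), (-1 : ℂ) ^ (i : ℕ) •
        Vertex.pure V (α.act (t i) s) (exteriorPower.ιMulti ℂ n (i.removeNth t)) y := by
  let L : HolForm N ⊗[ℂ] ⋀[ℂ]^n α.TF →ₗ[ℂ] α.Term V n :=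
    (TensorProduct.mk ℂ (HolForm N ⊗[ℂ] ⋀[ℂ]^n α.TF) (α.TopForm ⊗[ℂ] V α)).flip y
  refine (congrArg L (koszul_tmul (M := α.TF) α.act n s t)).trans ((map_sum L _ _).trans ?_)
  exact Finset.sum_congr rfl fun i _ => map_smul L _ _

theorem linearDependent_of_finrank_lt {T : Submodule ℂ (Pt N)} {m : ℕ} (h : finrank ℂ T < m)
    (u : Fin m → T) : ¬ LinearIndependent ℂ u := fun hu => by
  have := hu.fintype_card_le_finrank
  rw [Fintype.card_fin] at this
  omega

/-- The component of total degree zero of the Koszul differential vanishes: functions vanish at the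
origin, and the terms with derivatives form an alternating form whose degree exceeds the dimension. -/
theorem bottom_koszulTerm (h : finrank ℂ α.T = n) (z : α.Term V (n + 1)) :
    bottom V A h (α.koszulTerm V n z) = 0 := by
  suffices H : bottom V A h ∘ₗ α.koszulTerm V n = 0 from LinearMap.congr_fun H z
  refine term_ext_ιMulti fun s t w v => ?_
  rw [LinearMap.comp_apply, koszulTerm_pure, map_sum, LinearMap.zero_apply]
  simp only [map_smul, bottom_pure, pullForm_ιMulti]
  -- an alternating form whose degree exceeds the dimension
  let D : α.T →ₗ[ℂ] ℂ := HolForm.coeffAt 0 ∘ₗ negLie.flip s ∘ₗ α.T.subtype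
  have h0 : AlternatingMap.alternatizeUncurryFin (D.smulRight (w.domDomCongr (finCongr h)))
      (fun i => vectorPart α.T (t i)) = 0 :=
    AlternatingMap.map_linearDependent _ _
      (linearDependent_of_finrank_lt (by omega) fun i => vectorPart α.T (t i))
  have h1 : ∀ i, HolForm.coeffAt 0 (α.act (t i) s) = D (vectorPart α.T (t i)) := by
    intro i
    have : α.act (t i) s = negLie (t i).1.1 s + mulFun (t i).1.2 s := rfl
    rw [this, map_add, coeffAt_mulFun, map_zero, zero_mul, add_zero]
    rfl
  rw [AlternatingMap.alternatizeUncurryFin_apply] at h0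
  simp only [smul_smul, ← Finset.sum_smul]
  rw [← zero_smul ℂ v, ← h0]
  congr 1
  refine Finset.sum_congr rfl fun i _ => ?_
  rw [← Int.cast_smul_eq_zsmul ℂ, h1]
  simp only [Int.cast_pow, Int.cast_neg, Int.cast_one, smul_eq_mul, LinearMap.smulRight_apply,
    AlternatingMap.smul_apply]
  rfl

variable (φ : EdgeFraming 𝒞) (𝒱 : Quiver 𝒞 V)

theorem substitution_ιMulti_eq_sum (h : α ≻ β ∨ β ≻ α) (t : Fin (n + 1) → α.TF) :
    φ.substitution h n (exteriorPower.ιMulti ℂ (n + 1) t) =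
      ∑ i : Fin (n + 1), (-1 : ℂ) ^ (i : ℕ) • φ.pairing α β (t i) •
        exteriorPower.ιMulti ℂ n fun j => φ.shift h (i.removeNth t j) := by
  rw [EdgeFraming.substitution, LinearMap.comp_apply, interior_ιMulti, map_sum]
  refine Finset.sum_congr rfl fun i _ => ?_
  rw [map_smul, map_smul, exteriorPower.map_apply_ιMulti]
  rfl

theorem bottom_edgeMap_pure (h : α ≻ β ∨ β ≻ α) (hβ : finrank ℂ β.T = n) (s : HolForm N)
    (t : Fin (n + 1) → α.TF) (w : α.TopForm) (v : V α) :
    bottom V B hβ (edgeMap φ 𝒱 α β n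
      (Vertex.pure V s (exteriorPower.ιMulti ℂ (n + 1) t) (w ⊗ₜ v))) =
      (s.coeffAt 0 * ∑ i : Fin (n + 1), (-1 : ℂ) ^ (i : ℕ) * (φ.pairing α β (t i) *
        (φ.π h w).domDomCongr (finCongr hβ)
          fun j => vectorPart β.T (φ.shift h (i.removeNth t j)))) • 𝒱.A β α v := by
  rw [edgeMap_pure φ 𝒱 h, bottom_pure, substitution_ιMulti_eq_sum, map_sum]
  simp only [map_smul, smul_eq_mul, pullForm_ιMulti]

/-- The defining relation `df ∧ π ω = ω`, evaluated at vectors. -/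
theorem sum_piDown (h : α ≻ β) {a b : ℕ} (hab : a = b + 1) (ha : finrank ℂ α.T = a) (w : α.Form a)
    (u : Fin (b + 1) → α.T) :
    ∑ i : Fin (b + 1), (-1 : ℂ) ^ (i : ℕ) * (φ.f α β (u i) *
      φ.piDown h hab w fun j => φ.proj h (i.removeNth u j)) =
      w.domDomCongr (finCongr hab) u := by
  subst hab
  have h1 := φ.wedge_apply h (φ.piDown h rfl w) u
  rw [φ.wedge_piDown h ha] at h1
  refine Eq.trans ?_ h1.symm
  refine Finset.sum_congr rfl fun i _ => ?_
  ring

/-- For `α ≻ β`, the edge map is compatible with the projections. -/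
theorem bottom_edgeMap_down (h : α ≻ β) (hβ : finrank ℂ β.T = n) (hα : finrank ℂ α.T = n + 1)
    (z : α.Term V (n + 1)) :
    bottom V B hβ (edgeMap φ 𝒱 α β n z) = 𝒱.A β α (bottom V A hα z) := by
  suffices H : bottom V B hβ ∘ₗ edgeMap φ 𝒱 α β n = 𝒱.A β α ∘ₗ bottom V A hα from
    LinearMap.congr_fun H z
  refine term_ext_ιMulti fun s t w v => ?_
  rw [LinearMap.comp_apply, LinearMap.comp_apply, bottom_edgeMap_pure B φ 𝒱 (Or.inl h), bottom_pure,
    map_smul, pullForm_ιMulti]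
  subst hβ
  congr 2
  rw [← sum_piDown φ h hα rfl w]
  refine Finset.sum_congr rfl fun i _ => ?_
  rw [φ.pairing_down h, φ.π_down h]
  congr 3
  funext j
  exact Subtype.ext (φ.shift_down_fst h (Or.inl h) _)

/-- For `β ≻ α`, the image of the edge map has no component of total degree zero, since the vectors
parallel to `α` span a space whose dimension is less than that of `β`. -/
theorem bottom_edgeMap_up (h : β ≻ α) (hβ : finrank ℂ β.T = n) (z : α.Term V (n + 1)) :
    bottom V B hβ (edgeMap φ 𝒱 α β n z) = 0 := by
  suffices H : bottom V B hβ ∘ₗ edgeMap φ 𝒱 α β n = 0 from LinearMap.congr_fun H z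
  refine term_ext_ιMulti fun s t w v => ?_
  rw [LinearMap.comp_apply, bottom_edgeMap_pure B φ 𝒱 (Or.inr h), LinearMap.zero_apply,
    Finset.sum_eq_zero, mul_zero, zero_smul]
  intro i _
  rw [AlternatingMap.map_linearDependent, mul_zero, mul_zero]
  intro hu
  have h1 : (fun j => vectorPart β.T (φ.shift (Or.inr h) (i.removeNth t j))) =
      Submodule.inclusion h.1 ∘ fun j => vectorPart α.T (i.removeNth t j) := by
    funext j
    exact Subtype.ext (φ.shift_up_fst h (Or.inr h) _)
  rw [h1] at hu
  exact linearDependent_of_finrank_lt (by have := h.2; omega) _ (LinearIndependent.of_comp _ hu)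

end Arrangement
/-! ### Acyclicity of the kernel -/

section QuasiIso

/-- A surjective morphism of complexes of vector spaces whose kernel is acyclic is a
quasi-isomorphism. -/
theorem quasiIso_of_surjective {K L : CochainComplex (ModuleCat.{u} ℂ) ℤ} (f : K ⟶ L)
    (hf : ∀ r, Function.Surjective (f.f r).hom)
    (hk : ∀ r (x : K.X (r + 1)), (K.d (r + 1) (r + 1 + 1)).hom x = 0 → (f.f (r + 1)).hom x = 0 →
      ∃ y : K.X r, (f.f r).hom y = 0 ∧ (K.d r (r + 1)).hom y = x) : QuasiIso f := by
  have hcomm : ∀ i j (x : K.X i), (f.f j).hom ((K.d i j).hom x) = (L.d i j).hom ((f.f i).hom x) :=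
    fun i j x => (LinearMap.congr_fun (congrArg ModuleCat.Hom.hom (f.comm i j)) x).symm
  have hdd : ∀ i j k (x : K.X i), (K.d j k).hom ((K.d i j).hom x) = 0 :=
    fun i j k x => LinearMap.congr_fun (congrArg ModuleCat.Hom.hom (K.d_comp_d i j k)) x
  have hproj : ∀ A : ModuleCat.{u} ℂ, Module.Projective ℂ A := fun A =>
    have : Module.Free ℂ A := Module.Free.of_divisionRing ℂ A
    Module.Projective.of_free
  refine ⟨fun j => ?_⟩
  rw [quasiIsoAt_iff_isIso_homologyMap]
  obtain ⟨r, rfl⟩ : ∃ r, j = r + 1 := ⟨j - 1, by ring⟩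
  have hm : Mono (HomologicalComplex.homologyMap f (r + 1)) := by
    rw [HomologicalComplex.mono_homologyMap_iff_up_to_refinements f r (r + 1) (r + 1 + 1)
      (by simp) (by simp)]
    intro A x₂ hx₂ y₁ hy₁
    have := hproj A
    have hrange : ∀ a, x₂.hom a ∈ LinearMap.range (K.d r (r + 1)).hom := by
      intro a
      obtain ⟨y, hy⟩ := hf r (y₁.hom a)
      have e1 : (K.d (r + 1) (r + 1 + 1)).hom (x₂.hom a) = 0 :=
        LinearMap.congr_fun (congrArg ModuleCat.Hom.hom hx₂) a
      have e2 : (f.f (r + 1)).hom (x₂.hom a) = (L.d r (r + 1)).hom (y₁.hom a) :=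
        LinearMap.congr_fun (congrArg ModuleCat.Hom.hom hy₁) a
      obtain ⟨z, -, hz⟩ := hk r (x₂.hom a - (K.d r (r + 1)).hom y)
        (by rw [map_sub, e1, hdd, sub_zero]) (by rw [map_sub, hcomm, hy, e2, sub_self])
      exact ⟨z + y, by rw [map_add, hz, sub_add_cancel]⟩
    obtain ⟨g, hg⟩ := Module.projective_lifting_property (K.d r (r + 1)).hom.rangeRestrict
      (x₂.hom.codRestrict _ hrange) (LinearMap.surjective_rangeRestrict _)
    refine ⟨A, 𝟙 A, inferInstance, ModuleCat.ofHom g, ?_⟩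
    ext a
    have h := congrArg Subtype.val (LinearMap.congr_fun hg a)
    exact h.symm
  have he : Epi (HomologicalComplex.homologyMap f (r + 1)) := by
    rw [HomologicalComplex.epi_homologyMap_iff_up_to_refinements f r (r + 1) (r + 1 + 1)
      (by simp) (by simp)]
    intro A y₂ hy₂
    have := hproj A
    let q : LinearMap.ker (K.d (r + 1) (r + 1 + 1)).hom →ₗ[ℂ]
        LinearMap.ker (L.d (r + 1) (r + 1 + 1)).hom :=
      (f.f (r + 1)).hom.restrict fun x hx => by
        rw [LinearMap.mem_ker] at hx ⊢
        rw [← hcomm, hx, map_zero]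
    have hq : Function.Surjective q := by
      rintro ⟨y, hy⟩
      obtain ⟨x, rfl⟩ := hf (r + 1) y
      rw [LinearMap.mem_ker, ← hcomm] at hy
      obtain ⟨z, hz, hz'⟩ := hk (r + 1) ((K.d (r + 1) (r + 1 + 1)).hom x) (hdd _ _ _ _) hy
      refine ⟨⟨x - z, ?_⟩, Subtype.ext ?_⟩
      · rw [LinearMap.mem_ker, map_sub, hz', sub_self]
      · change (f.f (r + 1)).hom (x - z) = _
        rw [map_sub, hz, sub_zero]
    obtain ⟨g, hg⟩ := Module.projective_lifting_property q
      (y₂.hom.codRestrict (LinearMap.ker (L.d (r + 1) (r + 1 + 1)).hom)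
        fun a => LinearMap.congr_fun (congrArg ModuleCat.Hom.hom hy₂) a) hq
    refine ⟨A, 𝟙 A, inferInstance, ModuleCat.ofHom (Submodule.subtype _ ∘ₗ g), ?_, 0, ?_⟩
    · ext a
      exact (g a).2
    · rw [Limits.zero_comp, add_zero]
      ext a
      have h := congrArg Subtype.val (LinearMap.congr_fun hg a)
      exact h.symm
  exact isIso_of_mono_of_epi _

end QuasiIso

namespace Arrangement

variable {N : ℕ} {𝒞 : Arrangement N} {V : 𝒞.Vertex → Type u}

section Algebraic

variable [∀ α, AddCommGroup (V α)] [∀ α, Module ℂ (V α)] {n : ℕ}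
  (φ : EdgeFraming 𝒞) (𝒱 : Quiver 𝒞 V) (A : ∀ α : 𝒞.Vertex, AdaptedBasis α.T)

theorem sum_dite_eq_sum_subtype {ι M : Type*} [Fintype ι] [AddCommMonoid M] (p : ι → Prop)
    [DecidablePred p] (f : ∀ i, p i → M) :
    ∑ i, (if h : p i then f i h else 0) = ∑ i : {i // p i}, f i.1 i.2 := by
  rw [← Finset.sum_filter_of_ne (p := p) fun i _ hi => by
      by_contra hc
      exact hi (dif_neg hc),
    Finset.sum_subtype (p := p) _ (by simp)]
  exact Finset.sum_congr rfl fun i _ => dif_pos i.2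

/-- The projections intertwine the differential of the de Rham complex with that of the quiver
complex, up to the sign. -/
theorem bottom_dDR (z : DRTerm V (n + 1)) (β : 𝒞.Vertex) (hβ : finrank ℂ β.T = n) :
    bottom V (A β) hβ (dDR φ 𝒱 n z β) =
      - ∑ α : {α : 𝒞.Vertex // finrank ℂ α.T = n + 1},
        𝒱.A β α.1 (bottom V (A α.1) α.2 (z α.1)) := by
  classical
  have h : ∀ α : 𝒞.Vertex, bottom V (A β) hβ (edgeMap φ 𝒱 α β n (z α)) =
      if h : finrank ℂ α.T = n + 1 then 𝒱.A β α (bottom V (A α) h (z α)) else 0 := by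
    intro α
    by_cases h1 : α ≻ β
    · have h2 : finrank ℂ α.T = n + 1 := by rw [h1.2, hβ]
      rw [dif_pos h2, bottom_edgeMap_down (A α) (A β) φ 𝒱 h1 hβ h2]
    · by_cases h2 : β ≻ α
      · rw [bottom_edgeMap_up (A β) φ 𝒱 h2 hβ, dif_neg]
        have := h2.2
        omega
      · rw [edgeMap_eq_zero φ 𝒱 (by tauto), LinearMap.zero_apply, map_zero,
          𝒱.A_eq_zero β α (by tauto)]
        split_ifs <;> simp
  rw [dDR_apply, map_sub, bottom_koszulTerm, zero_sub, map_sum, Finset.sum_congr rfl fun α _ => h α]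
  rw [sum_dite_eq_sum_subtype]

/-- An element of a term of the de Rham complex has no component of total degree zero. -/
def BottomZero (z : DRTerm V n) : Prop :=
  ∀ (α : 𝒞.Vertex) (h : finrank ℂ α.T = n), bottom V (A α) h (z α) = 0

theorem BottomZero.dDR {z : DRTerm V (n + 1)} (hz : BottomZero A z) :
    BottomZero A (dDR φ 𝒱 n z) := by
  intro β hβ
  rw [bottom_dDR, Finset.sum_eq_zero fun α _ => by rw [hz α.1 α.2, map_zero], neg_zero]

theorem bottomZero_totalHomotopy (z : DRTerm V n) : BottomZero A (totalHomotopy V A n z) :=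
  fun α h => bottom_homotopy (A α) h (z α)

theorem bottomZero_iff {z : DRTerm V n} :
    BottomZero A z ↔ ∀ i k, order k + indexWeight A n i = 0 → coeffs A n z i k = 0 := by
  constructor
  · rintro hz ⟨α, J⟩ k hk
    obtain ⟨hk, hJ⟩ := Nat.add_eq_zero_iff.mp hk
    rw [order_eq_zero] at hk
    have hJ' : J.1 = (A α).τ := (A α).weight_eq_zero.mp hJ
    have h : finrank ℂ α.T = n := by rw [← (A α).card_eq, ← hJ']; exact J.2
    have : J = (A α).topIndex h := Subtype.ext hJ'
    rw [hk, this]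
    exact hz α h
  · intro hz α h
    refine hz ⟨α, (A α).topIndex h⟩ 0 ?_
    have h1 : indexWeight A n ⟨α, (A α).topIndex h⟩ = 0 := (A α).weight_eq_zero.mpr rfl
    rw [h1, order_eq_zero.mpr rfl]

theorem exists_bottom_eq (y : ∀ α : 𝒞.Vertex, finrank ℂ α.T = n → V α) :
    ∃ z : DRTerm V n, ∀ α h, bottom V (A α) h (z α) = y α h := by
  classical
  refine ⟨fun α => if h : finrank ℂ α.T = n then
    inclusion V (A α) (y α h) ((A α).topIndex h) (monomialForm 0) else 0, fun α h => ?_⟩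
  beta_reduce
  rw [dif_pos h, bottom, coeff_inclusion, if_pos rfl, taylorCoeff_monomialForm, if_pos rfl, one_smul]

end Algebraic

variable [∀ α, NormedAddCommGroup (V α)] [∀ α, NormedSpace ℂ (V α)]
  [∀ α, FiniteDimensional ℂ (V α)] {φ : EdgeFraming 𝒞} {𝒱 : Quiver 𝒞 V}
  {A : ∀ α : 𝒞.Vertex, AdaptedBasis α.T} {n : ℕ} {δ : ℝ}

theorem eq_of_coeffs {z z' : DRTerm V n} (h : ∀ i k, coeffs A n z i k = coeffs A n z' i k) :
    z = z' := by
  funext α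
  rw [← sub_eq_zero]
  refine eq_zero_of_coeff (A α) _ fun J k => ?_
  rw [map_sub, sub_eq_zero]
  exact h ⟨α, J⟩ k

/-- On the kernel of the projection the anticommutator is injective. -/
theorem laplacian_eq_zero
    (H : LadderBound (indexWeight A n) δ (mulPart φ 𝒱 A n) (derPart φ 𝒱 A n)) {z : DRTerm V n}
    (hz : BottomZero A z) (h : laplacian φ 𝒱 A n z = 0) : z = 0 := by
  have h0 : coeffs A n z = 0 := H.eq_zero ((bottomZero_iff A).mp hz) fun i k => by
    have h1 := coeffs_laplacian φ 𝒱 A n z i k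
    rw [h] at h1
    have h2 : coeffs A n (0 : DRTerm V n) i k = 0 := map_zero _
    rw [h2] at h1
    exact sub_eq_zero.mp h1.symm
  refine eq_of_coeffs (A := A) fun i k => ?_
  rw [h0]
  exact (map_zero _).symm

/-- On the kernel of the projection the anticommutator is surjective. -/
theorem exists_laplacian_eq
    (H : LadderBound (indexWeight A n) δ (mulPart φ 𝒱 A n) (derPart φ 𝒱 A n)) {z : DRTerm V n}
    (hz : BottomZero A z) : ∃ w, BottomZero A w ∧ laplacian φ 𝒱 A n w = z := by
  obtain ⟨a, ha0, ha, hd⟩ := H.exists_sol ((bottomZero_iff A).mp hz)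
    fun i => decay_coeff (A i.1) (z i.1) i.2
  choose w hw using fun α => exists_coeff_eq (A α) fun J => hd ⟨α, J⟩
  have hw' : coeffs A n w = a := funext fun i => funext fun k => hw i.1 i.2 k
  refine ⟨w, (bottomZero_iff A).mpr fun i k h => by rw [hw', ha0 i k h],
    eq_of_coeffs (A := A) fun i k => ?_⟩
  rw [coeffs_laplacian, hw', ha i k, add_sub_cancel_left]

/-- The kernel of the projection is acyclic in the lowest degree. -/
theorem exists_dDR_eq_zero
    (H : ∀ n, ∃ δ, LadderBound (indexWeight A n) δ (mulPart φ 𝒱 A n) (derPart φ 𝒱 A n))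
    {z : DRTerm V 0} (hz : BottomZero A z) : ∃ y, BottomZero A y ∧ dDR φ 𝒱 0 y = z := by
  obtain ⟨δ, H0⟩ := H 0
  obtain ⟨w, -, hw⟩ := exists_laplacian_eq H0 hz
  exact ⟨_, bottomZero_totalHomotopy A w, hw⟩

/-- The kernel of the projection is acyclic. -/
theorem exists_dDR_eq_succ
    (H : ∀ n, ∃ δ, LadderBound (indexWeight A n) δ (mulPart φ 𝒱 A n) (derPart φ 𝒱 A n))
    {z : DRTerm V (n + 1)} (hz : BottomZero A z) (hd : dDR φ 𝒱 n z = 0) :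
    ∃ y, BottomZero A y ∧ dDR φ 𝒱 (n + 1) y = z := by
  obtain ⟨δ, H1⟩ := H (n + 1)
  obtain ⟨δ', H0⟩ := H n
  obtain ⟨w, hw0, hw⟩ := exists_laplacian_eq H1 hz
  have h1 : dDR φ 𝒱 n w = 0 := laplacian_eq_zero H0 (hw0.dDR φ 𝒱 A)
    (by rw [laplacian_dDR, hw, hd])
  refine ⟨_, bottomZero_totalHomotopy A w, ?_⟩
  rw [laplacian, LinearMap.add_apply, LinearMap.comp_apply, LinearMap.comp_apply, h1, map_zero,
    add_zero] at hw
  exact hw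

end Arrangement
/-! ### The comparison morphism -/

namespace Arrangement

variable {N : ℕ} {𝒞 : Arrangement N} {V : 𝒞.Vertex → Type u}

section Comparison

variable [∀ α, AddCommGroup (V α)] [∀ α, Module ℂ (V α)]
  (φ : EdgeFraming 𝒞) (𝒱 : Quiver 𝒞 V) (A : ∀ α : 𝒞.Vertex, AdaptedBasis α.T)

/-- The differential of the quiver complex, with a target whose degree need not be syntactically the
successor of the degree of the source. -/
def dQuiverTo (i j : ℤ) : QuiverObj V i →ₗ[ℂ] QuiverObj V j :=
  LinearMap.pi fun β => ∑ α : {α : 𝒞.Vertex // (α.codim : ℤ) = i}, 𝒱.A β.1 α.1 ∘ₗ LinearMap.proj α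

theorem quiverComplex_d {i j : ℤ} (h : i + 1 = j) :
    (quiverComplex 𝒱).d i j = ModuleCat.ofHom (dQuiverTo 𝒱 i j) := by
  subst h
  exact CochainComplex.of_d (fun k => ModuleCat.of ℂ (QuiverObj V k))
    (fun k => ModuleCat.ofHom (dQuiver 𝒱 k)) i

theorem deRhamComplex_d (r : ℤ) :
    (deRhamComplex φ 𝒱).d r (r + 1) = ModuleCat.ofHom (dDRInt φ 𝒱 r) :=
  CochainComplex.of_d (fun r => ModuleCat.of ℂ (DRObj V r))
    (fun r => ModuleCat.ofHom (dDRInt φ 𝒱 r)) r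

theorem Vertex.finrank_eq_neg {α : 𝒞.Vertex} {r : ℤ} (h : (α.codim : ℤ) = r + N) :
    ((finrank ℂ α.T : ℕ) : ℤ) = -r := by
  have := α.codim_add
  omega

theorem Vertex.codim_eq_add {α : 𝒞.Vertex} {r : ℤ} (h : ((finrank ℂ α.T : ℕ) : ℤ) = -r) :
    (α.codim : ℤ) = r + N := by
  have := α.codim_add
  omega

variable (N) in
/-- The sign in degree `r` of the comparison map. It makes up for the sign `-1` of the edge maps in the
differential `d₁ - d₀` and for the sign `(-1) ^ N` of the differential of the shifted complex. -/
def compSign (r : ℤ) : ℂ := ((-1) ^ (N + 1)) ^ r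

theorem compSign_ne_zero (r : ℤ) : compSign N r ≠ 0 :=
  zpow_ne_zero _ (pow_ne_zero _ (neg_ne_zero.mpr one_ne_zero))

theorem compSign_succ (r : ℤ) : compSign N (r + 1) = - ((-1) ^ N * compSign N r) := by
  rw [compSign, zpow_add_one₀ (pow_ne_zero _ (neg_ne_zero.mpr one_ne_zero)), compSign, pow_succ]
  ring

/-- The comparison map from the complex of global sections to the shifted quiver complex. -/
def compMap (r : ℤ) : DRObj V r →ₗ[ℂ] QuiverObj V (r + N) :=
  LinearMap.pi fun α => compSign N r • (bottom V (A α.1) rfl ∘ₗ LinearMap.proj α.1 ∘ₗ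
    LinearMap.proj (⟨finrank ℂ α.1.T, Vertex.finrank_eq_neg α.2⟩ : {n : ℕ // (n : ℤ) = -r}))

theorem compMap_apply (r : ℤ) (z : DRObj V r) (α : {α : 𝒞.Vertex // (α.codim : ℤ) = r + N})
    (n : {n : ℕ // (n : ℤ) = -r}) (h : finrank ℂ α.1.T = n.1) :
    compMap A r z α = compSign N r • bottom V (A α.1) h (z n α.1) := by
  obtain ⟨n, hn⟩ := n
  simp only at h
  subst h
  rfl

/-- The sign `(-1) ^ N` is that of the differential of a complex shifted by `N`. -/
theorem compMap_dDRInt (r : ℤ) (z : DRObj V r) :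
    compMap A (r + 1) (dDRInt φ 𝒱 r z) =
      (-1 : ℂ) ^ N • dQuiverTo 𝒱 (r + N) (r + 1 + N) (compMap A r z) := by
  funext β
  have hβ := Vertex.finrank_eq_neg β.2
  have hr : ((finrank ℂ β.1.T + 1 : ℕ) : ℤ) = -r := by push_cast; omega
  rw [compMap_apply A (r + 1) _ β ⟨finrank ℂ β.1.T, hβ⟩ rfl]
  have h1 : dDRInt φ 𝒱 r z ⟨finrank ℂ β.1.T, hβ⟩ =
      dDR φ 𝒱 (finrank ℂ β.1.T) (z ⟨finrank ℂ β.1.T + 1, hr⟩) := rfl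
  have h2 : ((-1 : ℂ) ^ N • dQuiverTo 𝒱 (r + N) (r + 1 + N) (compMap A r z)) β =
      (-1 : ℂ) ^ N • ∑ α : {α : 𝒞.Vertex // (α.codim : ℤ) = r + N},
        𝒱.A β.1 α.1 (compMap A r z α) := by
    simp only [dQuiverTo, Pi.smul_apply, LinearMap.pi_apply, LinearMap.sum_apply,
      LinearMap.comp_apply, LinearMap.proj_apply]
  rw [h1, h2, bottom_dDR, compSign_succ, smul_neg, neg_smul, neg_neg, mul_smul]
  congr 1
  rw [Finset.smul_sum]
  have e : ∀ α : 𝒞.Vertex, finrank ℂ α.T = finrank ℂ β.1.T + 1 ↔ (α.codim : ℤ) = r + N := by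
    intro α
    have := α.codim_add
    omega
  refine Fintype.sum_equiv (Equiv.subtypeEquivRight e) _ _ fun α => ?_
  rw [compMap_apply A r z _ ⟨finrank ℂ β.1.T + 1, hr⟩ α.2, map_smul]
  rfl

/-- The comparison morphism from the complex of global sections to the shifted quiver complex. -/
def comparison : deRhamComplex φ 𝒱 ⟶ (quiverComplex 𝒱)⟦(N : ℤ)⟧ where
  f r := ModuleCat.ofHom (compMap A r)
  comm' i j hij := by
    have hij' : i + 1 = j := hij
    subst hij'
    rw [CochainComplex.shiftFunctor_obj_d', deRhamComplex_d,
      quiverComplex_d 𝒱 (show i + (N : ℤ) + 1 = i + 1 + N by ring)]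
    ext z
    have hs : (N : ℤ).negOnePow • dQuiverTo 𝒱 (i + N) (i + 1 + N) (compMap A i z) =
        (-1 : ℂ) ^ N • dQuiverTo 𝒱 (i + N) (i + 1 + N) (compMap A i z) := by
      rw [Int.negOnePow_def, zpow_natCast, Units.smul_def, Units.val_pow_eq_pow_val,
        ← Int.cast_smul_eq_zsmul ℂ]
      simp
    exact hs.trans (compMap_dDRInt φ 𝒱 A i z).symm

theorem compMap_surjective (r : ℤ) : Function.Surjective (compMap (V := V) A r) := by
  intro y
  choose z hz using fun n : {n : ℕ // (n : ℤ) = -r} => exists_bottom_eq A (n := n.1)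
    fun α h => (compSign N r)⁻¹ • y ⟨α, Vertex.codim_eq_add (by rw [h]; exact n.2)⟩
  refine ⟨z, funext fun α => ?_⟩
  rw [compMap_apply A r z α ⟨finrank ℂ α.1.T, Vertex.finrank_eq_neg α.2⟩ rfl]
  refine (congrArg (compSign N r • ·)
    (hz ⟨finrank ℂ α.1.T, Vertex.finrank_eq_neg α.2⟩ α.1 rfl)).trans ?_
  exact smul_inv_smul₀ (compSign_ne_zero r) (y α)

theorem compMap_eq_zero_iff {r : ℤ} {z : DRObj V r} :
    compMap A r z = 0 ↔ ∀ n, BottomZero A (z n) := by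
  constructor
  · intro h n α hα
    have h1 := congrFun h ⟨α, Vertex.codim_eq_add (by rw [hα]; exact n.2)⟩
    rw [compMap_apply A r z _ n hα] at h1
    exact (smul_eq_zero.mp h1).resolve_left (compSign_ne_zero r)
  · intro h
    funext α
    rw [compMap_apply A r z α ⟨finrank ℂ α.1.T, Vertex.finrank_eq_neg α.2⟩ rfl, h _ α.1 rfl,
      smul_zero]
    rfl

/-- The complex of global sections does not depend on the edge framing. -/
theorem deRhamComplex_eq (φ φ₀ : EdgeFraming 𝒞) : deRhamComplex φ 𝒱 = deRhamComplex φ₀ 𝒱 := by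
  have : ∀ r, dDRInt φ 𝒱 r = dDRInt φ₀ 𝒱 r := fun r => by
    simp only [dDRInt, dDR_eq_dDR φ φ₀]
  simp only [deRhamComplex, this]

end Comparison

variable [∀ α, NormedAddCommGroup (V α)] [∀ α, NormedSpace ℂ (V α)]
  [∀ α, FiniteDimensional ℂ (V α)] {φ : EdgeFraming 𝒞} {𝒱 : Quiver 𝒞 V}
  {A : ∀ α : 𝒞.Vertex, AdaptedBasis α.T}

theorem exists_dDRInt_eq
    (H : ∀ n, ∃ δ, LadderBound (indexWeight A n) δ (mulPart φ 𝒱 A n) (derPart φ 𝒱 A n)) {r : ℤ}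
    {x : DRObj V (r + 1)} (hd : dDRInt φ 𝒱 (r + 1) x = 0) (hx : compMap A (r + 1) x = 0) :
    ∃ y : DRObj V r, compMap A r y = 0 ∧ dDRInt φ 𝒱 r y = x := by
  rw [compMap_eq_zero_iff] at hx
  have key : ∀ n : {n : ℕ // (n : ℤ) = -r}, ∃ y : DRTerm V n.1, BottomZero A y ∧
      ∀ (m : {m : ℕ // (m : ℤ) = -(r + 1)}) (hm : n.1 = m.1 + 1), dDR φ 𝒱 m.1 (hm ▸ y) = x m := by
    rintro ⟨n, hn⟩
    cases n with
    | zero => exact ⟨0, fun α h => map_zero _, fun m hm => absurd hm (by simp)⟩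
    | succ n =>
      have hn' : (n : ℤ) = -(r + 1) := by push_cast at hn; omega
      have : ∃ y : DRTerm V (n + 1), BottomZero A y ∧ dDR φ 𝒱 n y = x ⟨n, hn'⟩ := by
        cases n with
        | zero => exact exists_dDR_eq_zero H (hx _)
        | succ n =>
          exact exists_dDR_eq_succ H (hx _)
            (congrFun hd (⟨n, by push_cast at hn'; omega⟩ : {m : ℕ // (m : ℤ) = -(r + 1 + 1)}))
      obtain ⟨y, hy, hy'⟩ := this
      refine ⟨y, hy, ?_⟩
      rintro ⟨m, hm'⟩ hm
      obtain rfl : n = m := Nat.succ.inj hm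
      exact hy'
  choose y hy hy' using key
  exact ⟨y, (compMap_eq_zero_iff A).mpr hy, funext fun m =>
    hy' ⟨m.1 + 1, by have := m.2; push_cast; omega⟩ m rfl⟩

/-- The comparison morphism is a quasi-isomorphism if the perturbation is small in every degree. -/
theorem quasiIso_comparison
    (H : ∀ n, ∃ δ, LadderBound (indexWeight A n) δ (mulPart φ 𝒱 A n) (derPart φ 𝒱 A n)) :
    QuasiIso (comparison φ 𝒱 A) := by
  refine quasiIso_of_surjective _ (compMap_surjective A) fun r x hd hx => ?_
  rw [deRhamComplex_d] at hd
  obtain ⟨y, hy, hy'⟩ := exists_dDRInt_eq H hd hx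
  refine ⟨y, hy, ?_⟩
  rw [deRhamComplex_d]
  exact hy'

end Arrangement

end QuiverDR

end

theorem theorem5p6 {N : ℕ} (𝒞 : QuiverDR.Arrangement N) :
    ∃ ε : ℝ, 0 < ε ∧ ∀ (V : 𝒞.Vertex → Type u) [∀ α, NormedAddCommGroup (V α)]
      [∀ α, NormedSpace ℂ (V α)] [∀ α, FiniteDimensional ℂ (V α)]
      (𝒱 : 𝒞.Quiver V) (φ : 𝒞.EdgeFraming),
      (∀ (α β : 𝒞.Vertex) (v : V β), ‖𝒱.A α β v‖ ≤ ε * ‖v‖) →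
      ∃ f : QuiverDR.Arrangement.deRhamComplex φ 𝒱 ⟶
        (QuiverDR.Arrangement.quiverComplex 𝒱)⟦(N : ℤ)⟧, QuasiIso f := by
  -- the complex does not depend on the framing, so `ε` may be chosen for a fixed framing
  obtain ⟨φ₀⟩ := (inferInstance : Nonempty 𝒞.EdgeFraming)
  let A : ∀ α : 𝒞.Vertex, QuiverDR.AdaptedBasis α.T := fun α =>
    (QuiverDR.nonempty_adaptedBasis α.T).some
  obtain ⟨ε, hε, h⟩ := QuiverDR.Arrangement.exists_ladderBound.{u} φ₀ A
  refine ⟨ε, hε, fun V _ _ _ 𝒱 φ hA => ?_⟩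
  rw [QuiverDR.Arrangement.deRhamComplex_eq 𝒱 φ φ₀]
  exact ⟨_, QuiverDR.Arrangement.quasiIso_comparison (h V 𝒱 hA)⟩
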